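/- Let $d$ be a real number with $d^2\ge 4$. Let $\mathcal O_d$ be the following $\mathbb C$-linear strict tensor category. Its objects are the words $w$ in two letters $X, X^*$, with tensor product given by concatenation and unit $I$ the empty word. $\mathrm{Hom}(w,w')$ is the free complex vector space on the oriented Kauffman diagrams of type $(w,w')$, that is, the planar (non-crossing) systems of disjoint oriented arcs, up to isotopy and without closed loops, joining in pairs the letters of $w$ (on the upper side) and of $w'$ (on the lower side), with orientations compatible with the letters: an arc joining the upper to the lower side joins equal letters, and an arc joining two points of the same side joins an $X$ with an $X^*$. Composition is concatenation of diagrams, every closed loop that arises being replaced by the factor $d$; the tensor product of morphisms is horizontal juxtaposition. Equip $\mathcal O_d$ with its C*-structure, namely the conjugate-linear extension of $$D^*=\Big(\frac{d}{|d|}\Big)^{\sharp(D)}D',$$ where $D'$ is the reflection of $D$ with orientation reversed, and $\sharp(D)$ is the number of arcs of $D$ joining two upper points minus the number of arcs joining two lower points. Let $\epsilon_{X^*}\in\mathrm{Hom}(X^*\otimes X, I)$ be the diagram consisting of a single arc. A unitary fiber functor on $\mathcal O_d$ is a $\mathbb C$-linear tensor functor $\Phi$ from $\mathcal O_d$ to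 the tensor category of finite-dimensional complex Hilbert spaces whose structure isomorphisms $\mathbb C\cong\Phi(I)$ and $\Phi(w)\otimes\Phi(w')\cong\Phi(w\otimes w')$ are unitary and which satisfies $\Phi(f^*)=\Phi(f)^*$ for all morphisms $f$. Two such functors are equivalent if there is a monoidal natural isomorphism between them all of whose components are unitary. For a unitary fiber functor $\Phi$ let $B$ be the matrix of the bilinear form $\Phi(X^*)\otimes\Phi(X)\cong\Phi(X^*\otimes X)\xrightarrow{\Phi(\epsilon_{X^*})}\Phi(I)\cong\mathbb C$ with respect to orthonormal bases of $\Phi(X^*)$ and $\Phi(X)$. Then the list (with multiplicities, up to order) $\{\mu_1,\dots,\mu_n\}$ of the eigenvalues of $|B|=(B^*B)^{1/2}$ does not depend on the choice of the orthonormal bases and depends only on the equivalence class of $\Phi$, and $\Phi\mapsto\{\mu_1,\dots,\mu_n\}$ is a bijection from the set of equivalence classes of unitary fiber functors on $\mathcal O_d$ onto the set of all finite lists (up to order) of positive real numbers satisfying $$\sum_{j}\mu_j^2=|d|=\sum_j\mu_j^{-2}.$$ -/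

import Mathlib

namespace OrientedKauffman

section Partitions

variable {α β γ δ A B C D : Type}

theorem map_sup (f : α → β) (r s : Setoid α) : (r ⊔ s).map f = r.map f ⊔ s.map f := by
  have gc : GaloisConnection (fun r : Setoid α => r.map f) (fun s => s.comap f) := by
    intro r s
    constructor
    · intro h x y hxy
      exact h (Relation.EqvGen.rel _ _ ⟨_, _, hxy, rfl, rfl⟩)
    · intro h
      refine Setoid.eqvGen_le ?_
      rintro _ _ ⟨a, b, hab, rfl, rfl⟩
      exact h hab
  exact gc.l_sup

theorem map_le_iff (f : α → β) (r : Setoid α) (s : Setoid β) :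
    r.map f ≤ s ↔ r ≤ s.comap f := by
  constructor
  · intro h x y hxy
    exact h (Relation.EqvGen.rel _ _ ⟨_, _, hxy, rfl, rfl⟩)
  · intro h
    refine Setoid.eqvGen_le ?_
    rintro _ _ ⟨a, b, hab, rfl, rfl⟩
    exact h hab

theorem map_map (f : α → β) (g : β → γ) (r : Setoid α) : (r.map f).map g = r.map (g ∘ f) := by
  apply eq_of_forall_ge_iff
  intro c
  rw [map_le_iff, map_le_iff, map_le_iff, Setoid.comap_comp]

theorem map_rel {f : α → β} (hf : f.Injective) (r : Setoid α) (x y : β) :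
    r.map f x y ↔ (∃ a b, r a b ∧ f a = x ∧ f b = y) ∨ x = y := by
  rw [Setoid.coe_map_of_ker_le r f (by rw [Setoid.ker_eq_bot_iff.2 hf]; exact bot_le)]
  rfl

theorem comap_sup_map (f : α → β) (E : Setoid β) (G : Setoid α) :
    (E ⊔ G.map f).comap f = E.comap f ⊔ G := by
  apply le_antisymm
  · have key : ∀ p q, (E ⊔ G.map f) p q → ∀ x, E (f x) p →
        ∃ z, (E.comap f ⊔ G) x z ∧ E (f z) q := by
      have h2 : E ⊔ G.map f =
          Relation.EqvGen.setoid (fun p q => E p q ∨ ∃ a b, G a b ∧ f a = p ∧ f b = q) := by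
        apply le_antisymm
        · refine sup_le ?_ ?_
          · intro p q h
            exact Relation.EqvGen.rel _ _ (Or.inl h)
          · rw [map_le_iff]
            intro p q h
            exact Relation.EqvGen.rel _ _ (Or.inr ⟨_, _, h, rfl, rfl⟩)
        · refine Setoid.eqvGen_le ?_
          rintro p q (h | ⟨a, b, h, rfl, rfl⟩)
          · exact (le_sup_left : E ≤ E ⊔ G.map f) h
          · exact (le_sup_right : G.map f ≤ E ⊔ G.map f)
              (Relation.EqvGen.rel _ _ ⟨_, _, h, rfl, rfl⟩)
      rw [h2]
      intro p q h
      have : (∀ x, E (f x) p → ∃ z, (E.comap f ⊔ G) x z ∧ E (f z) q) ∧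
          (∀ x, E (f x) q → ∃ z, (E.comap f ⊔ G) x z ∧ E (f z) p) := by
        have hG : G ≤ E.comap f ⊔ G := le_sup_right
        have hE : E.comap f ≤ E.comap f ⊔ G := le_sup_left
        induction h with
        | rel p q h =>
          rcases h with h | ⟨a, b, h, rfl, rfl⟩
          · exact ⟨fun x hx => ⟨x, Setoid.refl' _ _, E.trans' hx h⟩,
              fun x hx => ⟨x, Setoid.refl' _ _, E.trans' hx (E.symm' h)⟩⟩
          · exact ⟨fun x hx => ⟨b, Setoid.trans' _ (hE hx) (hG h), Setoid.refl' _ _⟩,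
              fun x hx => ⟨a, Setoid.trans' _ (hE hx) (hG (G.symm' h)), Setoid.refl' _ _⟩⟩
        | refl p => exact ⟨fun x hx => ⟨x, Setoid.refl' _ _, hx⟩,
            fun x hx => ⟨x, Setoid.refl' _ _, hx⟩⟩
        | symm p q _ ih => exact ⟨ih.2, ih.1⟩
        | trans p q r _ _ ih1 ih2 =>
          constructor
          · intro x hx
            obtain ⟨z, hz, hz'⟩ := ih1.1 x hx
            obtain ⟨u, hu, hu'⟩ := ih2.1 z hz'
            exact ⟨u, Setoid.trans' _ hz hu, hu'⟩
          · intro x hx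
            obtain ⟨z, hz, hz'⟩ := ih2.2 x hx
            obtain ⟨u, hu, hu'⟩ := ih1.2 z hz'
            exact ⟨u, Setoid.trans' _ hz hu, hu'⟩
      exact this.1
    intro x y h
    obtain ⟨z, hz, hz'⟩ := key _ _ h x (Setoid.refl' _ _)
    exact Setoid.trans' _ hz ((le_sup_left : E.comap f ≤ E.comap f ⊔ G) hz')
  · refine sup_le ?_ ?_
    · intro x y h
      exact (le_sup_left : E ≤ E ⊔ G.map f) h
    · rw [← map_le_iff]
      exact le_sup_right

/-- Base change along a pullback square of injections. -/
theorem comap_map {i : α → β} {j : γ → β} {k : δ → α} {o : δ → γ} (hi : i.Injective)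
    (hj : j.Injective) (hk : k.Injective) (hc : ∀ x, i (k x) = j (o x))
    (hp : ∀ a c, i a = j c → ∃ x, k x = a ∧ o x = c) (E : Setoid γ) :
    (E.map j).comap i = (E.comap o).map k := by
  ext x y
  rw [Setoid.comap_rel, map_rel hj, map_rel hk]
  constructor
  · rintro (⟨a, b, h, h1, h2⟩ | h)
    · obtain ⟨u, rfl, rfl⟩ := hp _ _ h1.symm
      obtain ⟨v, rfl, rfl⟩ := hp _ _ h2.symm
      exact Or.inl ⟨u, v, h, rfl, rfl⟩
    · exact Or.inr (hi h)
  · rintro (⟨a, b, h, rfl, rfl⟩ | rfl)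
    · exact Or.inl ⟨_, _, h, (hc _).symm, (hc _).symm⟩
    · exact Or.inr rfl

/-- The number of classes of `E` that contain no point of the image of `f`. -/
noncomputable def missed (f : α → β) (E : Setoid β) : ℕ :=
  Nat.card {q : Quotient E // ∀ a, Quotient.mk E (f a) ≠ q}

theorem missed_comp [Finite α] [Finite β] (i : α → β) (o : γ → α) (E : Setoid β) :
    missed (i ∘ o) E = missed i E + missed o (E.comap i) := by
  classical
  unfold missed
  rw [← Nat.card_sum]
  symm
  let F : {q : Quotient E // ∀ a, Quotient.mk E (i a) ≠ q} ⊕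
      {q : Quotient (E.comap i) // ∀ a, Quotient.mk (E.comap i) (o a) ≠ q} →
      {q : Quotient E // ∀ a, Quotient.mk E ((i ∘ o) a) ≠ q} :=
    Sum.elim (fun q => ⟨q.1, fun a => q.2 (o a)⟩)
      (fun q => ⟨Quotient.map' i (fun _ _ h => h) q.1, by
        rcases q with ⟨q, hq⟩
        induction q using Quotient.inductionOn with
        | h x =>
          intro a h
          have h : E (i (o a)) (i x) := Quotient.exact h
          exact hq a (Quotient.sound h)⟩)
  refine Nat.card_congr (Equiv.ofBijective F ⟨?_, ?_⟩)
  · rintro (⟨p, hp⟩ | ⟨p, hp⟩) (⟨q, hq⟩ | ⟨q, hq⟩) h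
    · have := congrArg Subtype.val h
      simp only [F, Sum.elim_inl] at this
      simp [this]
    · exfalso
      have := congrArg Subtype.val h
      simp only [F, Sum.elim_inl, Sum.elim_inr] at this
      induction q using Quotient.inductionOn with
      | h x => exact hp x this.symm
    · exfalso
      have := congrArg Subtype.val h
      simp only [F, Sum.elim_inl, Sum.elim_inr] at this
      induction p using Quotient.inductionOn with
      | h x => exact hq x this
    · have := congrArg Subtype.val h
      simp only [F, Sum.elim_inr] at this
      induction p using Quotient.inductionOn with
      | h x =>
        induction q using Quotient.inductionOn with
        | h y =>
          have h : E (i x) (i y) := Quotient.exact this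
          congr 2
          exact Quotient.sound h
  · rintro ⟨q, hq⟩
    by_cases h : ∃ a, Quotient.mk E (i a) = q
    · obtain ⟨a, rfl⟩ := h
      refine ⟨Sum.inr ⟨Quotient.mk _ a, fun c hc => hq c ?_⟩, rfl⟩
      have h : E.comap i (o c) a := Quotient.exact hc
      exact Quotient.sound h
    · push Not at h
      exact ⟨Sum.inl ⟨q, h⟩, rfl⟩

theorem missed_eq_zero {f : α → β} {E : Setoid β} (h : ∀ b, ∃ a, E (f a) b) :
    missed f E = 0 := by
  unfold missed
  have : IsEmpty {q : Quotient E // ∀ a, Quotient.mk E (f a) ≠ q} := by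
    constructor
    rintro ⟨q, hq⟩
    induction q using Quotient.inductionOn with
    | h x =>
      obtain ⟨a, ha⟩ := h x
      exact hq a (Quotient.sound ha)
  exact Nat.card_of_isEmpty

/-- Criterion for two partitions to have as many missed classes. -/
theorem missed_congr {f : α → β} {g : γ → δ} {E : Setoid β} {G : Setoid δ} (φ : β → δ)
    (hφ : ∀ x y, (∀ a, ¬ E (f a) x) → (E x y ↔ G (φ x) (φ y)))
    (h1 : ∀ x, (∀ a, ¬ E (f a) x) → ∀ c, ¬ G (g c) (φ x))
    (h2 : ∀ z, (∀ c, ¬ G (g c) z) → ∃ x, (∀ a, ¬ E (f a) x) ∧ G (φ x) z) :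
    missed f E = missed g G := by
  unfold missed
  have hrep : ∀ q : {q : Quotient E // ∀ a, Quotient.mk E (f a) ≠ q},
      ∃ x, Quotient.mk E x = q.1 ∧ ∀ a, ¬ E (f a) x := by
    rintro ⟨q, hq⟩
    induction q using Quotient.inductionOn with
    | h x => exact ⟨x, rfl, fun a h => hq a (Quotient.sound h)⟩
  choose r hr hr' using hrep
  refine Nat.card_congr (Equiv.ofBijective
    (fun q => ⟨Quotient.mk G (φ (r q)), fun c h => h1 _ (hr' q) c (Quotient.exact h)⟩) ⟨?_, ?_⟩)
  · intro p q h
    have h := congrArg Subtype.val h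
    have h : G (φ (r p)) (φ (r q)) := Quotient.exact h
    apply Subtype.ext
    rw [← hr p, ← hr q]
    exact Quotient.sound ((hφ _ _ (hr' p)).2 h)
  · rintro ⟨q, hq⟩
    induction q using Quotient.inductionOn with
    | h z =>
      obtain ⟨x, hx, hz⟩ := h2 z (fun c h => hq c (Quotient.sound h))
      let p : {q : Quotient E // ∀ a, Quotient.mk E (f a) ≠ q} :=
        ⟨Quotient.mk E x, fun a h => hx a (Quotient.exact h)⟩
      refine ⟨p, Subtype.ext (Quotient.sound ?_)⟩
      have : E x (r p) := E.symm' (Quotient.exact (hr p))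
      exact G.trans' (G.symm' ((hφ _ _ hx).1 this)) hz

theorem sup_map_rel_of_missed {f : α → β} {E : Setoid β} {G : Setoid α} {x y : β}
    (hx : ∀ a, ¬ E (f a) x) : (E ⊔ G.map f) x y ↔ E x y := by
  constructor
  · intro h
    let T : Setoid β :=
      { r := fun p q => E p q ∨ ((∃ a, E (f a) p) ∧ ∃ a, E (f a) q)
        iseqv := by
          refine ⟨fun p => Or.inl (E.refl' p), ?_, ?_⟩
          · rintro p q (h | h)
            · exact Or.inl (E.symm' h)
            · exact Or.inr h.symm
          · rintro p q r (h | ⟨h1, h2⟩) (h' | ⟨h1', h2'⟩)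
            · exact Or.inl (E.trans' h h')
            · obtain ⟨a, ha⟩ := h1'
              exact Or.inr ⟨⟨a, E.trans' ha (E.symm' h)⟩, h2'⟩
            · obtain ⟨a, ha⟩ := h2
              exact Or.inr ⟨h1, ⟨a, E.trans' ha h'⟩⟩
            · exact Or.inr ⟨h1, h2'⟩ }
    have hle : E ⊔ G.map f ≤ T := by
      refine sup_le (fun _ _ h => Or.inl h) ?_
      rw [map_le_iff]
      intro a b _
      exact Or.inr ⟨⟨a, E.refl' _⟩, ⟨b, E.refl' _⟩⟩
    rcases hle h with h | ⟨⟨a, ha⟩, _⟩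
    · exact h
    · exact absurd ha (hx a)
  · intro h
    exact (le_sup_left : E ≤ E ⊔ G.map f) h

theorem missed_sup_map (f : α → β) (E : Setoid β) (G : Setoid α) :
    missed f (E ⊔ G.map f) = missed f E := by
  have hle : E ≤ E ⊔ G.map f := le_sup_left
  symm
  refine missed_congr id (fun x y hx => (sup_map_rel_of_missed hx).symm) ?_ ?_
  · intro x hx c h
    exact hx c (E.symm' ((sup_map_rel_of_missed hx).1 (Setoid.symm' _ h)))
  · intro z hz
    exact ⟨z, fun a h => hz a (hle h), Setoid.refl' _ _⟩

theorem missed_map {i : α → β} {j : γ → β} {k : δ → α} {o : δ → γ}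
    (hj : j.Injective) (hc : ∀ x, i (k x) = j (o x))
    (hp : ∀ a c, i a = j c → ∃ x, k x = a ∧ o x = c)
    (hs : ∀ b, (∃ a, i a = b) ∨ ∃ c, j c = b) (E : Setoid γ) :
    missed i (E.map j) = missed o E := by
  have hr : ∀ x y, E.map j (j x) (j y) ↔ E x y := fun x y =>
    (Setoid.ext_iff.1 (Setoid.comap_map_eq j E hj) x y)
  symm
  refine missed_congr j (fun x y _ => (hr x y).symm) ?_ ?_
  · intro x hx a h
    rw [map_rel hj] at h
    rcases h with ⟨u, v, huv, h1, h2⟩ | h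
    · obtain rfl := hj h2
      obtain ⟨t, rfl, rfl⟩ := hp _ _ h1.symm
      exact hx _ huv
    · obtain ⟨t, rfl, rfl⟩ := hp _ _ h
      exact hx _ (E.refl' _)
  · intro z hz
    rcases hs z with ⟨a, rfl⟩ | ⟨c, rfl⟩
    · exact absurd (Setoid.refl' _ _) (hz a)
    · refine ⟨c, fun t h => hz (k t) ?_, Setoid.refl' _ _⟩
      rw [hc]
      exact (hr _ _).2 h

/-! Gluing of partitions. -/

/-- The inclusion of the two upper lines of points. -/
def up : A ⊕ B → A ⊕ (B ⊕ C) := Sum.map id Sum.inl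

/-- The inclusion of the two lower lines of points. -/
def low : B ⊕ C → A ⊕ (B ⊕ C) := Sum.inr

/-- The inclusion of the two outer lines of points. -/
def outer : A ⊕ C → A ⊕ (B ⊕ C) := Sum.map id Sum.inr

/-- Two partitions glued along the middle line of points. -/
def glue (M : Setoid (A ⊕ B)) (N : Setoid (B ⊕ C)) : Setoid (A ⊕ (B ⊕ C)) :=
  M.map up ⊔ N.map low

/-- The partition of the outer points obtained by concatenation. -/
def compRel (M : Setoid (A ⊕ B)) (N : Setoid (B ⊕ C)) : Setoid (A ⊕ C) :=
  (glue M N).comap outer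

/-- The number of closed components produced by concatenation. -/
noncomputable def loopCount (M : Setoid (A ⊕ B)) (N : Setoid (B ⊕ C)) : ℕ :=
  missed (outer : A ⊕ C → A ⊕ (B ⊕ C)) (glue M N)

theorem up_injective : (up : A ⊕ B → A ⊕ (B ⊕ C)).Injective :=
  Sum.map_injective.2 ⟨Function.injective_id, Sum.inl_injective⟩

theorem low_injective : (low : B ⊕ C → A ⊕ (B ⊕ C)).Injective := Sum.inr_injective

theorem outer_injective : (outer : A ⊕ C → A ⊕ (B ⊕ C)).Injective :=
  Sum.map_injective.2 ⟨Function.injective_id, Sum.inr_injective⟩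

section Assoc

/-- Levels `0,1,2` of four lines of points. -/
def l012 : A ⊕ (B ⊕ C) → A ⊕ (B ⊕ (C ⊕ D)) := Sum.map id (Sum.map id Sum.inl)
/-- Levels `0,2,3` of four lines of points. -/
def l023 : A ⊕ (C ⊕ D) → A ⊕ (B ⊕ (C ⊕ D)) := Sum.map id Sum.inr
/-- Levels `1,2,3` of four lines of points. -/
def l123 : B ⊕ (C ⊕ D) → A ⊕ (B ⊕ (C ⊕ D)) := Sum.inr
/-- Levels `0,1,3` of four lines of points. -/
def l013 : A ⊕ (B ⊕ D) → A ⊕ (B ⊕ (C ⊕ D)) := Sum.map id (Sum.map id Sum.inr)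

variable (M : Setoid (A ⊕ B)) (N : Setoid (B ⊕ C)) (P : Setoid (C ⊕ D))

/-- Three partitions glued together. -/
def glue3 : Setoid (A ⊕ (B ⊕ (C ⊕ D))) :=
  M.map (Sum.map id Sum.inl) ⊔ N.map (Sum.inr ∘ Sum.map id Sum.inl) ⊔ P.map (Sum.inr ∘ Sum.inr)

theorem glue3_left : glue3 M N P = (glue M N).map l012 ⊔ (P.map low).map l023 := by
  unfold glue3 glue
  rw [map_sup, map_map, map_map, map_map]
  congr 2
  · congr 1
    funext x
    rcases x with x | x <;> rfl
  
theorem glue3_right : glue3 M N P = (glue N P).map l123 ⊔ (M.map up).map l013 := by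
  unfold glue3 glue
  rw [map_sup, map_map, map_map, map_map, sup_comm, sup_left_comm, sup_comm]
  have h : (Sum.map id Sum.inl : A ⊕ B → A ⊕ (B ⊕ (C ⊕ D))) = l013 ∘ up := by
    funext x
    rcases x with x | x <;> rfl
  rw [h, sup_comm (P.map _)]
  rfl

theorem l012_inj : (l012 : A ⊕ (B ⊕ C) → A ⊕ (B ⊕ (C ⊕ D))).Injective := by
  rintro (x | x | x) (y | y | y) h <;> simp_all [l012]
theorem l023_inj : (l023 : A ⊕ (C ⊕ D) → A ⊕ (B ⊕ (C ⊕ D))).Injective := by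
  rintro (x | x | x) (y | y | y) h <;> simp_all [l023]
theorem l123_inj : (l123 : B ⊕ (C ⊕ D) → A ⊕ (B ⊕ (C ⊕ D))).Injective := Sum.inr_injective
theorem l013_inj : (l013 : A ⊕ (B ⊕ D) → A ⊕ (B ⊕ (C ⊕ D))).Injective := by
  rintro (x | x | x) (y | y | y) h <;> simp_all [l013]

theorem square1 (a : A ⊕ (C ⊕ D)) (c : A ⊕ (B ⊕ C)) (h : l023 a = l012 c) :
    ∃ x, up x = a ∧ outer x = c := by
  rcases a with a | a | a <;> rcases c with c | c | c <;> simp_all [l023, l012, up, outer]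

theorem square2 (a : A ⊕ (B ⊕ D)) (c : B ⊕ (C ⊕ D)) (h : l013 a = l123 c) :
    ∃ x, low x = a ∧ outer x = c := by
  rcases a with a | a | a <;> rcases c with c | c | c <;> simp_all [l013, l123, low, outer]

theorem square1_comm (x : A ⊕ C) :
    (l023 (up x : A ⊕ (C ⊕ D)) : A ⊕ (B ⊕ (C ⊕ D))) = l012 (outer x) := by
  rcases x with x | x <;> rfl

theorem square2_comm (x : B ⊕ D) :
    (l013 (low x) : A ⊕ (B ⊕ (C ⊕ D))) = l123 (outer x) := by
  rcases x with x | x <;> rfl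

theorem comap_glue3_left : (glue3 M N P).comap l023 = glue (compRel M N) P := by
  rw [glue3_left, comap_sup_map, comap_map l023_inj l012_inj up_injective square1_comm square1]
  rfl

theorem comap_glue3_right : (glue3 M N P).comap l013 = glue M (compRel N P) := by
  rw [glue3_right, comap_sup_map, comap_map l013_inj l123_inj low_injective square2_comm square2,
    sup_comm]
  rfl

theorem outer_outer : (l023 ∘ outer : A ⊕ D → A ⊕ (B ⊕ (C ⊕ D))) = l013 ∘ outer := by
  funext x
  rcases x with x | x <;> rfl

theorem compRel_assoc : compRel (compRel M N) P = compRel M (compRel N P) := by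
  unfold compRel
  change (glue (compRel M N) P).comap outer = (glue M (compRel N P)).comap outer
  rw [← comap_glue3_left, ← comap_glue3_right, ← Setoid.comap_comp, outer_outer,
    Setoid.comap_comp]

theorem loopCount_assoc [Finite A] [Finite B] [Finite C] [Finite D] :
    loopCount M N + loopCount (compRel M N) P = loopCount N P + loopCount M (compRel N P) := by
  have h1 : loopCount M N = missed l023 (glue3 M N P) := by
    rw [glue3_left, missed_sup_map, missed_map l012_inj square1_comm square1]
    · rfl
    · rintro (x | x | x | x)
      · exact Or.inl ⟨Sum.inl x, rfl⟩
      · exact Or.inr ⟨Sum.inr (Sum.inl x), rfl⟩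
      · exact Or.inl ⟨Sum.inr (Sum.inl x), rfl⟩
      · exact Or.inl ⟨Sum.inr (Sum.inr x), rfl⟩
  have h2 : loopCount N P = missed l013 (glue3 M N P) := by
    rw [glue3_right, missed_sup_map, missed_map l123_inj square2_comm square2]
    · rfl
    · rintro (x | x)
      · exact Or.inl ⟨Sum.inl x, rfl⟩
      · exact Or.inr ⟨x, rfl⟩
  rw [h1, h2]
  unfold loopCount
  rw [← comap_glue3_left, ← comap_glue3_right, ← missed_comp, ← missed_comp, outer_outer]

end Assoc

section Identity

/-- The partition of straight strings. -/
def idRel : Setoid (A ⊕ A) := Setoid.ker (Sum.elim id id)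

theorem idRel_comp (N : Setoid (A ⊕ B)) : compRel idRel N = N := by
  apply le_antisymm
  · have : glue idRel N ≤ N.comap (Sum.elim Sum.inl id) := by
      refine sup_le ?_ ?_
      · rw [map_le_iff]
        rintro (x | x) (y | y) h <;> · obtain rfl : x = y := h
                                       exact N.refl' _
      · rw [map_le_iff]
        intro x y h
        exact h
    intro x y h
    have h := this h
    rcases x with x | x <;> rcases y with y | y <;> exact h
  · have h1 : ∀ x : A ⊕ B, glue idRel N (outer x) (low x) := by
      rintro (x | x)
      · refine (le_sup_left : idRel.map up ≤ glue idRel N) ?_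
        exact Relation.EqvGen.rel _ _ ⟨Sum.inl x, Sum.inr x, rfl, rfl, rfl⟩
      · exact Setoid.refl' _ _
    intro x y h
    refine (glue idRel N).trans' (h1 x) ((glue idRel N).trans' ?_ ((glue idRel N).symm' (h1 y)))
    exact (le_sup_right : N.map low ≤ glue idRel N) (Relation.EqvGen.rel _ _ ⟨x, y, h, rfl, rfl⟩)

theorem comp_idRel (M : Setoid (A ⊕ B)) : compRel M idRel = M := by
  apply le_antisymm
  · have : glue M idRel ≤ M.comap (Sum.elim Sum.inl (Sum.elim Sum.inr Sum.inr)) := by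
      refine sup_le ?_ ?_
      · rw [map_le_iff]
        rintro (x | x) (y | y) h <;> exact h
      · rw [map_le_iff]
        rintro (x | x) (y | y) h <;> · obtain rfl : x = y := h
                                       exact M.refl' _
    intro x y h
    have h := this h
    rcases x with x | x <;> rcases y with y | y <;> exact h
  · have h1 : ∀ x : A ⊕ B, glue M idRel (outer x) (up x) := by
      rintro (x | x)
      · exact Setoid.refl' _ _
      · refine (le_sup_right : idRel.map low ≤ glue M idRel) ?_
        exact Relation.EqvGen.rel _ _ ⟨Sum.inr x, Sum.inl x, rfl, rfl, rfl⟩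
    intro x y h
    refine (glue M idRel).trans' (h1 x) ((glue M idRel).trans' ?_ ((glue M idRel).symm' (h1 y)))
    exact (le_sup_left : M.map up ≤ glue M idRel) (Relation.EqvGen.rel _ _ ⟨x, y, h, rfl, rfl⟩)

theorem loopCount_idRel_left (N : Setoid (A ⊕ B)) : loopCount idRel N = 0 := by
  refine missed_eq_zero ?_
  rintro (x | x | x)
  · exact ⟨Sum.inl x, Setoid.refl' _ _⟩
  · refine ⟨Sum.inl x, (le_sup_left : idRel.map up ≤ glue idRel N) ?_⟩
    exact Relation.EqvGen.rel _ _ ⟨Sum.inl x, Sum.inr x, rfl, rfl, rfl⟩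
  · exact ⟨Sum.inr x, Setoid.refl' _ _⟩

theorem loopCount_idRel_right (M : Setoid (A ⊕ B)) : loopCount M idRel = 0 := by
  refine missed_eq_zero ?_
  rintro (x | x | x)
  · exact ⟨Sum.inl x, Setoid.refl' _ _⟩
  · refine ⟨Sum.inr x, (le_sup_right : idRel.map low ≤ glue M idRel) ?_⟩
    exact Relation.EqvGen.rel _ _ ⟨Sum.inr x, Sum.inl x, rfl, rfl, rfl⟩
  · exact ⟨Sum.inr x, Setoid.refl' _ _⟩

end Identity

section Juxtaposition

variable {f : α → γ} {g : β → γ}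

/-- The partition of a disjoint union. -/
theorem sup_map_rel (hf : f.Injective) (hg : g.Injective) (hd : ∀ a b, f a ≠ g b)
    (E : Setoid α) (G : Setoid β) :
    (∀ a a', (E.map f ⊔ G.map g) (f a) (f a') ↔ E a a') ∧
    (∀ b b', (E.map f ⊔ G.map g) (g b) (g b') ↔ G b b') ∧
    (∀ a b, ¬ (E.map f ⊔ G.map g) (f a) (g b)) := by
  have h1 : (E.map f ⊔ G.map g).comap f = E := by
    rw [sup_comm, comap_sup_map]
    refine sup_eq_right.2 ?_
    intro x y h
    rw [Setoid.comap_rel, map_rel hg] at h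
    rcases h with ⟨a, b, _, h, _⟩ | h
    · exact absurd h.symm (hd _ _)
    · rw [hf h]
  have h2 : (E.map f ⊔ G.map g).comap g = G := by
    rw [comap_sup_map]
    refine sup_eq_right.2 ?_
    intro x y h
    rw [Setoid.comap_rel, map_rel hf] at h
    rcases h with ⟨a, b, _, h, _⟩ | h
    · exact absurd h (hd _ _)
    · rw [hg h]
  refine ⟨fun a a' => Setoid.ext_iff.1 h1 a a', fun b b' => Setoid.ext_iff.1 h2 b b', ?_⟩
  intro a b h
  let T : Setoid γ := Setoid.ker (fun x => ∃ a, f a = x)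
  have hle : E.map f ⊔ G.map g ≤ T := by
    refine sup_le ?_ ?_ <;> rw [map_le_iff]
    · intro x y _
      exact propext ⟨fun _ => ⟨y, rfl⟩, fun _ => ⟨x, rfl⟩⟩
    · intro x y _
      exact propext ⟨fun ⟨u, hu⟩ => absurd hu (hd _ _), fun ⟨u, hu⟩ => absurd hu (hd _ _)⟩
  have h3 : (∃ u, f u = f a) = (∃ u, f u = g b) := hle h
  obtain ⟨u, hu⟩ := h3.mp ⟨a, rfl⟩
  exact hd _ _ hu

end Juxtaposition

end Partitions


section Diagrams

/-- Words in the two letters `X` (written `true`) and `X*` (written `false`). -/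
abbrev Word : Type := List Bool

/-- The boundary points of a rectangle: an upper line followed by a lower line of points. -/
abbrev Points (w w' : Word) : Type := Fin w.length ⊕ Fin w'.length

/-- The position of a boundary point on the boundary of the rectangle, cut open at the right:
upper points from right to left, then lower points from left to right. -/
def pos {m n : ℕ} : Fin m ⊕ Fin n → ℤ := Sum.elim (fun i => -1 - (i : ℤ)) (fun j => (j : ℤ))

/-- Whether a string starts (or else ends) at a boundary point: an upper `X` and a lower `X*` are
starting points, an upper `X*` and a lower `X` are ending points. -/
def isStart {w w' : Word} : Points w w' → Bool := Sum.elim w.get (fun j => !(w'.get j))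

/-- A partition of the boundary points given by the strings of an oriented Kauffman diagram:
every string joins exactly two points, strings do not cross, and every string joins a starting
point to an ending point. -/
structure IsDiagram (w w' : Word) (E : Setoid (Points w w')) : Prop where
  pair : ∀ x, ∃! y, y ≠ x ∧ E x y
  planar : ∀ x y z t, pos x < pos y → pos y < pos z → pos z < pos t → E x z → ¬ E y t
  oriented : ∀ x y, E x y → x ≠ y → isStart x ≠ isStart y

/-- Oriented Kauffman diagrams of type `(w, w')`: isotopy classes of planar oriented strings, which
are determined by the way the boundary points are joined. -/
@[ext]
structure Diagram (w w' : Word) where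
  rel : Setoid (Points w w')
  isDiagram : IsDiagram w w' rel

theorem pos_injective {m n : ℕ} : (pos : Fin m ⊕ Fin n → ℤ).Injective := by
  rintro (x | x) (y | y) h <;> simp only [pos, Sum.elim_inl, Sum.elim_inr] at h
  · congr 1; apply Fin.ext; omega
  · omega
  · omega
  · congr 1; apply Fin.ext; omega

theorem IsDiagram.exists_partner {w w' : Word} {E : Setoid (Points w w')} (h : IsDiagram w w' E) :
    ∃ σ : Points w w' → Points w w', (∀ x, σ x ≠ x) ∧ (∀ x, E x (σ x)) ∧ (∀ x, σ (σ x) = x) ∧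
      ∀ x y, E x y → y ≠ x → y = σ x := by
  choose σ hσ hu using h.pair
  refine ⟨σ, fun x => (hσ x).1, fun x => (hσ x).2, fun x => ?_, fun x y h h' => hu x y ⟨h', h⟩⟩
  exact (hu (σ x) x ⟨(hσ x).1.symm, E.symm' (hσ x).2⟩).symm

section Parity

open Classical in
/-- Indicator. -/
noncomputable def ind (R : Type) [CommRing R] (p : Prop) : R := if p then 1 else 0

variable {R : Type} [CommRing R] {w w' : Word} {E : Setoid (Points w w')}

theorem IsDiagram.sum_eq_zero (h : IsDiagram w w' E) (K : Points w w' → Prop)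
    (hK : ∀ x y, E x y → K x → K y) (f : Points w w' → R)
    (hf : ∀ x y, E x y → x ≠ y → f x + f y = 0) : ∑ x, ind R (K x) * f x = 0 := by
  obtain ⟨σ, h1, h2, h3, -⟩ := h.exists_partner
  refine Finset.sum_involution (fun x _ => σ x) ?_ (fun x _ _ => h1 x) (fun x _ => Finset.mem_univ _)
    (fun x _ => h3 x)
  intro x _
  have : ind R (K (σ x)) = ind R (K x) := by
    congr 1
    exact propext ⟨hK _ _ (E.symm' (h2 x)), hK _ _ (h2 x)⟩
  rw [this, ← mul_add, hf _ _ (h2 x) (h1 x).symm, mul_zero]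

theorem four_term {a a' b b' : ℤ} (h1 : a ≠ b) (h2 : a ≠ b') (h3 : a' ≠ b) (h4 : a' ≠ b')
    (c1 : ¬ (a < b ∧ b < a' ∧ a' < b')) (c2 : ¬ (a' < b ∧ b < a ∧ a < b'))
    (c3 : ¬ (a < b' ∧ b' < a' ∧ a' < b)) (c4 : ¬ (a' < b' ∧ b' < a ∧ a < b))
    (c5 : ¬ (b < a ∧ a < b' ∧ b' < a')) (c6 : ¬ (b < a' ∧ a' < b' ∧ b' < a))
    (c7 : ¬ (b' < a ∧ a < b ∧ b < a')) (c8 : ¬ (b' < a' ∧ a' < b ∧ b < a)) :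
    (ind (ZMod 2) (a < b) + ind (ZMod 2) (a' < b)) +
      (ind (ZMod 2) (a < b') + ind (ZMod 2) (a' < b')) = 0 := by
  unfold ind
  split_ifs <;> first | decide | (exfalso; omega)

theorem IsDiagram.cross_sum (h : IsDiagram w w' E) (K K' : Points w w' → Prop)
    (hK : ∀ x y, E x y → K x → K y) (hK' : ∀ x y, E x y → K' x → K' y)
    (hd : ∀ x, K x → ¬ K' x) :
    ∑ p, ∑ q, ind (ZMod 2) (K p) * (ind (ZMod 2) (K' q) * ind (ZMod 2) (pos p < pos q)) = 0 := by
  have aux : ∀ p p', E p p' → p ≠ p' → K p → ∑ q, ind (ZMod 2) (K' q) *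
      (ind (ZMod 2) (pos p < pos q) + ind (ZMod 2) (pos p' < pos q)) = 0 := by
    intro p p' hp hne hKp
    have hKp' := hK _ _ hp hKp
    have key : ∀ q q', E q q' → q ≠ q' → K' q →
        (ind (ZMod 2) (pos p < pos q) + ind (ZMod 2) (pos p' < pos q)) +
        (ind (ZMod 2) (pos p < pos q') + ind (ZMod 2) (pos p' < pos q')) = 0 := by
      intro q q' hq hne' hKq
      have hKq' := hK' _ _ hq hKq
      have hpq : ∀ u v, K u → K' v → pos u ≠ pos v := by
        intro u v hu hv huv
        rw [pos_injective huv] at hu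
        exact hd _ hu hv
      have hp' := E.symm' hp
      have hq' := E.symm' hq
      apply four_term (hpq _ _ hKp hKq) (hpq _ _ hKp hKq') (hpq _ _ hKp' hKq) (hpq _ _ hKp' hKq')
      · rintro ⟨a, b, c⟩; exact h.planar _ _ _ _ a b c hp hq
      · rintro ⟨a, b, c⟩; exact h.planar _ _ _ _ a b c hp' hq
      · rintro ⟨a, b, c⟩; exact h.planar _ _ _ _ a b c hp hq'
      · rintro ⟨a, b, c⟩; exact h.planar _ _ _ _ a b c hp' hq'
      · rintro ⟨a, b, c⟩; exact h.planar _ _ _ _ a b c hq hp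
      · rintro ⟨a, b, c⟩; exact h.planar _ _ _ _ a b c hq hp'
      · rintro ⟨a, b, c⟩; exact h.planar _ _ _ _ a b c hq' hp
      · rintro ⟨a, b, c⟩; exact h.planar _ _ _ _ a b c hq' hp'
    have : ∀ q, ind (ZMod 2) (K' q) *
        (ind (ZMod 2) (pos p < pos q) + ind (ZMod 2) (pos p' < pos q)) =
        ind (ZMod 2) (K' q) * (ind (ZMod 2) (K' q) *
        (ind (ZMod 2) (pos p < pos q) + ind (ZMod 2) (pos p' < pos q))) := by
      intro q
      by_cases hq : K' q <;> simp [ind, hq]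
    rw [Finset.sum_congr rfl (fun q _ => this q)]
    refine h.sum_eq_zero K' hK' _ ?_
    intro q q' hq hne'
    by_cases hKq : K' q
    · have hKq' := hK' _ _ hq hKq
      have := key q q' hq hne' hKq
      simpa [ind, hKq, hKq'] using this
    · have hKq' : ¬ K' q' := fun h => hKq (hK' _ _ (E.symm' hq) h)
      simp [ind, hKq, hKq']
  have : ∀ p, ∑ q, ind (ZMod 2) (K p) * (ind (ZMod 2) (K' q) * ind (ZMod 2) (pos p < pos q)) =
      ind (ZMod 2) (K p) * (ind (ZMod 2) (K p) *
        ∑ q, ind (ZMod 2) (K' q) * ind (ZMod 2) (pos p < pos q)) := by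
    intro p
    rw [← Finset.mul_sum]
    by_cases hp : K p <;> simp [ind, hp]
  rw [Finset.sum_congr rfl (fun p _ => this p)]
  refine h.sum_eq_zero K hK _ ?_
  intro p p' hp hne
  by_cases hKp : K p
  · have hKp' := hK _ _ hp hKp
    have := aux p p' hp hne hKp
    simp only [mul_add, Finset.sum_add_distrib] at this
    have e1 : ind (ZMod 2) (K p) = 1 := if_pos hKp
    have e2 : ind (ZMod 2) (K p') = 1 := if_pos hKp'
    rw [e1, e2, one_mul, one_mul, this]
  · have hKp' : ¬ K p' := fun h => hKp (hK _ _ (E.symm' hp) h)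
    have e1 : ind (ZMod 2) (K p) = 0 := if_neg hKp
    have e2 : ind (ZMod 2) (K p') = 0 := if_neg hKp'
    rw [e1, e2, zero_mul, zero_mul, add_zero]

end Parity

section Chains

variable {P : Type} {S : P → P → Prop}

theorem reach_of_eqvGen (hl : ∀ p p' q, S p q → S p' q → p = p') {x : P} (hx : ∀ p, ¬ S p x)
    {z : P} (h : Relation.EqvGen S x z) : Relation.ReflTransGen S x z := by
  have : ∀ p q, Relation.EqvGen S p q →
      (Relation.ReflTransGen S x p ↔ Relation.ReflTransGen S x q) := by
    intro p q h
    induction h with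
    | rel p q h =>
      constructor
      · intro h'
        exact h'.tail h
      · intro h'
        rcases Relation.ReflTransGen.cases_tail h' with h1 | ⟨c, h1, h2⟩
        · rw [h1] at h
          exact absurd h (hx _)
        · rw [hl _ _ _ h h2]
          exact h1
    | refl p => exact Iff.rfl
    | symm p q _ ih => exact ih.symm
    | trans p q r _ _ ih1 ih2 => exact ih1.trans ih2
  exact (this _ _ h).1 Relation.ReflTransGen.refl

theorem eq_of_no_succ {y z : P} (hy : ∀ q, ¬ S y q) (h : Relation.ReflTransGen S y z) : y = z := by
  rcases Relation.ReflTransGen.cases_head h with h | ⟨c, h, _⟩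
  · exact h
  · exact absurd h (hy _)

theorem eq_of_no_pred {x z : P} (hz : ∀ q, ¬ S q z) (h : Relation.ReflTransGen S x z) : x = z := by
  rcases Relation.ReflTransGen.cases_tail h with h | ⟨c, _, h⟩
  · exact h.symm
  · exact absurd h (hz _)

theorem eq_of_ends (hl : ∀ p p' q, S p q → S p' q → p = p') (hr : ∀ p q q', S p q → S p q' → q = q')
    {x y z : P} (hx : ∀ p, ¬ S p x) (hy : ∀ q, ¬ S y q) (hz : ∀ q, ¬ S z q)
    (hxy : Relation.EqvGen S x y) (hxz : Relation.EqvGen S x z) : y = z := by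
  rcases Relation.ReflTransGen.total_of_right_unique (fun a b c => hr a b c)
    (reach_of_eqvGen hl hx hxy) (reach_of_eqvGen hl hx hxz) with h | h
  · exact eq_of_no_succ hy h
  · exact (eq_of_no_succ hz h).symm

end Chains

section Composition

variable {w₀ w₁ w₂ : Word} {M : Setoid (Points w₀ w₁)} {N : Setoid (Points w₁ w₂)}

/-- The directed strings of two diagrams placed on top of each other. -/
def Step (M : Setoid (Points w₀ w₁)) (N : Setoid (Points w₁ w₂))
    (p q : Fin w₀.length ⊕ (Fin w₁.length ⊕ Fin w₂.length)) : Prop :=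
  (∃ x y, M x y ∧ isStart x = true ∧ isStart y = false ∧ up x = p ∧ up y = q) ∨
  (∃ x y, N x y ∧ isStart x = true ∧ isStart y = false ∧ low x = p ∧ low y = q)

theorem isStart_up_low (x : Points w₀ w₁) (y : Points w₁ w₂)
    (h : (up x : Fin w₀.length ⊕ (Fin w₁.length ⊕ Fin w₂.length)) = low y) :
    isStart x = !isStart y := by
  rcases x with x | x <;> rcases y with y | y <;> simp_all [up, low, isStart]

theorem isStart_up_outer (x : Points w₀ w₁) (y : Points w₀ w₂)
    (h : (up x : Fin w₀.length ⊕ (Fin w₁.length ⊕ Fin w₂.length)) = outer y) :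
    isStart x = isStart y := by
  rcases x with x | x <;> rcases y with y | y <;> simp_all [up, outer, isStart]

theorem isStart_low_outer (x : Points w₁ w₂) (y : Points w₀ w₂)
    (h : (low x : Fin w₀.length ⊕ (Fin w₁.length ⊕ Fin w₂.length)) = outer y) :
    isStart x = isStart y := by
  rcases x with x | x <;> rcases y with y | y <;> simp_all [low, outer, isStart]

theorem IsDiagram.unique {w w' : Word} {E : Setoid (Points w w')} (h : IsDiagram w w' E)
    {x y z : Points w w'} (hy : E x y) (hz : E x z) (hxy : isStart x ≠ isStart y)
    (hxz : isStart x ≠ isStart z) : y = z := by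
  obtain ⟨σ, h1, h2, h3, h4⟩ := h.exists_partner
  rw [h4 x y hy (fun e => hxy (by rw [e])), h4 x z hz (fun e => hxz (by rw [e]))]

theorem step_left (hM : IsDiagram w₀ w₁ M) (hN : IsDiagram w₁ w₂ N)
    (p p' q) (h : Step M N p q) (h' : Step M N p' q) : p = p' := by
  rcases h with ⟨x, y, h, hx, hy, rfl, rfl⟩ | ⟨x, y, h, hx, hy, rfl, rfl⟩ <;>
    rcases h' with ⟨x', y', h', hx', hy', rfl, e⟩ | ⟨x', y', h', hx', hy', rfl, e⟩
  · obtain rfl := up_injective e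
    rw [hM.unique (M.symm' h) (M.symm' h') (by simp [hx, hy]) (by simp [hx', hy])]
  · have := isStart_up_low _ _ e.symm
    simp [hy, hy'] at this
  · have := isStart_up_low _ _ e
    simp [hy, hy'] at this
  · obtain rfl := low_injective e
    rw [hN.unique (N.symm' h) (N.symm' h') (by simp [hx, hy]) (by simp [hx', hy])]

theorem step_right (hM : IsDiagram w₀ w₁ M) (hN : IsDiagram w₁ w₂ N)
    (p q q') (h : Step M N p q) (h' : Step M N p q') : q = q' := by
  rcases h with ⟨x, y, h, hx, hy, rfl, rfl⟩ | ⟨x, y, h, hx, hy, rfl, rfl⟩ <;>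
    rcases h' with ⟨x', y', h', hx', hy', e, rfl⟩ | ⟨x', y', h', hx', hy', e, rfl⟩
  · obtain rfl := up_injective e
    rw [hM.unique h h' (by simp [hx, hy]) (by simp [hx, hy'])]
  · have := isStart_up_low _ _ e.symm
    simp [hx, hx'] at this
  · have := isStart_up_low _ _ e
    simp [hx, hx'] at this
  · obtain rfl := low_injective e
    rw [hN.unique h h' (by simp [hx, hy]) (by simp [hx, hy'])]

theorem step_no_pred {x : Points w₀ w₂} (hx : isStart x = true) (p) :
    ¬ Step M N p (outer x) := by
  rintro (⟨u, v, h, hu, hv, rfl, e⟩ | ⟨u, v, h, hu, hv, rfl, e⟩)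
  · have := isStart_up_outer _ _ e
    simp [hx, hv] at this
  · have := isStart_low_outer _ _ e
    simp [hx, hv] at this

theorem step_no_succ {x : Points w₀ w₂} (hx : isStart x = false) (p) :
    ¬ Step M N (outer x) p := by
  rintro (⟨u, v, h, hu, hv, e, rfl⟩ | ⟨u, v, h, hu, hv, e, rfl⟩)
  · have := isStart_up_outer _ _ e
    simp [hx, hu] at this
  · have := isStart_low_outer _ _ e
    simp [hx, hu] at this

theorem eqvGen_step_of_glue (hM : IsDiagram w₀ w₁ M) (hN : IsDiagram w₁ w₂ N) {p q}
    (h : glue M N p q) : Relation.EqvGen (Step M N) p q := by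
  have : glue M N ≤ Relation.EqvGen.setoid (Step M N) := by
    refine sup_le ?_ ?_ <;> rw [map_le_iff]
    · intro x y h
      by_cases hxy : x = y
      · rw [hxy]
      · have ho := hM.oriented x y h hxy
        cases hx : isStart x <;> cases hy : isStart y <;> simp_all only [ne_eq, not_true_eq_false]
        · exact Relation.EqvGen.symm _ _ (Relation.EqvGen.rel _ _
            (Or.inl ⟨y, x, M.symm' h, hy, hx, rfl, rfl⟩))
        · exact Relation.EqvGen.rel _ _ (Or.inl ⟨x, y, h, hx, hy, rfl, rfl⟩)
    · intro x y h
      by_cases hxy : x = y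
      · rw [hxy]
      · have ho := hN.oriented x y h hxy
        cases hx : isStart x <;> cases hy : isStart y <;> simp_all only [ne_eq, not_true_eq_false]
        · exact Relation.EqvGen.symm _ _ (Relation.EqvGen.rel _ _
            (Or.inr ⟨y, x, N.symm' h, hy, hx, rfl, rfl⟩))
        · exact Relation.EqvGen.rel _ _ (Or.inr ⟨x, y, h, hx, hy, rfl, rfl⟩)
  exact this h

theorem compRel_unique (hM : IsDiagram w₀ w₁ M) (hN : IsDiagram w₁ w₂ N) {x y z : Points w₀ w₂}
    (hxy : compRel M N x y) (hxz : compRel M N x z) (hy : y ≠ x) (hz : z ≠ x) : y = z := by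
  have hxy := eqvGen_step_of_glue hM hN hxy
  have hxz := eqvGen_step_of_glue hM hN hxz
  have hl := step_left hM hN
  have hr := step_right hM hN
  cases hx : isStart x
  · have flip : ∀ p q, Relation.EqvGen (Step M N) p q →
        Relation.EqvGen (fun a b => Step M N b a) p q := by
      intro p q h
      induction h with
      | rel p q h => exact Relation.EqvGen.symm _ _ (Relation.EqvGen.rel _ _ h)
      | refl p => exact Relation.EqvGen.refl _
      | symm p q _ ih => exact Relation.EqvGen.symm _ _ ih
      | trans p q r _ _ ih1 ih2 => exact Relation.EqvGen.trans _ _ _ ih1 ih2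
    have hs : ∀ u : Points w₀ w₂, Relation.EqvGen (Step M N) (outer x) (outer u) → u ≠ x →
        isStart u = true := by
      intro u hu hne
      by_contra hcon
      have := reach_of_eqvGen (S := fun a b => Step M N b a) (fun a b c h h' => hr c a b h h')
        (step_no_succ hx) (flip _ _ hu)
      exact hne (outer_injective (eq_of_no_pred
        (step_no_succ (by simpa using hcon)) this)).symm
    exact outer_injective (eq_of_ends (S := fun a b => Step M N b a)
      (fun a b c h h' => hr c a b h h') (fun a b c h h' => hl b c a h h')
      (step_no_succ hx) (step_no_pred (hs y hxy hy)) (step_no_pred (hs z hxz hz))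
      (flip _ _ hxy) (flip _ _ hxz))
  · have hs : ∀ u : Points w₀ w₂, Relation.EqvGen (Step M N) (outer x) (outer u) → u ≠ x →
        isStart u = false := by
      intro u hu hne
      by_contra hcon
      have := reach_of_eqvGen hl (step_no_pred hx) hu
      exact hne (outer_injective (eq_of_no_pred
        (step_no_pred (by simpa using hcon)) this)).symm
    exact outer_injective (eq_of_ends hl hr
      (step_no_pred hx) (step_no_succ (hs y hxy hy)) (step_no_succ (hs z hxz hz)) hxy hxz)

/-- The sign of a boundary point. -/
def sgn {w w' : Word} (x : Points w w') : ℤ := if isStart x = true then 1 else -1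

theorem glue_up {x y : Points w₀ w₁} (h : M x y) : glue M N (up x) (up y) :=
  (le_sup_left : M.map up ≤ glue M N) (Relation.EqvGen.rel _ _ ⟨x, y, h, rfl, rfl⟩)

theorem glue_low {x y : Points w₁ w₂} (h : N x y) : glue M N (low x) (low y) :=
  (le_sup_right : N.map low ≤ glue M N) (Relation.EqvGen.rel _ _ ⟨x, y, h, rfl, rfl⟩)

theorem IsDiagram.sgn_sum {w w' : Word} {E : Setoid (Points w w')} (h : IsDiagram w w' E)
    (K : Points w w' → Prop) (hK : ∀ x y, E x y → K x → K y) :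
    ∑ x, ind ℤ (K x) * sgn x = 0 := by
  refine h.sum_eq_zero K hK _ ?_
  intro x y hxy hne
  have := h.oriented x y hxy hne
  unfold sgn
  cases hx : isStart x <;> cases hy : isStart y <;> simp_all

theorem compRel_sgn_sum (hM : IsDiagram w₀ w₁ M) (hN : IsDiagram w₁ w₂ N) (k) :
    ∑ x : Points w₀ w₂, ind ℤ (glue M N k (outer x)) * sgn x = 0 := by
  have h1 := hM.sgn_sum (fun x => glue M N k (up x))
    (fun x y h h' => Setoid.trans' _ h' (glue_up h))
  have h2 := hN.sgn_sum (fun x => glue M N k (low x))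
    (fun x y h h' => Setoid.trans' _ h' (glue_low h))
  rw [Fintype.sum_sum_type] at h1 h2 ⊢
  have e : ∑ i : Fin w₁.length, ind ℤ (glue M N k (up (Sum.inr i))) *
        sgn (Sum.inr i : Points w₀ w₁) =
      - ∑ i : Fin w₁.length, ind ℤ (glue M N k (low (Sum.inl i))) *
        sgn (Sum.inl i : Points w₁ w₂) := by
    rw [← Finset.sum_neg_distrib]
    refine Finset.sum_congr rfl fun i _ => ?_
    have : sgn (Sum.inr i : Points w₀ w₁) = - sgn (Sum.inl i : Points w₁ w₂) := by
      have : ∀ b : Bool, (if (!b) = true then (1 : ℤ) else -1) = -(if b = true then 1 else -1) := by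
        decide
      exact this (w₁.get i)
    rw [this, mul_neg]
    rfl
  rw [e] at h1
  have := congrArg₂ (· + ·) h1 h2
  simp only [add_zero] at this
  rw [← this]
  have e1 : ∀ i, (outer (Sum.inl i) : Fin w₀.length ⊕ (Fin w₁.length ⊕ Fin w₂.length))
    = up (Sum.inl i) := fun _ => rfl
  have e2 : ∀ i, (outer (Sum.inr i) : Fin w₀.length ⊕ (Fin w₁.length ⊕ Fin w₂.length))
    = low (Sum.inr i) := fun _ => rfl
  have e3 : ∀ i, sgn (Sum.inl i : Points w₀ w₂) = sgn (Sum.inl i : Points w₀ w₁) := fun _ => rfl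
  have e4 : ∀ i, sgn (Sum.inr i : Points w₀ w₂) = sgn (Sum.inr i : Points w₁ w₂) := fun _ => rfl
  simp only [e1, e2, e3, e4]
  ring

theorem compRel_exists (hM : IsDiagram w₀ w₁ M) (hN : IsDiagram w₁ w₂ N) (x : Points w₀ w₂) :
    ∃ y, y ≠ x ∧ compRel M N x y ∧ isStart x ≠ isStart y := by
  by_contra hcon
  push Not at hcon
  have hall : ∀ y, compRel M N x y → isStart x = isStart y := by
    intro y hy
    by_cases hne : y = x
    · rw [hne]
    · exact hcon y hne hy
  have h := compRel_sgn_sum hM hN (outer x)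
  have h' : ∑ y : Points w₀ w₂, ind ℤ (glue M N (outer x) (outer y)) = 0 := by
    have : ∀ y : Points w₀ w₂, ind ℤ (glue M N (outer x) (outer y)) * sgn y =
        ind ℤ (glue M N (outer x) (outer y)) * sgn x := by
      intro y
      by_cases hy : glue M N (outer x) (outer y)
      · have : sgn y = sgn x := by
          unfold sgn
          rw [hall y hy]
        rw [this]
      · simp [ind, hy]
    rw [Finset.sum_congr rfl (fun y _ => this y), ← Finset.sum_mul] at h
    rcases mul_eq_zero.1 h with h | h
    · exact h
    · unfold sgn at h
      split_ifs at h; omega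
  have h0 : ∀ y : Points w₀ w₂, 0 ≤ ind ℤ (glue M N (outer x) (outer y)) := by
    intro y
    unfold ind
    split_ifs <;> simp
  have := (Finset.sum_eq_zero_iff_of_nonneg (fun y _ => h0 y)).1 h' x (Finset.mem_univ _)
  rw [ind, if_pos (Setoid.refl' _ _)] at this
  omega

theorem ind_inl_inr {m n : ℕ} (i : Fin m) (j : Fin n) :
    ind (ZMod 2) (pos (Sum.inl i : Fin m ⊕ Fin n) < pos (Sum.inr j : Fin m ⊕ Fin n)) = 1 := by
  refine if_pos ?_
  simp only [pos, Sum.elim_inl, Sum.elim_inr]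
  omega

theorem ind_inr_inl {m n : ℕ} (i : Fin m) (j : Fin n) :
    ind (ZMod 2) (pos (Sum.inr j : Fin m ⊕ Fin n) < pos (Sum.inl i : Fin m ⊕ Fin n)) = 0 := by
  refine if_neg ?_
  simp only [pos, Sum.elim_inl, Sum.elim_inr]
  omega

theorem sum_class {x z : Points w₀ w₂} (hxz : x ≠ z) (K : Points w₀ w₂ → Prop)
    (hK : ∀ p, K p ↔ p = x ∨ p = z) (F : Points w₀ w₂ → ZMod 2) :
    ∑ p, ind (ZMod 2) (K p) * F p = F x + F z := by
  classical
  have : ∀ p, ind (ZMod 2) (K p) * F p = (if p = x then F p else 0) + (if p = z then F p else 0) := by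
    intro p
    by_cases h1 : p = x
    · have h2 : p ≠ z := fun h => hxz (h1.symm.trans h)
      have h3 : K p := (hK p).2 (Or.inl h1)
      simp [ind, h1, hxz, h1 ▸ h3]
    · by_cases h2 : p = z
      · have h3 : K p := (hK p).2 (Or.inr h2)
        simp [ind, h2, hxz.symm, h2 ▸ h3]
      · have h3 : ¬ K p := fun h => by rcases (hK p).1 h with h | h <;> contradiction
        simp [ind, h1, h2, h3]
  rw [Finset.sum_congr rfl (fun p _ => this p), Finset.sum_add_distrib]
  simp

theorem compRel_planar (hM : IsDiagram w₀ w₁ M) (hN : IsDiagram w₁ w₂ N) (x y z t : Points w₀ w₂)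
    (hxy : pos x < pos y) (hyz : pos y < pos z) (hzt : pos z < pos t)
    (hxz : compRel M N x z) (hyt : compRel M N y t) : False := by
  have nxy : x ≠ y := fun h => by rw [h] at hxy; omega
  have nyz : y ≠ z := fun h => by rw [h] at hyz; omega
  have nxz : x ≠ z := fun h => by rw [h] at hxy; omega
  have nyt : y ≠ t := fun h => by rw [h] at hyz; omega
  have hne : ¬ compRel M N x y := fun h =>
    nyz (compRel_unique hM hN h hxz nxy.symm nxz.symm)
  let K := fun p => glue M N (outer x) p
  let K' := fun p => glue M N (outer y) p
  have hd : ∀ p, K p → ¬ K' p := fun p h h' => hne ((glue M N).trans' h ((glue M N).symm' h'))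
  let I := ind (ZMod 2)
  have cM := hM.cross_sum (fun p => K (up p)) (fun p => K' (up p))
    (fun x y h h' => Setoid.trans' _ h' (glue_up h)) (fun x y h h' => Setoid.trans' _ h' (glue_up h))
    (fun p => hd _)
  have cN := hN.cross_sum (fun p => K (low p)) (fun p => K' (low p))
    (fun x y h h' => Setoid.trans' _ h' (glue_low h))
    (fun x y h h' => Setoid.trans' _ h' (glue_low h)) (fun p => hd _)
  have pM : ∀ L : _ → Prop, (∀ p q, glue M N p q → L p → L q) →
      ∑ p : Points w₀ w₁, I (L (up p)) = 0 := by
    intro L hL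
    have := hM.sum_eq_zero (R := ZMod 2) (fun p => L (up p)) (fun x y h h' => hL _ _ (glue_up h) h')
      (fun _ => 1) (fun _ _ _ _ => by decide)
    simpa using this
  have pN : ∀ L : _ → Prop, (∀ p q, glue M N p q → L p → L q) →
      ∑ p : Points w₁ w₂, I (L (low p)) = 0 := by
    intro L hL
    have := hN.sum_eq_zero (R := ZMod 2) (fun p => L (low p)) (fun x y h h' => hL _ _ (glue_low h) h')
      (fun _ => 1) (fun _ _ _ _ => by decide)
    simpa using this
  have hKs : ∀ p q, glue M N p q → K p → K q := fun p q h h' => Setoid.trans' _ h' h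
  have hKs' : ∀ p q, glue M N p q → K' p → K' q := fun p q h h' => Setoid.trans' _ h' h
  have pM1 := pM K hKs
  have pM2 := pM K' hKs'
  have pN1 := pN K hKs
  have pN2 := pN K' hKs'
  -- the crossing number of the two outer strings
  have cO : ∑ p : Points w₀ w₂, ∑ q : Points w₀ w₂,
      I (K (outer p)) * (I (K' (outer q)) * I (pos p < pos q)) = 0 := by
    rw [Fintype.sum_sum_type] at pM1 pM2 pN1 pN2
    simp only [Fintype.sum_sum_type] at cM cN ⊢
    simp only [I, ind_inl_inr, ind_inr_inl, mul_one, mul_zero, Finset.sum_const_zero, zero_add,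
      Finset.sum_add_distrib] at cM cN ⊢
    simp only [← Finset.mul_sum, ← Finset.sum_mul] at cM cN ⊢
    have bb : ∑ i : Fin w₁.length, ind (ZMod 2) (K (up (Sum.inr i))) *
          ∑ j : Fin w₁.length, ind (ZMod 2) (K' (up (Sum.inr j))) *
            ind (ZMod 2) (pos (Sum.inr i : Points w₀ w₁) < pos (Sum.inr j : Points w₀ w₁)) +
        ∑ i : Fin w₁.length, ind (ZMod 2) (K (low (Sum.inl i))) *
          ∑ j : Fin w₁.length, ind (ZMod 2) (K' (low (Sum.inl j))) *
            ind (ZMod 2) (pos (Sum.inl i : Points w₁ w₂) < pos (Sum.inl j : Points w₁ w₂)) =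
        (∑ i : Fin w₁.length, ind (ZMod 2) (K (low (Sum.inl i)))) *
          ∑ j : Fin w₁.length, ind (ZMod 2) (K' (low (Sum.inl j))) := by
      rw [Finset.sum_mul, ← Finset.sum_add_distrib]
      refine Finset.sum_congr rfl fun i _ => ?_
      have e : ∀ i : Fin w₁.length, (up (Sum.inr i) :
        Fin w₀.length ⊕ (Fin w₁.length ⊕ Fin w₂.length)) = low (Sum.inl i) := fun _ => rfl
      simp only [e]
      rw [← mul_add, ← Finset.sum_add_distrib]
      by_cases hi : K (low (Sum.inl i))
      · congr 1
        refine Finset.sum_congr rfl fun j _ => ?_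
        by_cases hij : i = j
        · have : ¬ K' (low (Sum.inl j)) := hij ▸ hd _ hi
          simp [ind, this]
        · rw [← mul_add]
          have hij' : (i : ℕ) ≠ j := fun h => hij (Fin.ext h)
          have : ind (ZMod 2) (pos (Sum.inr i : Points w₀ w₁) < pos (Sum.inr j : Points w₀ w₁)) +
            ind (ZMod 2) (pos (Sum.inl i : Points w₁ w₂) < pos (Sum.inl j : Points w₁ w₂)) = 1 := by
            rcases lt_or_gt_of_ne hij' with h | h
            · rw [ind, if_pos (by simp only [pos, Sum.elim_inr]; omega), ind,
                if_neg (by simp only [pos, Sum.elim_inl]; omega), add_zero]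
            · rw [ind, if_neg (by simp only [pos, Sum.elim_inr]; omega), ind,
                if_pos (by simp only [pos, Sum.elim_inl]; omega), zero_add]
          rw [this, mul_one]
      · simp [ind, hi]
    have e1 : ∀ i, (outer (Sum.inl i) : Fin w₀.length ⊕ (Fin w₁.length ⊕ Fin w₂.length))
      = up (Sum.inl i) := fun _ => rfl
    have e2 : ∀ i, (outer (Sum.inr i) : Fin w₀.length ⊕ (Fin w₁.length ⊕ Fin w₂.length))
      = low (Sum.inr i) := fun _ => rfl
    have e3 : ∀ i : Fin w₁.length, (up (Sum.inr i) :
        Fin w₀.length ⊕ (Fin w₁.length ⊕ Fin w₂.length)) = low (Sum.inl i) := fun _ => rfl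
    have e4 : ∀ i j : Fin w₀.length, (pos (Sum.inl i : Points w₀ w₂) < pos (Sum.inl j : Points w₀ w₂)) =
      (pos (Sum.inl i : Points w₀ w₁) < pos (Sum.inl j : Points w₀ w₁)) := fun _ _ => rfl
    have e5 : ∀ i j : Fin w₂.length, (pos (Sum.inr i : Points w₀ w₂) < pos (Sum.inr j : Points w₀ w₂)) =
      (pos (Sum.inr i : Points w₁ w₂) < pos (Sum.inr j : Points w₁ w₂)) := fun _ _ => rfl
    simp only [e1, e2, e3, e4, e5, I] at *
    generalize (∑ i : Fin w₀.length, ind (ZMod 2) (K (up (Sum.inl i)))) = a at *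
    generalize (∑ i : Fin w₀.length, ind (ZMod 2) (K' (up (Sum.inl i)))) = a' at *
    generalize (∑ i : Fin w₁.length, ind (ZMod 2) (K (low (Sum.inl i)))) = b at *
    generalize (∑ i : Fin w₁.length, ind (ZMod 2) (K' (low (Sum.inl i)))) = b' at *
    generalize (∑ i : Fin w₂.length, ind (ZMod 2) (K (low (Sum.inr i)))) = c at *
    generalize (∑ i : Fin w₂.length, ind (ZMod 2) (K' (low (Sum.inr i)))) = c' at *
    obtain rfl := CharTwo.add_eq_zero.1 pM1
    obtain rfl := CharTwo.add_eq_zero.1 pM2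
    obtain rfl := CharTwo.add_eq_zero.1 pN1
    obtain rfl := CharTwo.add_eq_zero.1 pN2
    have h2 : (2 : ZMod 2) = 0 := by decide
    linear_combination cM + cN - bb - (a * a') * h2
  have hKc : ∀ p, K (outer p) ↔ p = x ∨ p = z := by
    intro p
    constructor
    · intro h
      by_cases hp : p = x
      · exact Or.inl hp
      · exact Or.inr (compRel_unique hM hN h hxz hp nxz.symm)
    · rintro (rfl | rfl)
      · exact Setoid.refl' _ _
      · exact hxz
  have hKc' : ∀ p, K' (outer p) ↔ p = y ∨ p = t := by
    intro p
    constructor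
    · intro h
      by_cases hp : p = y
      · exact Or.inl hp
      · exact Or.inr (compRel_unique hM hN h hyt hp nyt.symm)
    · rintro (rfl | rfl)
      · exact Setoid.refl' _ _
      · exact hyt
  simp only [← Finset.mul_sum, I] at cO
  rw [sum_class nxz _ hKc, sum_class nyt _ hKc', sum_class nyt _ hKc'] at cO
  simp only [ind] at cO
  rw [if_pos hxy, if_pos (by omega), if_neg (by omega), if_pos hzt] at cO
  revert cO
  decide

theorem IsDiagram.comp (hM : IsDiagram w₀ w₁ M) (hN : IsDiagram w₁ w₂ N) :
    IsDiagram w₀ w₂ (compRel M N) where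
  pair x := by
    obtain ⟨y, h1, h2, h3⟩ := compRel_exists hM hN x
    exact ⟨y, ⟨h1, h2⟩, fun z hz => compRel_unique hM hN hz.2 h2 hz.1 h1⟩
  planar x y z t h1 h2 h3 h4 h5 := compRel_planar hM hN x y z t h1 h2 h3 h4 h5
  oriented x y h hne := by
    obtain ⟨z, h1, h2, h3⟩ := compRel_exists hM hN x
    rw [compRel_unique hM hN h h2 hne.symm h1]
    exact h3

end Composition

section Juxtapose

/-- Additivity of the number of missed classes on disjoint unions. -/
theorem missed_sup {α α' β β' γ ε : Type} [Finite β] [Finite β'] {f : α → β} {f' : α' → β'}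
    {F : β → γ} {G : β' → γ} {k : ε → γ} {E : Setoid β} {E' : Setoid β'} {T : Setoid γ}
    (hF : ∀ a a', T (F a) (F a') ↔ E a a') (hG : ∀ b b', T (G b) (G b') ↔ E' b b')
    (hFG : ∀ a b, ¬ T (F a) (G b)) (hs : ∀ x, (∃ a, F a = x) ∨ ∃ b, G b = x)
    (hk : ∀ b, (∃ e, T (k e) (F b)) ↔ ∃ a, E (f a) b)
    (hk' : ∀ b, (∃ e, T (k e) (G b)) ↔ ∃ a, E' (f' a) b) :
    missed k T = missed f E + missed f' E' := by
  unfold missed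
  rw [← Nat.card_sum]
  symm
  have m1 : ∀ q : {q : Quotient E // ∀ a, Quotient.mk E (f a) ≠ q},
      ∃ x, Quotient.mk E x = q.1 ∧ ∀ a, ¬ E (f a) x := by
    rintro ⟨q, hq⟩
    induction q using Quotient.inductionOn with
    | h x => exact ⟨x, rfl, fun a h => hq a (Quotient.sound h)⟩
  have m2 : ∀ q : {q : Quotient E' // ∀ a, Quotient.mk E' (f' a) ≠ q},
      ∃ x, Quotient.mk E' x = q.1 ∧ ∀ a, ¬ E' (f' a) x := by
    rintro ⟨q, hq⟩
    induction q using Quotient.inductionOn with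
    | h x => exact ⟨x, rfl, fun a h => hq a (Quotient.sound h)⟩
  choose r hr hr' using m1
  choose s hs1 hs' using m2
  have n1 : ∀ q e, Quotient.mk T (k e) ≠ Quotient.mk T (F (r q)) := by
    intro q e h
    obtain ⟨a, ha⟩ := (hk (r q)).1 ⟨e, Quotient.exact h⟩
    exact hr' q a ha
  have n2 : ∀ q e, Quotient.mk T (k e) ≠ Quotient.mk T (G (s q)) := by
    intro q e h
    obtain ⟨a, ha⟩ := (hk' (s q)).1 ⟨e, Quotient.exact h⟩
    exact hs' q a ha
  refine Nat.card_congr (Equiv.ofBijective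
    (Sum.elim (fun q => ⟨Quotient.mk T (F (r q)), n1 q⟩)
      (fun q => ⟨Quotient.mk T (G (s q)), n2 q⟩)) ⟨?_, ?_⟩)
  · rintro (p | p) (q | q) h <;> have h := congrArg Subtype.val h <;>
      simp only [Sum.elim_inl, Sum.elim_inr] at h
    · have h : T (F (r p)) (F (r q)) := Quotient.exact h
      congr 1
      apply Subtype.ext
      rw [← hr p, ← hr q]
      exact Quotient.sound ((hF _ _).1 h)
    · exact absurd (Quotient.exact h) (hFG _ _)
    · exact absurd (Quotient.exact h.symm) (hFG _ _)
    · have h : T (G (s p)) (G (s q)) := Quotient.exact h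
      congr 1
      apply Subtype.ext
      rw [← hs1 p, ← hs1 q]
      exact Quotient.sound ((hG _ _).1 h)
  · rintro ⟨q, hq⟩
    induction q using Quotient.inductionOn with
    | h z =>
      rcases hs z with ⟨b, rfl⟩ | ⟨b, rfl⟩
      · let p : {q : Quotient E // ∀ a, Quotient.mk E (f a) ≠ q} :=
          ⟨Quotient.mk E b, fun a h => by
            obtain ⟨e, he⟩ := (hk b).2 ⟨a, Quotient.exact h⟩
            exact hq e (Quotient.sound he)⟩
        refine ⟨Sum.inl p, Subtype.ext (Quotient.sound ?_)⟩
        exact (hF _ _).2 (Quotient.exact (hr p))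
      · let p : {q : Quotient E' // ∀ a, Quotient.mk E' (f' a) ≠ q} :=
          ⟨Quotient.mk E' b, fun a h => by
            obtain ⟨e, he⟩ := (hk' b).2 ⟨a, Quotient.exact h⟩
            exact hq e (Quotient.sound he)⟩
        refine ⟨Sum.inr p, Subtype.ext (Quotient.sound ?_)⟩
        exact (hG _ _).2 (Quotient.exact (hs1 p))

/-- The positions of the left factor in a juxtaposition of words. -/
def leftFin (w u : Word) (i : Fin w.length) : Fin (w ++ u).length :=
  ⟨i, by rw [List.length_append]; omega⟩

/-- The positions of the right factor in a juxtaposition of words. -/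
def rightFin (w u : Word) (i : Fin u.length) : Fin (w ++ u).length :=
  ⟨w.length + i, by rw [List.length_append]; omega⟩

theorem leftFin_injective (w u : Word) : (leftFin w u).Injective := fun _ _ h =>
  Fin.ext (by simpa [leftFin] using h)

theorem rightFin_injective (w u : Word) : (rightFin w u).Injective := fun _ _ h =>
  Fin.ext (by simpa [rightFin] using h)

theorem leftFin_ne (w u : Word) (i j) : leftFin w u i ≠ rightFin w u j := by
  intro h
  have := congrArg Fin.val h
  simp only [leftFin, rightFin] at this
  omega

theorem fin_cases (w u : Word) (i) : (∃ j, leftFin w u j = i) ∨ ∃ j, rightFin w u j = i := by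
  have hi : (i : ℕ) < w.length + u.length := lt_of_lt_of_eq i.2 List.length_append
  by_cases h : (i : ℕ) < w.length
  · exact Or.inl ⟨⟨i, h⟩, rfl⟩
  · exact Or.inr ⟨⟨i - w.length, by omega⟩, Fin.ext (by simp only [rightFin]; omega)⟩

variable {w₀ w₁ w₂ u₀ u₁ u₂ : Word}

/-- The boundary points of the left factor of a juxtaposition. -/
def leftPt : Points w₀ w₁ → Points (w₀ ++ u₀) (w₁ ++ u₁) :=
  Sum.map (leftFin w₀ u₀) (leftFin w₁ u₁)

/-- The boundary points of the right factor of a juxtaposition. -/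
def rightPt : Points u₀ u₁ → Points (w₀ ++ u₀) (w₁ ++ u₁) :=
  Sum.map (rightFin w₀ u₀) (rightFin w₁ u₁)

theorem leftPt_injective : (leftPt : Points w₀ w₁ → Points (w₀ ++ u₀) (w₁ ++ u₁)).Injective :=
  Sum.map_injective.2 ⟨leftFin_injective _ _, leftFin_injective _ _⟩

theorem rightPt_injective : (rightPt : Points u₀ u₁ → Points (w₀ ++ u₀) (w₁ ++ u₁)).Injective :=
  Sum.map_injective.2 ⟨rightFin_injective _ _, rightFin_injective _ _⟩

theorem leftPt_ne (a : Points w₀ w₁) (b : Points u₀ u₁) :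
    (leftPt a : Points (w₀ ++ u₀) (w₁ ++ u₁)) ≠ rightPt b := by
  rcases a with a | a <;> rcases b with b | b <;> simp [leftPt, rightPt, leftFin_ne]

theorem pt_cases (x : Points (w₀ ++ u₀) (w₁ ++ u₁)) :
    (∃ a : Points w₀ w₁, leftPt a = x) ∨ ∃ b : Points u₀ u₁, rightPt b = x := by
  rcases x with x | x <;> rcases fin_cases _ _ x with ⟨j, rfl⟩ | ⟨j, rfl⟩
  · exact Or.inl ⟨Sum.inl j, rfl⟩
  · exact Or.inr ⟨Sum.inl j, rfl⟩
  · exact Or.inl ⟨Sum.inr j, rfl⟩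
  · exact Or.inr ⟨Sum.inr j, rfl⟩

/-- Horizontal juxtaposition. -/
def tensorRel (M : Setoid (Points w₀ w₁)) (N : Setoid (Points u₀ u₁)) :
    Setoid (Points (w₀ ++ u₀) (w₁ ++ u₁)) :=
  M.map leftPt ⊔ N.map rightPt

theorem tensorRel_left {M : Setoid (Points w₀ w₁)} {N : Setoid (Points u₀ u₁)} {a a'} :
    tensorRel M N (leftPt a) (leftPt a') ↔ M a a' :=
  (sup_map_rel leftPt_injective rightPt_injective leftPt_ne M N).1 a a'

theorem tensorRel_right {M : Setoid (Points w₀ w₁)} {N : Setoid (Points u₀ u₁)} {a a'} :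
    tensorRel M N (rightPt a) (rightPt a') ↔ N a a' :=
  (sup_map_rel leftPt_injective rightPt_injective leftPt_ne M N).2.1 a a'

theorem tensorRel_ne {M : Setoid (Points w₀ w₁)} {N : Setoid (Points u₀ u₁)} {a b} :
    ¬ tensorRel M N (leftPt a) (rightPt b) :=
  (sup_map_rel leftPt_injective rightPt_injective leftPt_ne M N).2.2 a b

theorem tensorRel_ne' {M : Setoid (Points w₀ w₁)} {N : Setoid (Points u₀ u₁)} {a b} :
    ¬ tensorRel M N (rightPt b) (leftPt a) := fun h => tensorRel_ne (Setoid.symm' _ h)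

theorem isStart_leftPt (a : Points w₀ w₁) :
    isStart (leftPt a : Points (w₀ ++ u₀) (w₁ ++ u₁)) = isStart a := by
  rcases a with a | a <;> simp [leftPt, isStart, leftFin]

theorem isStart_rightPt (a : Points u₀ u₁) :
    isStart (rightPt a : Points (w₀ ++ u₀) (w₁ ++ u₁)) = isStart a := by
  rcases a with a | a <;> simp [rightPt, isStart, rightFin]

theorem pos_leftPt (a : Points w₀ w₁) :
    pos (leftPt a : Points (w₀ ++ u₀) (w₁ ++ u₁)) = pos a := by
  rcases a with a | a <;> simp [leftPt, pos, leftFin]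

theorem pos_left_bound (a : Points w₀ w₁) :
    -1 - (w₀.length : ℤ) < pos a ∧ pos a < (w₁.length : ℤ) := by
  rcases a with a | a <;> simp only [pos, Sum.elim_inl, Sum.elim_inr] <;> omega

theorem pos_right_bound (a : Points u₀ u₁) :
    (pos (rightPt a : Points (w₀ ++ u₀) (w₁ ++ u₁)) = pos a - w₀.length ∧ pos a < 0) ∨
    (pos (rightPt a : Points (w₀ ++ u₀) (w₁ ++ u₁)) = pos a + w₁.length ∧ 0 ≤ pos a) := by
  rcases a with a | a <;>
    simp only [pos, rightPt, Sum.map_inl, Sum.map_inr, Sum.elim_inl, Sum.elim_inr, rightFin,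
      Nat.cast_add] <;> omega

theorem IsDiagram.tensor {M : Setoid (Points w₀ w₁)} {N : Setoid (Points u₀ u₁)}
    (hM : IsDiagram w₀ w₁ M) (hN : IsDiagram u₀ u₁ N) :
    IsDiagram (w₀ ++ u₀) (w₁ ++ u₁) (tensorRel M N) where
  pair x := by
    rcases pt_cases x with ⟨a, rfl⟩ | ⟨a, rfl⟩
    · obtain ⟨y, ⟨h1, h2⟩, h3⟩ := hM.pair a
      refine ⟨leftPt y, ⟨fun h => h1 (leftPt_injective h), tensorRel_left.2 h2⟩, ?_⟩
      rintro z ⟨hz, hz'⟩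
      rcases pt_cases z with ⟨b, rfl⟩ | ⟨b, rfl⟩
      · rw [h3 b ⟨fun h => hz (by rw [h]), tensorRel_left.1 hz'⟩]
      · exact absurd hz' tensorRel_ne
    · obtain ⟨y, ⟨h1, h2⟩, h3⟩ := hN.pair a
      refine ⟨rightPt y, ⟨fun h => h1 (rightPt_injective h), tensorRel_right.2 h2⟩, ?_⟩
      rintro z ⟨hz, hz'⟩
      rcases pt_cases z with ⟨b, rfl⟩ | ⟨b, rfl⟩
      · exact absurd hz' tensorRel_ne'
      · rw [h3 b ⟨fun h => hz (by rw [h]), tensorRel_right.1 hz'⟩]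
  planar x y z t h1 h2 h3 h4 h5 := by
    rcases pt_cases x with ⟨a, rfl⟩ | ⟨a, rfl⟩ <;> rcases pt_cases z with ⟨c, rfl⟩ | ⟨c, rfl⟩
    · rcases pt_cases y with ⟨b, rfl⟩ | ⟨b, rfl⟩ <;> rcases pt_cases t with ⟨e, rfl⟩ | ⟨e, rfl⟩
      · simp only [pos_leftPt] at h1 h2 h3
        exact hM.planar _ _ _ _ h1 h2 h3 (tensorRel_left.1 h4) (tensorRel_left.1 h5)
      · exact tensorRel_ne h5
      · exact tensorRel_ne' h5
      · have := pos_left_bound a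
        have := pos_left_bound c
        simp only [pos_leftPt] at h1 h2 h3
        rcases pos_right_bound (w₀ := w₀) (w₁ := w₁) b with ⟨h, h'⟩ | ⟨h, h'⟩ <;> omega
    · exact tensorRel_ne h4
    · exact tensorRel_ne' h4
    · rcases pt_cases y with ⟨b, rfl⟩ | ⟨b, rfl⟩ <;> rcases pt_cases t with ⟨e, rfl⟩ | ⟨e, rfl⟩
      · have := pos_left_bound b
        have := pos_left_bound e
        simp only [pos_leftPt] at h1 h2 h3
        rcases pos_right_bound (w₀ := w₀) (w₁ := w₁) c with ⟨h, h'⟩ | ⟨h, h'⟩ <;> omega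
      · exact tensorRel_ne h5
      · exact tensorRel_ne' h5
      · have mono : ∀ p q : Points u₀ u₁,
            pos (rightPt p : Points (w₀ ++ u₀) (w₁ ++ u₁)) <
              pos (rightPt q : Points (w₀ ++ u₀) (w₁ ++ u₁)) → pos p < pos q := by
          intro p q h
          rcases pos_right_bound (w₀ := w₀) (w₁ := w₁) p with ⟨e1, h'⟩ | ⟨e1, h'⟩ <;>
            rcases pos_right_bound (w₀ := w₀) (w₁ := w₁) q with ⟨e2, h''⟩ | ⟨e2, h''⟩ <;> omega
        exact hN.planar _ _ _ _ (mono _ _ h1) (mono _ _ h2) (mono _ _ h3)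
          (tensorRel_right.1 h4) (tensorRel_right.1 h5)
  oriented x y h hne := by
    rcases pt_cases x with ⟨a, rfl⟩ | ⟨a, rfl⟩ <;> rcases pt_cases y with ⟨b, rfl⟩ | ⟨b, rfl⟩
    · rw [isStart_leftPt, isStart_leftPt]
      exact hM.oriented _ _ (tensorRel_left.1 h) (fun e => hne (by rw [e]))
    · exact absurd h tensorRel_ne
    · exact absurd h tensorRel_ne'
    · rw [isStart_rightPt, isStart_rightPt]
      exact hN.oriented _ _ (tensorRel_right.1 h) (fun e => hne (by rw [e]))

section Interchange

/-- The left factor of three lines of points. -/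
def left3 : Fin w₀.length ⊕ (Fin w₁.length ⊕ Fin w₂.length) →
    Fin (w₀ ++ u₀).length ⊕ (Fin (w₁ ++ u₁).length ⊕ Fin (w₂ ++ u₂).length) :=
  Sum.map (leftFin w₀ u₀) (Sum.map (leftFin w₁ u₁) (leftFin w₂ u₂))

/-- The right factor of three lines of points. -/
def right3 : Fin u₀.length ⊕ (Fin u₁.length ⊕ Fin u₂.length) →
    Fin (w₀ ++ u₀).length ⊕ (Fin (w₁ ++ u₁).length ⊕ Fin (w₂ ++ u₂).length) :=
  Sum.map (rightFin w₀ u₀) (Sum.map (rightFin w₁ u₁) (rightFin w₂ u₂))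

variable (M : Setoid (Points w₀ w₁)) (N : Setoid (Points w₁ w₂))
  (M' : Setoid (Points u₀ u₁)) (N' : Setoid (Points u₁ u₂))

theorem glue_tensor :
    glue (tensorRel M M') (tensorRel N N') = (glue M N).map left3 ⊔ (glue M' N').map right3 := by
  have e1 : (up ∘ leftPt : Points w₀ w₁ →
      Fin (w₀ ++ u₀).length ⊕ (Fin (w₁ ++ u₁).length ⊕ Fin (w₂ ++ u₂).length)) = left3 ∘ up := by
    funext x; rcases x with x | x <;> rfl
  have e2 : (up ∘ rightPt : Points u₀ u₁ →
      Fin (w₀ ++ u₀).length ⊕ (Fin (w₁ ++ u₁).length ⊕ Fin (w₂ ++ u₂).length)) = right3 ∘ up := by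
    funext x; rcases x with x | x <;> rfl
  have e3 : (low ∘ leftPt : Points w₁ w₂ →
      Fin (w₀ ++ u₀).length ⊕ (Fin (w₁ ++ u₁).length ⊕ Fin (w₂ ++ u₂).length)) = left3 ∘ low := by
    funext x; rcases x with x | x <;> rfl
  have e4 : (low ∘ rightPt : Points u₁ u₂ →
      Fin (w₀ ++ u₀).length ⊕ (Fin (w₁ ++ u₁).length ⊕ Fin (w₂ ++ u₂).length)) = right3 ∘ low := by
    funext x; rcases x with x | x <;> rfl
  unfold glue tensorRel
  simp only [map_sup, map_map, e1, e2, e3, e4]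
  exact sup_sup_sup_comm _ _ _ _

theorem left3_injective : (left3 : Fin w₀.length ⊕ (Fin w₁.length ⊕ Fin w₂.length) →
    Fin (w₀ ++ u₀).length ⊕ (Fin (w₁ ++ u₁).length ⊕ Fin (w₂ ++ u₂).length)).Injective :=
  Sum.map_injective.2 ⟨leftFin_injective _ _,
    Sum.map_injective.2 ⟨leftFin_injective _ _, leftFin_injective _ _⟩⟩

theorem right3_injective : (right3 : Fin u₀.length ⊕ (Fin u₁.length ⊕ Fin u₂.length) →
    Fin (w₀ ++ u₀).length ⊕ (Fin (w₁ ++ u₁).length ⊕ Fin (w₂ ++ u₂).length)).Injective :=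
  Sum.map_injective.2 ⟨rightFin_injective _ _,
    Sum.map_injective.2 ⟨rightFin_injective _ _, rightFin_injective _ _⟩⟩

theorem left3_ne (a : Fin w₀.length ⊕ (Fin w₁.length ⊕ Fin w₂.length))
    (b : Fin u₀.length ⊕ (Fin u₁.length ⊕ Fin u₂.length)) : left3 a ≠ right3 b := by
  rcases a with a | a | a <;> rcases b with b | b | b <;> simp [left3, right3, leftFin_ne]

theorem cases3 (x : Fin (w₀ ++ u₀).length ⊕ (Fin (w₁ ++ u₁).length ⊕ Fin (w₂ ++ u₂).length)) :
    (∃ a, left3 a = x) ∨ ∃ b, right3 b = x := by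
  rcases x with x | x | x <;> rcases fin_cases _ _ x with ⟨j, rfl⟩ | ⟨j, rfl⟩
  · exact Or.inl ⟨Sum.inl j, rfl⟩
  · exact Or.inr ⟨Sum.inl j, rfl⟩
  · exact Or.inl ⟨Sum.inr (Sum.inl j), rfl⟩
  · exact Or.inr ⟨Sum.inr (Sum.inl j), rfl⟩
  · exact Or.inl ⟨Sum.inr (Sum.inr j), rfl⟩
  · exact Or.inr ⟨Sum.inr (Sum.inr j), rfl⟩

theorem outer_leftPt (a : Points w₀ w₂) :
    (outer (leftPt a) : Fin (w₀ ++ u₀).length ⊕ (Fin (w₁ ++ u₁).length ⊕ Fin (w₂ ++ u₂).length)) =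
      left3 (outer a) := by
  rcases a with a | a <;> rfl

theorem outer_rightPt (a : Points u₀ u₂) :
    (outer (rightPt a) : Fin (w₀ ++ u₀).length ⊕ (Fin (w₁ ++ u₁).length ⊕ Fin (w₂ ++ u₂).length)) =
      right3 (outer a) := by
  rcases a with a | a <;> rfl

theorem compRel_tensorRel :
    compRel (tensorRel M M') (tensorRel N N') = tensorRel (compRel M N) (compRel M' N') := by
  have h := sup_map_rel left3_injective right3_injective left3_ne (glue M N) (glue M' N')
  ext x y
  unfold compRel
  rw [Setoid.comap_rel, glue_tensor]
  rcases pt_cases x with ⟨a, rfl⟩ | ⟨a, rfl⟩ <;> rcases pt_cases y with ⟨b, rfl⟩ | ⟨b, rfl⟩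
  · rw [outer_leftPt, outer_leftPt, h.1, tensorRel_left]
    rfl
  · rw [outer_leftPt, outer_rightPt]
    exact iff_of_false (h.2.2 _ _) tensorRel_ne
  · rw [outer_leftPt, outer_rightPt]
    exact iff_of_false (fun e => h.2.2 _ _ (Setoid.symm' _ e)) tensorRel_ne'
  · rw [outer_rightPt, outer_rightPt, h.2.1, tensorRel_right]
    rfl

theorem loopCount_tensorRel :
    loopCount (tensorRel M M') (tensorRel N N') = loopCount M N + loopCount M' N' := by
  have h := sup_map_rel left3_injective right3_injective left3_ne (glue M N) (glue M' N')
  unfold loopCount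
  rw [glue_tensor]
  refine missed_sup h.1 h.2.1 h.2.2 cases3 ?_ ?_
  · intro b
    constructor
    · rintro ⟨e, he⟩
      rcases pt_cases e with ⟨a, rfl⟩ | ⟨a, rfl⟩
      · rw [outer_leftPt, h.1] at he
        exact ⟨a, he⟩
      · rw [outer_rightPt] at he
        exact absurd (Setoid.symm' _ he) (h.2.2 _ _)
    · rintro ⟨a, ha⟩
      refine ⟨leftPt a, ?_⟩
      rw [outer_leftPt, h.1]
      exact ha
  · intro b
    constructor
    · rintro ⟨e, he⟩
      rcases pt_cases e with ⟨a, rfl⟩ | ⟨a, rfl⟩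
      · rw [outer_leftPt] at he
        exact absurd he (h.2.2 _ _)
      · rw [outer_rightPt, h.2.1] at he
        exact ⟨a, he⟩
    · rintro ⟨a, ha⟩
      refine ⟨rightPt a, ?_⟩
      rw [outer_rightPt, h.2.1]
      exact ha

end Interchange

end Juxtapose

namespace Diagram

variable {w₀ w₁ w₂ w₃ u₀ u₁ u₂ v₀ v₁ : Word}

/-- Concatenation of strings, closed loops being removed. -/
def comp (D : Diagram w₀ w₁) (D' : Diagram w₁ w₂) : Diagram w₀ w₂ :=
  ⟨compRel D.rel D'.rel, D.isDiagram.comp D'.isDiagram⟩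

/-- The number of closed loops in a concatenation. -/
noncomputable def loops (D : Diagram w₀ w₁) (D' : Diagram w₁ w₂) : ℕ := loopCount D.rel D'.rel

/-- The diagram of straight strings. -/
def id (w : Word) : Diagram w w where
  rel := idRel
  isDiagram :=
    { pair := by
        rintro (i | i)
        · refine ⟨Sum.inr i, ⟨by simp, rfl⟩, ?_⟩
          rintro (j | j) ⟨h1, h2⟩
          · exact absurd (congrArg Sum.inl h2.symm) h1
          · exact congrArg Sum.inr (Eq.symm h2)
        · refine ⟨Sum.inl i, ⟨by simp, rfl⟩, ?_⟩
          rintro (j | j) ⟨h1, h2⟩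
          · exact congrArg Sum.inl (Eq.symm h2)
          · exact absurd (congrArg Sum.inr h2.symm) h1
      planar := by
        intro x y z t h1 h2 h3 h4 h5
        rcases x with x | x <;> rcases z with z | z <;> rcases y with y | y <;>
          rcases t with t | t <;> obtain rfl : x = z := h4 <;> obtain rfl : y = t := h5 <;>
          simp only [pos, Sum.elim_inl, Sum.elim_inr] at h1 h2 h3 <;> omega
      oriented := by
        rintro (x | x) (y | y) h hne <;> obtain rfl : x = y := h
        · exact absurd rfl hne
        · simp [isStart]
        · simp [isStart]
        · exact absurd rfl hne }

/-- Horizontal juxtaposition of diagrams. -/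
def tensor (D : Diagram w₀ w₁) (D' : Diagram u₀ u₁) : Diagram (w₀ ++ u₀) (w₁ ++ u₁) :=
  ⟨tensorRel D.rel D'.rel, D.isDiagram.tensor D'.isDiagram⟩

/-- The reflection of a diagram in a horizontal line, with all orientations reversed. -/
def reflect (D : Diagram w₀ w₁) : Diagram w₁ w₀ where
  rel := D.rel.comap Sum.swap
  isDiagram :=
    { pair := by
        intro x
        obtain ⟨y, ⟨h1, h2⟩, h3⟩ := D.isDiagram.pair x.swap
        refine ⟨y.swap, ⟨fun h => h1 (by rw [← h, Sum.swap_swap]), ?_⟩, ?_⟩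
        · rw [Setoid.comap_rel, Sum.swap_swap]
          exact h2
        · rintro z ⟨hz, hz'⟩
          rw [← h3 z.swap ⟨fun h => hz (by rw [← Sum.swap_swap z, h, Sum.swap_swap]), hz'⟩,
            Sum.swap_swap]
      planar := by
        intro x y z t h1 h2 h3 h4 h5
        have hp : ∀ p : Points w₁ w₀, pos p.swap = -1 - pos p := by
          rintro (p | p) <;> simp [pos]
        refine D.isDiagram.planar t.swap z.swap y.swap x.swap ?_ ?_ ?_ (D.rel.symm' h5)
          (D.rel.symm' h4) <;> rw [hp, hp] <;> omega
      oriented := by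
        intro x y h hne
        have hs : ∀ p : Points w₁ w₀, isStart p.swap = !isStart p := by
          rintro (p | p) <;> simp [isStart]
        have := D.isDiagram.oriented x.swap y.swap h
          (fun e => hne (by rw [← Sum.swap_swap x, e, Sum.swap_swap]))
        rw [hs, hs] at this
        exact fun e => this (by rw [e]) }

/-- The number of arcs joining two upper points. -/
noncomputable def upperArcs (D : Diagram w₀ w₁) : ℕ :=
  Nat.card {p : Fin w₀.length × Fin w₀.length // p.1 < p.2 ∧ D.rel (Sum.inl p.1) (Sum.inl p.2)}

/-- The number of arcs joining two lower points. -/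
noncomputable def lowerArcs (D : Diagram w₀ w₁) : ℕ :=
  Nat.card {p : Fin w₁.length × Fin w₁.length // p.1 < p.2 ∧ D.rel (Sum.inr p.1) (Sum.inr p.2)}

/-- The number of arcs of the form `ε` minus the number of arcs of the form `δ`. -/
noncomputable def sharp (D : Diagram w₀ w₁) : ℤ := (D.upperArcs : ℤ) - D.lowerArcs

/-- The basic arc joining the two points of an upper line labelled by a letter `b` followed by its
dual. -/
def arc (b : Bool) : Diagram [b, !b] [] where
  rel := ⊤
  isDiagram :=
    { pair := by
        rintro (x | x)
        · refine ⟨Sum.inl (Fin.rev x), ⟨?_, trivial⟩, ?_⟩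
          · fin_cases x <;> simp
          · rintro (y | y) ⟨h, -⟩
            · congr 1
              fin_cases x <;> fin_cases y <;> simp_all
            · exact y.elim0
        · exact x.elim0
      planar := by
        rintro (x | x) (y | y) (z | z) (t | t) h1 h2 h3
        · simp only [pos, Sum.elim_inl] at h1 h2 h3
          have := x.2
          simp only [List.length_cons, List.length_nil] at this
          omega
        all_goals first | exact x.elim0 | exact y.elim0 | exact z.elim0 | exact t.elim0
      oriented := by
        rintro (x | x) (y | y) - hne
        · fin_cases x <;> fin_cases y <;> simp_all [isStart]
        all_goals first | exact x.elim0 | exact y.elim0 }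

theorem id_comp (D : Diagram w₀ w₁) : (id w₀).comp D = D := Diagram.ext (idRel_comp D.rel)

theorem comp_id (D : Diagram w₀ w₁) : D.comp (id w₁) = D := Diagram.ext (comp_idRel D.rel)

theorem comp_assoc (D : Diagram w₀ w₁) (D' : Diagram w₁ w₂) (D'' : Diagram w₂ w₃) :
    (D.comp D').comp D'' = D.comp (D'.comp D'') := Diagram.ext (compRel_assoc _ _ _)

theorem loops_assoc (D : Diagram w₀ w₁) (D' : Diagram w₁ w₂) (D'' : Diagram w₂ w₃) :
    D.loops D' + (D.comp D').loops D'' = D'.loops D'' + D.loops (D'.comp D'') :=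
  loopCount_assoc _ _ _

theorem tensor_comp (D : Diagram w₀ w₁) (D' : Diagram w₁ w₂) (E : Diagram u₀ u₁)
    (E' : Diagram u₁ u₂) :
    (D.tensor E).comp (D'.tensor E') = (D.comp D').tensor (E.comp E') :=
  Diagram.ext (compRel_tensorRel _ _ _ _)

theorem loops_tensor (D : Diagram w₀ w₁) (D' : Diagram w₁ w₂) (E : Diagram u₀ u₁)
    (E' : Diagram u₁ u₂) :
    (D.tensor E).loops (D'.tensor E') = D.loops D' + E.loops E' :=
  loopCount_tensorRel _ _ _ _

theorem id_tensor_id (w u : Word) : (id w).tensor (id u) = id (w ++ u) := by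
  apply Diagram.ext
  have h : ∀ (v : Word) (x y : Points v v), (id v).rel x y ↔
      (Sum.elim _root_.id _root_.id x : Fin v.length) = Sum.elim _root_.id _root_.id y :=
    fun _ _ _ => Iff.rfl
  ext x y
  rw [h]
  change tensorRel (id w).rel (id u).rel x y ↔ _
  have l : ∀ a : Points w w, (Sum.elim _root_.id _root_.id (leftPt a : Points (w ++ u) (w ++ u))) =
      leftFin w u (Sum.elim _root_.id _root_.id a) := by
    rintro (a | a) <;> rfl
  have r : ∀ a : Points u u, (Sum.elim _root_.id _root_.id (rightPt a : Points (w ++ u) (w ++ u))) =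
      rightFin w u (Sum.elim _root_.id _root_.id a) := by
    rintro (a | a) <;> rfl
  rcases pt_cases x with ⟨a, rfl⟩ | ⟨a, rfl⟩ <;> rcases pt_cases y with ⟨b, rfl⟩ | ⟨b, rfl⟩
  · rw [tensorRel_left, l, l, h, (leftFin_injective w u).eq_iff]
  · rw [l, r]
    exact iff_of_false tensorRel_ne (leftFin_ne _ _ _ _)
  · rw [l, r]
    exact iff_of_false tensorRel_ne' (leftFin_ne _ _ _ _).symm
  · rw [tensorRel_right, r, r, h, (rightFin_injective w u).eq_iff]

/-- Relabelling of the boundary points along equalities of words. -/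
def castPt (h₀ : w₀ = u₀) (h₁ : w₁ = u₁) : Points w₀ w₁ → Points u₀ u₁ :=
  Sum.map (Fin.cast (by rw [h₀])) (Fin.cast (by rw [h₁]))

theorem tensor_assoc_rel (D : Diagram w₀ w₁) (E : Diagram u₀ u₁) (F : Diagram v₀ v₁) :
    ((D.tensor E).tensor F).rel.map
      (castPt (List.append_assoc w₀ u₀ v₀) (List.append_assoc w₁ u₁ v₁)) =
      (D.tensor (E.tensor F)).rel := by
  change ((D.rel.map leftPt ⊔ E.rel.map rightPt).map leftPt ⊔ F.rel.map rightPt).map _ =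
    D.rel.map leftPt ⊔ (E.rel.map leftPt ⊔ F.rel.map rightPt).map rightPt
  have e1 : castPt (List.append_assoc w₀ u₀ v₀) (List.append_assoc w₁ u₁ v₁) ∘ leftPt ∘ leftPt =
      (leftPt : Points w₀ w₁ → _) := by
    funext x
    rcases x with x | x <;> rfl
  have e2 : castPt (List.append_assoc w₀ u₀ v₀) (List.append_assoc w₁ u₁ v₁) ∘ leftPt ∘ rightPt =
      rightPt ∘ (leftPt : Points u₀ u₁ → _) := by
    funext x
    rcases x with x | x <;> rfl
  have e3 : castPt (List.append_assoc w₀ u₀ v₀) (List.append_assoc w₁ u₁ v₁) ∘ rightPt =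
      rightPt ∘ (rightPt : Points v₀ v₁ → _) := by
    funext x
    rcases x with x | x <;>
      · simp only [Function.comp, castPt, rightPt, Sum.map_inl, Sum.map_inr, rightFin]
        congr 1
        apply Fin.ext
        simp [Nat.add_assoc]
  simp only [map_sup, map_map]
  rw [sup_assoc, e1, e2, e3]

theorem id_nil_tensor (D : Diagram w₀ w₁) : @Eq (Diagram w₀ w₁) ((id []).tensor D) D := by
  apply Diagram.ext
  change idRel.map leftPt ⊔ D.rel.map (rightPt : Points w₀ w₁ → Points ([] ++ w₀) ([] ++ w₁)) = D.rel
  have h : (rightPt : Points w₀ w₁ → Points ([] ++ w₀) ([] ++ w₁)) = _root_.id := by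
    funext x
    rcases x with x | x <;>
      · simp only [rightPt, Sum.map_inl, Sum.map_inr, rightFin, _root_.id]
        congr 1
        apply Fin.ext
        simp
  rw [h]
  apply eq_of_forall_ge_iff
  intro c
  rw [sup_le_iff, map_le_iff, map_le_iff, Setoid.comap_id]
  refine and_iff_right_of_imp fun _ => ?_
  rintro (a | a) <;> exact a.elim0

theorem tensor_id_nil_rel (D : Diagram w₀ w₁) :
    (D.tensor (id [])).rel.map (castPt (List.append_nil w₀) (List.append_nil w₁)) = D.rel := by
  change (D.rel.map leftPt ⊔ (id []).rel.map rightPt).map _ = D.rel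
  have h : (castPt (List.append_nil w₀) (List.append_nil w₁) ∘ leftPt : Points w₀ w₁ → _) =
      _root_.id := by
    funext x
    rcases x with x | x <;> rfl
  rw [map_sup, map_map, h]
  apply eq_of_forall_ge_iff
  intro c
  rw [sup_le_iff, map_le_iff, map_le_iff, map_le_iff, Setoid.comap_id]
  refine and_iff_left_of_imp fun _ => ?_
  rintro (a | a) <;> exact a.elim0

end Diagram

end Diagrams
open CategoryTheory MonoidalCategory TensorProduct

section OrientedCategory

/-- The objects `X^w` of the category `O_d`. -/
@[ext]
structure Kauffman (d : ℂ) where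
  word : Word

namespace Kauffman

variable {d : ℂ} {w₀ w₁ w₂ w₃ u₀ u₁ u₂ : Word}

/-- Bilinear extension of the concatenation of diagrams, every closed loop (clockwise or
anticlockwise) being replaced by the scalar `d`. -/
noncomputable def compL (d : ℂ) :
    (Diagram w₀ w₁ →₀ ℂ) →ₗ[ℂ] (Diagram w₁ w₂ →₀ ℂ) →ₗ[ℂ] (Diagram w₀ w₂ →₀ ℂ) :=
  Finsupp.linearCombination ℂ fun D => Finsupp.linearCombination ℂ fun D' =>
    Finsupp.single (D.comp D') (d ^ D.loops D')

/-- Bilinear extension of the horizontal juxtaposition of diagrams. -/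
noncomputable def tensorL :
    (Diagram w₀ w₁ →₀ ℂ) →ₗ[ℂ] (Diagram u₀ u₁ →₀ ℂ) →ₗ[ℂ] (Diagram (w₀ ++ u₀) (w₁ ++ u₁) →₀ ℂ) :=
  Finsupp.linearCombination ℂ fun D => Finsupp.linearCombination ℂ fun D' =>
    Finsupp.single (D.tensor D') 1

theorem compL_single (D : Diagram w₀ w₁) (D' : Diagram w₁ w₂) (a b : ℂ) :
    compL d (Finsupp.single D a) (Finsupp.single D' b) =
      Finsupp.single (D.comp D') (a * b * d ^ D.loops D') := by
  simp only [compL, Finsupp.linearCombination_single, LinearMap.smul_apply, Finsupp.smul_single,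
    smul_eq_mul, mul_assoc]

theorem tensorL_single (D : Diagram w₀ w₁) (D' : Diagram u₀ u₁) (a b : ℂ) :
    tensorL (Finsupp.single D a) (Finsupp.single D' b) = Finsupp.single (D.tensor D') (a * b) := by
  simp only [tensorL, Finsupp.linearCombination_single, LinearMap.smul_apply, Finsupp.smul_single,
    smul_eq_mul, mul_one]

theorem compL_assoc (f : Diagram w₀ w₁ →₀ ℂ) (g : Diagram w₁ w₂ →₀ ℂ) (h : Diagram w₂ w₃ →₀ ℂ) :
    compL d (compL d f g) h = compL d f (compL d g h) := by
  induction f using Finsupp.induction_linear with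
  | zero => simp
  | add f f' hf hf' => simp only [map_add, LinearMap.add_apply, hf, hf']
  | single D a =>
    induction g using Finsupp.induction_linear with
    | zero => simp
    | add f f' hf hf' => simp only [map_add, LinearMap.add_apply, hf, hf']
    | single D' b =>
      induction h using Finsupp.induction_linear with
      | zero => simp
      | add f f' hf hf' => simp only [map_add, hf, hf']
      | single D'' c =>
        simp only [compL_single, Diagram.comp_assoc]
        congr 1
        have h := congrArg (fun n => d ^ n) (Diagram.loops_assoc D D' D'')
        simp only [pow_add] at h
        linear_combination (a * b * c) * h

theorem id_compL (f : Diagram w₀ w₁ →₀ ℂ) :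
    compL d (Finsupp.single (Diagram.id w₀) 1) f = f := by
  induction f using Finsupp.induction_linear with
  | zero => simp
  | add f f' hf hf' => simp only [map_add, hf, hf']
  | single D a =>
    have : (Diagram.id w₀).loops D = 0 := loopCount_idRel_left _
    rw [compL_single, Diagram.id_comp, this, pow_zero, mul_one, one_mul]

theorem compL_id (f : Diagram w₀ w₁ →₀ ℂ) :
    compL d f (Finsupp.single (Diagram.id w₁) 1) = f := by
  induction f using Finsupp.induction_linear with
  | zero => simp
  | add f f' hf hf' => simp only [map_add, LinearMap.add_apply, hf, hf']
  | single D a =>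
    have : D.loops (Diagram.id w₁) = 0 := loopCount_idRel_right _
    rw [compL_single, Diagram.comp_id, this, pow_zero, mul_one, mul_one]

/-- The category `O_d`: morphisms from `X^w` to `X^w'` form the free complex vector space on the
oriented Kauffman diagrams of type `(w, w')`. -/
noncomputable instance : Category (Kauffman d) where
  Hom X Y := Diagram X.word Y.word →₀ ℂ
  id X := Finsupp.single (Diagram.id X.word) 1
  comp f g := compL d f g
  id_comp := id_compL
  comp_id := compL_id
  assoc := compL_assoc

/-- A diagram as a morphism of `O_d`. -/
noncomputable def ofDiagram {X Y : Kauffman d} (D : Diagram X.word Y.word) : X ⟶ Y :=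
  (Finsupp.single D 1 : Diagram X.word Y.word →₀ ℂ)

noncomputable instance : Preadditive (Kauffman d) where
  homGroup X Y := inferInstanceAs (AddCommGroup (Diagram X.word Y.word →₀ ℂ))
  add_comp _ _ _ f f' g := LinearMap.map_add₂ (compL d) f f' g
  comp_add _ _ _ f g g' := LinearMap.map_add (compL d f) g g'

noncomputable instance : Linear ℂ (Kauffman d) where
  homModule X Y := inferInstanceAs (Module ℂ (Diagram X.word Y.word →₀ ℂ))
  smul_comp _ _ _ r f g := LinearMap.map_smul₂ (compL d) r f g
  comp_smul _ _ _ f r g := LinearMap.map_smul (compL d f) r g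

/-- The tensor structure of `O_d`: concatenation of words and juxtaposition of diagrams. It is
strict, so that the associator and the unitors are the identities of the respective words. -/
noncomputable instance : MonoidalCategoryStruct (Kauffman d) where
  tensorObj X Y := ⟨X.word ++ Y.word⟩
  tensorHom f g := tensorL f g
  whiskerLeft X _ _ f := tensorL (Finsupp.single (Diagram.id X.word) 1) f
  whiskerRight f Y := tensorL f (Finsupp.single (Diagram.id Y.word) 1)
  tensorUnit := ⟨[]⟩
  associator X Y Z := eqToIso (congrArg Kauffman.mk (List.append_assoc X.word Y.word Z.word))
  leftUnitor X := Iso.refl X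
  rightUnitor X := eqToIso (congrArg Kauffman.mk (List.append_nil X.word))

theorem single_comp_eqToHom {X Y X' Y' : Kauffman d} (hX : X = X') (hY : Y = Y')
    (D : Diagram X.word Y.word) (E : Diagram X'.word Y'.word)
    (h : D.rel.map (Diagram.castPt (congrArg word hX) (congrArg word hY)) = E.rel) (a : ℂ) :
    (Finsupp.single D a : X ⟶ Y) ≫ eqToHom hY = eqToHom hX ≫ (Finsupp.single E a : X' ⟶ Y') := by
  subst hX hY
  have e : (Diagram.castPt rfl rfl : Points X.word Y.word → Points X.word Y.word) = id := by
    funext x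
    rcases x with x | x <;> rfl
  have hDE : D = E := by
    apply Diagram.ext
    rw [← h, e]
    apply eq_of_forall_ge_iff
    intro c
    rw [map_le_iff, Setoid.comap_id]
  rw [hDE]
  simp

theorem tensorHom_id_id (X Y : Kauffman d) : (𝟙 X : X ⟶ X) ⊗ₘ (𝟙 Y : Y ⟶ Y) = 𝟙 (X ⊗ Y) := by
  change tensorL (Finsupp.single _ 1) (Finsupp.single _ 1) = Finsupp.single _ 1
  rw [tensorL_single, Diagram.id_tensor_id, mul_one]
  rfl

theorem eqToHom_tensor_eqToHom {X Y X' Y' : Kauffman d} (h : X = X') (h' : Y = Y') :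
    eqToHom h ⊗ₘ eqToHom h' = eqToHom (by rw [h, h'] : X ⊗ Y = X' ⊗ Y') := by
  subst h h'
  exact tensorHom_id_id _ _

theorem tensorL_compL (f : Diagram w₀ w₁ →₀ ℂ) (f' : Diagram u₀ u₁ →₀ ℂ)
    (g : Diagram w₁ w₂ →₀ ℂ) (g' : Diagram u₁ u₂ →₀ ℂ) :
    compL d (tensorL f f') (tensorL g g') = tensorL (compL d f g) (compL d f' g') := by
  induction f using Finsupp.induction_linear with
  | zero => simp
  | add f f' hf hf' => simp only [map_add, LinearMap.add_apply, hf, hf']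
  | single D a =>
    induction f' using Finsupp.induction_linear with
    | zero => simp
    | add f f' hf hf' => simp only [map_add, LinearMap.add_apply, hf, hf']
    | single D' b =>
      induction g using Finsupp.induction_linear with
      | zero => simp
      | add f f' hf hf' => simp only [map_add, LinearMap.add_apply, hf, hf']
      | single E a' =>
        induction g' using Finsupp.induction_linear with
        | zero => simp
        | add f f' hf hf' => simp only [map_add, hf, hf']
        | single E' b' =>
          simp only [compL_single, tensorL_single, Diagram.tensor_comp, Diagram.loops_tensor,
            pow_add]
          congr 1
          ring

noncomputable instance : MonoidalCategory (Kauffman d) :=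
  MonoidalCategory.ofTensorHom
    (id_tensorHom_id := tensorHom_id_id)
    (id_tensorHom := fun _ _ _ _ => rfl)
    (tensorHom_id := fun _ _ => rfl)
    (tensorHom_comp_tensorHom := fun f f' g g' => tensorL_compL f f' g g')
    (associator_naturality := by
      intro X₁ X₂ X₃ Y₁ Y₂ Y₃ f g h
      change compL d (tensorL (tensorL f g) h) _ = compL d _ (tensorL f (tensorL g h))
      induction f using Finsupp.induction_linear with
      | zero => simp
      | add f f' hf hf' => simp only [map_add, LinearMap.add_apply, hf, hf']
      | single D a =>
        induction g using Finsupp.induction_linear with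
        | zero => simp
        | add f f' hf hf' => simp only [map_add, LinearMap.add_apply, hf, hf']
        | single D' b =>
          induction h using Finsupp.induction_linear with
          | zero => simp
          | add f f' hf hf' => simp only [map_add, LinearMap.add_apply, hf, hf']
          | single D'' c =>
            simp only [tensorL_single, mul_assoc]
            exact single_comp_eqToHom
              (congrArg Kauffman.mk (List.append_assoc X₁.word X₂.word X₃.word))
              (congrArg Kauffman.mk (List.append_assoc Y₁.word Y₂.word Y₃.word))
              _ _ (Diagram.tensor_assoc_rel D D' D'') _)
    (leftUnitor_naturality := by
      intro X Y f
      change compL d (tensorL (Finsupp.single _ 1) f) (Finsupp.single _ 1) =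
        compL d (Finsupp.single _ 1) f
      induction f using Finsupp.induction_linear with
      | zero => simp
      | add f f' hf hf' => simp only [map_add, LinearMap.add_apply, hf, hf']
      | single D a =>
        rw [tensorL_single, one_mul]
        refine (compL_id _).trans (Eq.trans ?_ (id_compL _).symm)
        exact congrArg (fun E : Diagram X.word Y.word => Finsupp.single E a) (Diagram.id_nil_tensor D))
    (rightUnitor_naturality := by
      intro X Y f
      change compL d (tensorL f (Finsupp.single _ 1)) _ = compL d _ f
      induction f using Finsupp.induction_linear with
      | zero => simp
      | add f f' hf hf' => simp only [map_add, LinearMap.add_apply, hf, hf']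
      | single D a =>
        rw [tensorL_single, mul_one]
        exact single_comp_eqToHom (congrArg Kauffman.mk (List.append_nil X.word))
          (congrArg Kauffman.mk (List.append_nil Y.word)) _ _ (Diagram.tensor_id_nil_rel D) _)
    (pentagon := by
      intro W X Y Z
      have h1 := eqToHom_tensor_eqToHom (d := d)
        (congrArg Kauffman.mk (List.append_assoc W.word X.word Y.word)) (rfl : Z = Z)
      have h2 := eqToHom_tensor_eqToHom (d := d) (rfl : W = W)
        (congrArg Kauffman.mk (List.append_assoc X.word Y.word Z.word))
      refine Eq.trans (congrArg₂ (fun a b => a ≫ (α_ W (X ⊗ Y) Z).hom ≫ b) h1 h2) ?_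
      have h3 : ∀ {A B C D E : Kauffman d} (p : A = B) (q : B = C) (r : C = D) (s : A = E)
          (t : E = D), eqToHom p ≫ eqToHom q ≫ eqToHom r = eqToHom s ≫ eqToHom t := by
        intros
        simp only [eqToHom_trans]
      exact h3 _ (congrArg Kauffman.mk (List.append_assoc W.word (X.word ++ Y.word) Z.word)) _
        (congrArg Kauffman.mk (List.append_assoc (W.word ++ X.word) Y.word Z.word))
        (congrArg Kauffman.mk (List.append_assoc W.word X.word (Y.word ++ Z.word))))
    (triangle := by
      intro X Y
      have h1 := eqToHom_tensor_eqToHom (d := d)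
        (congrArg Kauffman.mk (List.append_nil X.word)) (rfl : Y = Y)
      refine Eq.trans ?_ h1.symm
      refine Eq.trans (congrArg (fun a => (α_ X (𝟙_ (Kauffman d)) Y).hom ≫ a)
        (tensorHom_id_id X Y)) ?_
      exact Category.comp_id _)

/-- The object `X`. -/
def X (d : ℂ) : Kauffman d := ⟨[true]⟩

/-- The object `X*`. -/
def Xdual (d : ℂ) : Kauffman d := ⟨[false]⟩

/-- The basic arc `X* ⊗ X ⟶ I`. -/
noncomputable def epsilonXdual (d : ℂ) : Xdual d ⊗ X d ⟶ 𝟙_ (Kauffman d) :=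
  ofDiagram (X := Xdual d ⊗ X d) (Y := 𝟙_ (Kauffman d)) (Diagram.arc false)

/-- The *-operation of `O_d` (for `d` real): the conjugate-linear extension of
`D ↦ (d / |d|) ^ ♯(D) • D'`, where `D'` is the orientation reversion of the reflection of `D`. -/
noncomputable def dagger {X Y : Kauffman d} (f : X ⟶ Y) : Y ⟶ X :=
  Finsupp.sum (f : Diagram X.word Y.word →₀ ℂ) fun D a =>
    (Finsupp.single D.reflect (starRingEnd ℂ a * (d / (‖d‖ : ℂ)) ^ D.sharp) :
      Diagram Y.word X.word →₀ ℂ)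

end Kauffman

end OrientedCategory

section HilbertSpaces

/-- Finite-dimensional complex Hilbert spaces. -/
structure FdHilb where
  carrier : Type
  [normed : NormedAddCommGroup carrier]
  [innerProduct : InnerProductSpace ℂ carrier]
  [finiteDimensional : FiniteDimensional ℂ carrier]

namespace FdHilb

instance : CoeSort FdHilb Type := ⟨carrier⟩

instance (V : FdHilb) : NormedAddCommGroup V := V.normed
instance (V : FdHilb) : InnerProductSpace ℂ V := V.innerProduct
instance (V : FdHilb) : FiniteDimensional ℂ V := V.finiteDimensional

/-- Morphisms of finite-dimensional Hilbert spaces are the linear maps. -/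
instance : Category FdHilb where
  Hom V W := V →ₗ[ℂ] W
  id V := LinearMap.id
  comp f g := g ∘ₗ f

instance : Preadditive FdHilb where
  homGroup V W := inferInstanceAs (AddCommGroup (V →ₗ[ℂ] W))
  add_comp _ _ _ f f' g := LinearMap.comp_add f f' g
  comp_add _ _ _ f g g' := LinearMap.add_comp f g' g

instance : Linear ℂ FdHilb where
  homModule V W := inferInstanceAs (Module ℂ (V →ₗ[ℂ] W))
  smul_comp _ _ _ r f g := LinearMap.comp_smul g r f
  comp_smul _ _ _ f r g := LinearMap.smul_comp r g f

/-- A linear equivalence as an isomorphism. -/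
def isoOf {V W : FdHilb} (e : V ≃ₗ[ℂ] W) : V ≅ W where
  hom := e.toLinearMap
  inv := e.symm.toLinearMap
  hom_inv_id := LinearMap.ext e.symm_apply_apply
  inv_hom_id := LinearMap.ext e.apply_symm_apply

/-- The Hilbert space tensor product. -/
noncomputable instance : MonoidalCategoryStruct FdHilb where
  tensorObj V W := ⟨V ⊗[ℂ] W⟩
  tensorHom f g := TensorProduct.map f g
  whiskerLeft V _ _ f := LinearMap.lTensor V f
  whiskerRight f V := LinearMap.rTensor V f
  tensorUnit := ⟨ℂ⟩
  associator U V W := isoOf (TensorProduct.assoc ℂ U V W)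
  leftUnitor V := isoOf (TensorProduct.lid ℂ V)
  rightUnitor V := isoOf (TensorProduct.rid ℂ V)

noncomputable instance : MonoidalCategory FdHilb :=
  MonoidalCategory.ofTensorHom
    (id_tensorHom_id := fun _ _ => TensorProduct.ext' fun _ _ => rfl)
    (id_tensorHom := fun _ _ _ _ => rfl)
    (tensorHom_id := fun _ _ => rfl)
    (tensorHom_comp_tensorHom := fun _ _ _ _ => TensorProduct.ext' fun _ _ => rfl)
    (associator_naturality := fun _ _ _ => TensorProduct.ext_threefold fun _ _ _ => rfl)
    (leftUnitor_naturality := fun {V W} f => TensorProduct.ext' fun (x : ℂ) (y : V) =>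
      (LinearMap.map_smul (M := V) (M₂ := W) f x y).symm)
    (rightUnitor_naturality := fun {V W} f => TensorProduct.ext' fun (y : V) (x : ℂ) =>
      (LinearMap.map_smul (M := V) (M₂ := W) f x y).symm)
    (pentagon := fun _ _ _ _ => TensorProduct.ext_fourfold fun _ _ _ _ => rfl)
    (triangle := fun V W => TensorProduct.ext_threefold fun (x : V) (c : ℂ) (y : W) =>
      (TensorProduct.smul_tmul c x y).symm)

/-- The adjoint of a linear map. -/
noncomputable def adjoint {V W : FdHilb} (f : V ⟶ W) : W ⟶ V :=
  LinearMap.adjoint (𝕜 := ℂ) (E := V) (F := W) f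

/-- Unitary morphisms. -/
def IsUnitary {V W : FdHilb} (f : V ⟶ W) : Prop :=
  f ≫ adjoint f = 𝟙 V ∧ adjoint f ≫ f = 𝟙 W

theorem adjoint_comp {U V W : FdHilb} (f : U ⟶ V) (g : V ⟶ W) :
    adjoint (f ≫ g) = adjoint g ≫ adjoint f :=
  LinearMap.adjoint_comp (𝕜 := ℂ) (E := U) (F := V) (G := W) g f

theorem adjoint_id (V : FdHilb) : adjoint (𝟙 V) = 𝟙 V :=
  LinearMap.adjoint_id (𝕜 := ℂ) (E := V)

theorem adjoint_adjoint {V W : FdHilb} (f : V ⟶ W) : adjoint (adjoint f) = f :=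
  LinearMap.adjoint_adjoint (𝕜 := ℂ) (E := V) (F := W) f

theorem IsUnitary.id (V : FdHilb) : IsUnitary (𝟙 V) := by
  unfold IsUnitary
  rw [adjoint_id]
  simp

theorem IsUnitary.comp {U V W : FdHilb} {f : U ⟶ V} {g : V ⟶ W} (hf : IsUnitary f)
    (hg : IsUnitary g) : IsUnitary (f ≫ g) := by
  unfold IsUnitary
  rw [adjoint_comp]
  constructor
  · rw [Category.assoc, reassoc_of% hg.1, hf.1]
  · rw [Category.assoc, reassoc_of% hf.2, hg.2]

theorem IsUnitary.inv {V W : FdHilb} {e : V ≅ W} (h : IsUnitary e.hom) : IsUnitary e.inv := by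
  have : e.inv = adjoint e.hom := by
    rw [← cancel_epi e.hom, Iso.hom_inv_id, h.1]
  unfold IsUnitary
  rw [this, adjoint_adjoint]
  exact h.symm

end FdHilb

end HilbertSpaces

section FiberFunctors

open Functor

/-- Unitary fiber functors: linear tensor functors from `O_d` to finite-dimensional Hilbert spaces
that preserve the *-operation and whose structure isomorphisms are unitary. -/
structure UnitaryFiberFunctor (d : ℝ) where
  toFunctor : Kauffman (d : ℂ) ⥤ FdHilb
  [monoidal : toFunctor.Monoidal]
  [additive : toFunctor.Additive]
  [linear : toFunctor.Linear ℂ]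
  map_dagger : ∀ {Y Z : Kauffman (d : ℂ)} (f : Y ⟶ Z),
    toFunctor.map (Kauffman.dagger f) = FdHilb.adjoint (toFunctor.map f)
  isUnitary_unit : FdHilb.IsUnitary (LaxMonoidal.ε toFunctor)
  isUnitary_tensor : ∀ Y Z : Kauffman (d : ℂ), FdHilb.IsUnitary (LaxMonoidal.μ toFunctor Y Z)

namespace UnitaryFiberFunctor

variable {d : ℝ}

attribute [instance] monoidal additive linear

/-- Unitary monoidal natural equivalence of unitary fiber functors. -/
def Equivalent (Φ Ψ : UnitaryFiberFunctor d) : Prop :=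
  ∃ η : Φ.toFunctor ≅ Ψ.toFunctor, NatTrans.IsMonoidal η.hom ∧
    ∀ Y, FdHilb.IsUnitary (η.hom.app Y)

/-- Unitary fiber functors up to unitary monoidal natural equivalence. -/
instance setoid (d : ℝ) : Setoid (UnitaryFiberFunctor d) where
  r := Equivalent
  iseqv :=
    { refl := fun Φ => ⟨Iso.refl _, NatTrans.IsMonoidal.id, fun _ => FdHilb.IsUnitary.id _⟩
      symm := by
        rintro Φ Ψ ⟨η, h1, h2⟩
        refine ⟨η.symm, ?_, fun Y => ?_⟩
        · exact inferInstanceAs (NatTrans.IsMonoidal η.inv)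
        · exact FdHilb.IsUnitary.inv (e := η.app Y) (h2 Y)
      trans := by
        rintro Φ Ψ Θ ⟨η, h1, h2⟩ ⟨θ, h3, h4⟩
        refine ⟨η ≪≫ θ, ?_, fun Y => ?_⟩
        · exact inferInstanceAs (NatTrans.IsMonoidal (η.hom ≫ θ.hom))
        · exact (h2 Y).comp (h4 Y) }

/-- The pairing `Φ(X*) ⊗ Φ(X) ⟶ ℂ` given by the image of the basic arc `X* ⊗ X ⟶ I`. -/
noncomputable def pairing (Φ : UnitaryFiberFunctor d) :
    Φ.toFunctor.obj (Kauffman.Xdual d) ⊗ Φ.toFunctor.obj (Kauffman.X d) ⟶ 𝟙_ FdHilb :=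
  LaxMonoidal.μ Φ.toFunctor _ _ ≫ Φ.toFunctor.map (Kauffman.epsilonXdual d) ≫
    OplaxMonoidal.η Φ.toFunctor

/-- The matrix of the pairing with respect to two orthonormal bases. -/
noncomputable def formMatrix (Φ : UnitaryFiberFunctor d) {m n : ℕ}
    (w : OrthonormalBasis (Fin m) ℂ (Φ.toFunctor.obj (Kauffman.Xdual d)))
    (v : OrthonormalBasis (Fin n) ℂ (Φ.toFunctor.obj (Kauffman.X d))) :
    Matrix (Fin m) (Fin n) ℂ :=
  Matrix.of fun j i => (show (_ ⊗[ℂ] _) →ₗ[ℂ] ℂ from Φ.pairing) (w j ⊗ₜ[ℂ] v i)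

end UnitaryFiberFunctor

/-- The list of eigenvalues, with multiplicities, of the positive part `|B| = (B* B)^(1/2)` in the
polar decomposition of `B`. -/
noncomputable def absEigenvalues {m n : ℕ} (B : Matrix (Fin m) (Fin n) ℂ) : Multiset ℝ :=
  Finset.univ.val.map fun i =>
    √((Matrix.isHermitian_conjTranspose_mul_self B).eigenvalues i)

/-- Lists (up to order) of positive numbers `μ₁, …, μₙ` with `∑ μⱼ² = |d| = ∑ μⱼ⁻²`. -/
def EigenvalueList (d : ℝ) : Type :=
  {μ : Multiset ℝ // (∀ t ∈ μ, 0 < t) ∧ (μ.map fun t => t ^ 2).sum = |d| ∧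
    (μ.map fun t => (t ^ 2)⁻¹).sum = |d|}

end FiberFunctors

end OrientedKauffman

/-!
A diagram of `O_d` is generated under composition by straight strings, by caps (straight strings
with one of the two basic arcs inserted at adjacent points) and by reflected caps
(`Diagram.generation`): an innermost arc joins adjacent points, and a planar diagram without arcs
on either side is an identity. A unitary fiber functor is therefore controlled by the bilinear
forms of the two basic arcs `X* ⊗ X ⟶ I` and `X ⊗ X* ⟶ I`.

*Necessary conditions.* Let `B` and `A` be the matrices of the two forms in orthonormal bases. The
zigzag relations say that `B` and the conjugate of `A` are inverse to each other up to a scalar of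
modulus one that depends only on `d` (`sum_form_mul_star_form`). Composing an arc with its adjoint
produces one loop, so that the squared Hilbert-Schmidt norms of `B` and `A` are both `|d|`
(`sum_norm_form`). In particular `B` is a square invertible matrix, and by the singular value
decomposition it is `diag(μ)` with `μ > 0` in suitable orthonormal bases
(`exists_formMatrix_diagonal`). The matrix `A` is then determined by `μ` (`form_arc_true`), and the
two norms are `∑ μⱼ²` and `∑ μⱼ⁻²` (`sum_eigenvalues`). A change of orthonormal bases, and the
passage to an equivalent functor, conjugate `B* B` by a unitary, which leaves its characteristic
polynomial unchanged.

*Injectivity.* If two functors have the same `μ`, then identifying the bases that diagonalize their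
forms gives isometries on `X` and `X*` that respect both forms. Being monoidal, such isometries
extend in a unique way to all words, and the extension is natural with respect to the arcs, hence,
as it is unitary, with respect to their reflections, hence with respect to all diagrams
(`equivalent_of_form`).

*Surjectivity.* Given `μ`, each word is sent to the Hilbert space with the labellings of its letters
by the indices of `μ` as an orthonormal basis. The matrix entry of a diagram at a labelling of its
boundary points vanishes unless both ends of every string carry the same label, and is otherwise
the product of the weights of the strings (`Diagram.coeff`); a turning string with label `i` has
weight `μᵢ` or `μᵢ⁻¹` up to the sign of `d`, depending on its direction, and the other strings have
weight one. Compatibility with composition (`Diagram.mat_comp`) has to be checked for caps only.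
There, either the cap closes a loop, and the sum over the label of the loop is `d` by one of the two
equations for `μ`, or it joins two strings, whose weights multiply to the weight of the resulting
string by planarity (`Diagram.wt_join`).
-/


namespace OrientedKauffman

/-! ### Partners of boundary points -/

namespace Diagram

variable {w₀ w₁ w₂ w₃ : Word}

/-- The other end of the string that starts or ends at a given boundary point. -/
noncomputable def partner (D : Diagram w₀ w₁) : Points w₀ w₁ → Points w₀ w₁ :=
  D.isDiagram.exists_partner.choose

theorem partner_ne (D : Diagram w₀ w₁) (x : Points w₀ w₁) : D.partner x ≠ x :=
  D.isDiagram.exists_partner.choose_spec.1 x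

theorem rel_partner (D : Diagram w₀ w₁) (x : Points w₀ w₁) : D.rel x (D.partner x) :=
  D.isDiagram.exists_partner.choose_spec.2.1 x

theorem partner_partner (D : Diagram w₀ w₁) (x : Points w₀ w₁) : D.partner (D.partner x) = x :=
  D.isDiagram.exists_partner.choose_spec.2.2.1 x

theorem partner_eq (D : Diagram w₀ w₁) {x y : Points w₀ w₁} (h : D.rel x y) (hne : y ≠ x) :
    D.partner x = y :=
  (D.isDiagram.exists_partner.choose_spec.2.2.2 x y h hne).symm

theorem rel_iff (D : Diagram w₀ w₁) {x y : Points w₀ w₁} :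
    D.rel x y ↔ y = x ∨ y = D.partner x := by
  constructor
  · intro h
    by_cases hne : y = x
    · exact Or.inl hne
    · exact Or.inr (D.partner_eq h hne).symm
  · rintro (rfl | rfl)
    · exact D.rel.refl' _
    · exact D.rel_partner x

theorem isStart_partner (D : Diagram w₀ w₁) (x : Points w₀ w₁) :
    isStart (D.partner x) = !isStart x := by
  have := D.isDiagram.oriented x _ (D.rel_partner x) (D.partner_ne x).symm
  revert this
  cases isStart x <;> cases isStart (D.partner x) <;> simp

/-- Since all strings have two ends, a diagram that refines another one is equal to it. -/
theorem eq_of_le {D E : Diagram w₀ w₁} (h : D.rel ≤ E.rel) : D = E := by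
  have hp : ∀ x, E.partner x = D.partner x := fun x =>
    E.partner_eq (h (D.rel_partner x)) (D.partner_ne x)
  apply Diagram.ext
  ext x y
  rw [rel_iff, rel_iff, hp]

theorem reflect_reflect (D : Diagram w₀ w₁) : D.reflect.reflect = D := by
  apply eq_of_le
  intro x y h
  change D.rel x.swap.swap y.swap.swap at h
  simpa using h

theorem reflect_comp (D : Diagram w₀ w₁) (E : Diagram w₁ w₂) :
    (D.comp E).reflect = E.reflect.comp D.reflect := by
  let r : Fin w₀.length ⊕ (Fin w₁.length ⊕ Fin w₂.length) →
      Fin w₂.length ⊕ (Fin w₁.length ⊕ Fin w₀.length) :=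
    Sum.elim (fun i => Sum.inr (Sum.inr i)) (Sum.elim (fun i => Sum.inr (Sum.inl i)) Sum.inl)
  have hr : glue D.rel E.rel ≤ (glue E.reflect.rel D.reflect.rel).comap r := by
    refine sup_le ?_ ?_ <;> rw [map_le_iff] <;> intro x y h
    · have e : ∀ z : Points w₀ w₁, r (up z) = low z.swap := by rintro (z | z) <;> rfl
      change glue E.reflect.rel D.reflect.rel (r (up x)) (r (up y))
      rw [e, e]
      refine glue_low ?_
      change D.rel x.swap.swap y.swap.swap
      simpa using h
    · have e : ∀ z : Points w₁ w₂, r (low z) = up z.swap := by rintro (z | z) <;> rfl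
      change glue E.reflect.rel D.reflect.rel (r (low x)) (r (low y))
      rw [e, e]
      refine glue_up ?_
      change E.rel x.swap.swap y.swap.swap
      simpa using h
  apply eq_of_le
  intro x y h
  have e : ∀ z : Points w₂ w₀, r (outer z.swap) = outer z := by rintro (z | z) <;> rfl
  have h' : glue E.reflect.rel D.reflect.rel (r (outer x.swap)) (r (outer y.swap)) := hr h
  rw [e, e] at h'
  exact h'

end Diagram

/-! ### Caps -/

/-- The diagram `K` joins the adjacent upper points `P` and `Q` and consists otherwise of straight
strings, from the upper points `ι j` to the lower points `j`. -/
structure IsCap {w₁ w₂ : Word} (K : Diagram w₁ w₂) (ι : Fin w₂.length → Fin w₁.length)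
    (P Q : Fin w₁.length) : Prop where
  strictMono : StrictMono ι
  next : (Q : ℕ) = P + 1
  ne_left : ∀ j, ι j ≠ P
  ne_right : ∀ j, ι j ≠ Q
  cases : ∀ i, i = P ∨ i = Q ∨ ∃ j, ι j = i
  arc : K.rel (Sum.inl P) (Sum.inl Q)
  straight : ∀ j, K.rel (Sum.inl (ι j)) (Sum.inr j)

namespace IsCap

variable {w₀ w₁ w₂ : Word} {K : Diagram w₁ w₂} {ι : Fin w₂.length → Fin w₁.length}
  {P Q : Fin w₁.length}

theorem ne (hK : IsCap K ι P Q) : P ≠ Q := by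
  intro h
  have := hK.next
  rw [h] at this
  omega

theorem get_eq (hK : IsCap K ι P Q) (j : Fin w₂.length) : w₁.get (ι j) = w₂.get j := by
  have := K.isDiagram.oriented _ _ (hK.straight j) (by simp)
  simp only [isStart, Sum.elim_inl, Sum.elim_inr] at this
  revert this
  cases w₁.get (ι j) <;> cases w₂.get j <;> simp

theorem get_right (hK : IsCap K ι P Q) : w₁.get Q = !w₁.get P := by
  have := K.isDiagram.oriented _ _ hK.arc (fun h => hK.ne (Sum.inl_injective h))
  simp only [isStart, Sum.elim_inl] at this
  revert this
  cases w₁.get P <;> cases w₁.get Q <;> simp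

/-- The boundary points that remain after a cap has been put below a diagram. -/
def lift (ι : Fin w₂.length → Fin w₁.length) : Points w₀ w₂ → Points w₀ w₁ := Sum.map id ι

theorem lift_injective (hK : IsCap K ι P Q) :
    (lift ι : Points w₀ w₂ → Points w₀ w₁).Injective :=
  Sum.map_injective.2 ⟨Function.injective_id, hK.strictMono.injective⟩

theorem lift_ne_left (hK : IsCap K ι P Q) (x : Points w₀ w₂) : lift ι x ≠ Sum.inr P := by
  rcases x with x | x <;> simp [lift, hK.ne_left]

theorem lift_ne_right (hK : IsCap K ι P Q) (x : Points w₀ w₂) : lift ι x ≠ Sum.inr Q := by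
  rcases x with x | x <;> simp [lift, hK.ne_right]

theorem point_cases (hK : IsCap K ι P Q) (x : Points w₀ w₁) :
    x = Sum.inr P ∨ x = Sum.inr Q ∨ ∃ y : Points w₀ w₂, lift ι y = x := by
  rcases x with x | x
  · exact Or.inr (Or.inr ⟨Sum.inl x, rfl⟩)
  · rcases hK.cases x with rfl | rfl | ⟨j, rfl⟩
    · exact Or.inl rfl
    · exact Or.inr (Or.inl rfl)
    · exact Or.inr (Or.inr ⟨Sum.inr j, rfl⟩)

theorem isStart_lift (hK : IsCap K ι P Q) (x : Points w₀ w₂) :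
    isStart (lift ι x : Points w₀ w₁) = isStart x := by
  rcases x with x | x
  · rfl
  · simp only [isStart, lift, Sum.map_inr, Sum.elim_inr, hK.get_eq]

theorem glue_outer (hK : IsCap K ι P Q) (D : Diagram w₀ w₁) (x : Points w₀ w₂) :
    glue D.rel K.rel (outer x) (up (lift ι x)) := by
  rcases x with x | x
  · exact Setoid.refl' _ _
  · exact Setoid.symm' _ (glue_low (hK.straight x))

theorem glue_arc (hK : IsCap K ι P Q) (D : Diagram w₀ w₁) :
    glue D.rel K.rel (up (Sum.inr P)) (up (Sum.inr Q)) :=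
  glue_low hK.arc

theorem comp_rel (hK : IsCap K ι P Q) (D : Diagram w₀ w₁) {x y : Points w₀ w₂}
    (h : D.rel (lift ι x) (lift ι y)) : (D.comp K).rel x y :=
  Setoid.trans' (glue D.rel K.rel) (hK.glue_outer D x)
    (Setoid.trans' (glue D.rel K.rel) (glue_up h)
      (Setoid.symm' (glue D.rel K.rel) (hK.glue_outer D y)))

theorem comp_rel_of_arc (hK : IsCap K ι P Q) (D : Diagram w₀ w₁) {x y : Points w₀ w₂}
    (h : D.rel (lift ι x) (Sum.inr P)) (h' : D.rel (Sum.inr Q) (lift ι y)) :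
    (D.comp K).rel x y :=
  Setoid.trans' (glue D.rel K.rel)
    (Setoid.trans' (glue D.rel K.rel) (hK.glue_outer D x) (glue_up h))
    (Setoid.trans' (glue D.rel K.rel) (hK.glue_arc D)
      (Setoid.trans' (glue D.rel K.rel) (glue_up h')
        (Setoid.symm' (glue D.rel K.rel) (hK.glue_outer D y))))

/-- Putting a cap below an arc closes a loop. -/
theorem loops_of_rel (hK : IsCap K ι P Q) (D : Diagram w₀ w₁)
    (h : D.rel (Sum.inr P) (Sum.inr Q)) : D.loops K = 1 := by
  have hPQ : D.partner (Sum.inr P) = Sum.inr Q :=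
    D.partner_eq h (fun e => hK.ne (Sum.inr_injective e).symm)
  have hQP : D.partner (Sum.inr Q) = Sum.inr P := by rw [← hPQ, D.partner_partner]
  let mid : Fin w₁.length → Fin w₀.length ⊕ (Fin w₁.length ⊕ Fin w₂.length) :=
    fun i => Sum.inr (Sum.inl i)
  -- the points `P` and `Q` of the middle line are separated from all other points
  let T : Setoid (Fin w₀.length ⊕ (Fin w₁.length ⊕ Fin w₂.length)) :=
    Setoid.ker fun z => z = mid P ∨ z = mid Q
  have hT : glue D.rel K.rel ≤ T := by
    refine sup_le ?_ ?_ <;> rw [map_le_iff] <;> intro x y hxy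
    · change (up x = up (Sum.inr P) ∨ up x = up (Sum.inr Q)) =
        (up y = up (Sum.inr P) ∨ up y = up (Sum.inr Q))
      simp only [up_injective.eq_iff]
      rcases D.rel_iff.1 hxy with rfl | rfl
      · rfl
      · have e : ∀ a b : Points w₀ w₁, D.partner a = b ↔ a = D.partner b := fun a b =>
          ⟨fun e => by rw [← e, D.partner_partner], fun e => by rw [e, D.partner_partner]⟩
        rw [e, e, hPQ, hQP, or_comm]
    · have hKP : K.partner (Sum.inl P) = Sum.inl Q :=
        K.partner_eq hK.arc (fun e => hK.ne (Sum.inl_injective e).symm)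
      have hKQ : K.partner (Sum.inl Q) = Sum.inl P := by rw [← hKP, K.partner_partner]
      change (low x = low (Sum.inl P) ∨ low x = low (Sum.inl Q)) =
        (low y = low (Sum.inl P) ∨ low y = low (Sum.inl Q))
      simp only [low_injective.eq_iff]
      rcases K.rel_iff.1 hxy with rfl | rfl
      · rfl
      · have e : ∀ a b : Points w₁ w₂, K.partner a = b ↔ a = K.partner b := fun a b =>
          ⟨fun e => by rw [← e, K.partner_partner], fun e => by rw [e, K.partner_partner]⟩
        rw [e, e, hKP, hKQ, or_comm]
  have hmissed : ∀ a : Points w₀ w₂, Quotient.mk (glue D.rel K.rel) (outer a) ≠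
      Quotient.mk _ (mid P) := by
    intro a ha
    have h1 := hT (Quotient.exact ha)
    have h2 : (outer a = mid P ∨ outer a = mid Q) = (mid P = mid P ∨ mid P = mid Q) := h1
    have h3 : outer a = mid P ∨ outer a = mid Q := by
      rw [h2]
      exact Or.inl rfl
    rcases a with a | a <;> simp [outer, mid] at h3
  unfold Diagram.loops loopCount missed
  rw [Nat.card_eq_one_iff_unique]
  refine ⟨⟨?_⟩, ⟨⟨_, hmissed⟩⟩⟩
  have key : ∀ q : {q : Quotient (glue D.rel K.rel) //
      ∀ a : Points w₀ w₂, Quotient.mk _ (outer a) ≠ q}, q.1 = Quotient.mk _ (mid P) := by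
    rintro ⟨q, hq⟩
    induction q using Quotient.inductionOn with
    | h z =>
      rcases z with z | z | z
      · exact absurd rfl (hq (Sum.inl z))
      · rcases hK.cases z with rfl | rfl | ⟨j, rfl⟩
        · rfl
        · exact Quotient.sound (Setoid.symm' _ (hK.glue_arc D))
        · exact absurd (Quotient.sound (hK.glue_outer D (Sum.inr j))) (hq (Sum.inr j))
      · exact absurd rfl (hq (Sum.inr z))
  intro a b
  exact Subtype.ext ((key a).trans (key b).symm)

/-- A cap below two different strings joins them, and no loop arises. -/
theorem loops_of_not_rel (hK : IsCap K ι P Q) (D : Diagram w₀ w₁)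
    (h : ¬ D.rel (Sum.inr P) (Sum.inr Q)) : D.loops K = 0 := by
  have hP : ∃ x : Points w₀ w₂, lift ι x = D.partner (Sum.inr P) := by
    rcases hK.point_cases (D.partner (Sum.inr P)) with e | e | e
    · exact absurd e (D.partner_ne _)
    · exact absurd (e ▸ D.rel_partner _) h
    · exact e
  obtain ⟨p, hp⟩ := hP
  have hpP : glue D.rel K.rel (outer p) (up (Sum.inr P)) :=
    Setoid.trans' _ (hK.glue_outer D p) (Setoid.symm' _ (glue_up (hp ▸ D.rel_partner _)))
  refine missed_eq_zero ?_
  rintro (z | z | z)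
  · exact ⟨Sum.inl z, Setoid.refl' _ _⟩
  · rcases hK.cases z with rfl | rfl | ⟨j, rfl⟩
    · exact ⟨p, hpP⟩
    · exact ⟨p, Setoid.trans' _ hpP (hK.glue_arc D)⟩
    · exact ⟨Sum.inr j, hK.glue_outer D (Sum.inr j)⟩
  · exact ⟨Sum.inr z, Setoid.refl' _ _⟩

theorem comp_reflect_rel (hK : IsCap K ι P Q) (D : Diagram w₀ w₂) {x y : Points w₀ w₂}
    (h : D.rel x y) : (D.comp K.reflect).rel (lift ι x) (lift ι y) := by
  have key : ∀ z : Points w₀ w₂, glue D.rel K.reflect.rel (outer (lift ι z)) (up z) := by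
    rintro (z | z)
    · exact Setoid.refl' _ _
    · exact glue_low (M := D.rel) (x := Sum.inr (ι z)) (y := Sum.inl z) (hK.straight z)
  exact Setoid.trans' (glue D.rel K.reflect.rel) (key x) (Setoid.trans' (glue D.rel K.reflect.rel)
    (glue_up h)
    (Setoid.symm' (glue D.rel K.reflect.rel) (key y)))

theorem comp_reflect_arc (hK : IsCap K ι P Q) (D : Diagram w₀ w₂) :
    (D.comp K.reflect).rel (Sum.inr P) (Sum.inr Q) :=
  glue_low (M := D.rel) (x := Sum.inr P) (y := Sum.inr Q) hK.arc

theorem loops_reflect (hK : IsCap K ι P Q) (D : Diagram w₀ w₂) : D.loops K.reflect = 0 := by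
  refine missed_eq_zero ?_
  rintro (z | z | z)
  · exact ⟨Sum.inl z, Setoid.refl' _ _⟩
  · exact ⟨Sum.inr (ι z),
      glue_low (M := D.rel) (x := Sum.inr (ι z)) (y := Sum.inl z) (hK.straight z)⟩
  · exact ⟨Sum.inr z, Setoid.refl' _ _⟩

theorem loops_left (hK : IsCap K ι P Q) (E : Diagram w₂ w₀) : K.loops E = 0 := by
  refine missed_eq_zero ?_
  rintro (z | z | z)
  · exact ⟨Sum.inl z, Setoid.refl' _ _⟩
  · exact ⟨Sum.inl (ι z), glue_up (N := E.rel) (hK.straight z)⟩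
  · exact ⟨Sum.inr z, Setoid.refl' _ _⟩

/-- A diagram with an arc at the place of a cap factors through the reflected cap. -/
theorem comp_comp_reflect (hK : IsCap K ι P Q) (D : Diagram w₀ w₁)
    (h : D.rel (Sum.inr P) (Sum.inr Q)) : (D.comp K).comp K.reflect = D := by
  symm
  apply Diagram.eq_of_le
  intro x y hxy
  have hPQ : D.partner (Sum.inr P) = Sum.inr Q :=
    D.partner_eq h (fun e => hK.ne (Sum.inr_injective e).symm)
  have hQP : D.partner (Sum.inr Q) = Sum.inr P := by rw [← hPQ, D.partner_partner]
  rcases D.rel_iff.1 hxy with rfl | rfl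
  · exact Setoid.refl' _ _
  rcases hK.point_cases x with rfl | rfl | ⟨x, rfl⟩
  · rw [hPQ]
    exact hK.comp_reflect_arc _
  · rw [hQP]
    exact Setoid.symm' _ (hK.comp_reflect_arc _)
  · rcases hK.point_cases (D.partner (lift ι x)) with e | e | ⟨y, e⟩
    · exact absurd (by rw [← hPQ, ← e, D.partner_partner]) (hK.lift_ne_right x)
    · exact absurd (by rw [← hQP, ← e, D.partner_partner]) (hK.lift_ne_left x)
    · rw [← e] at hxy ⊢
      exact hK.comp_reflect_rel _ (hK.comp_rel _ hxy)

theorem comp_reflect_comp (hK : IsCap K ι P Q) (D : Diagram w₁ w₀)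
    (h : D.rel (Sum.inl P) (Sum.inl Q)) : K.comp (K.reflect.comp D) = D := by
  have := congrArg Diagram.reflect (hK.comp_comp_reflect D.reflect h)
  rwa [Diagram.reflect_comp, Diagram.reflect_comp, Diagram.reflect_reflect,
    Diagram.reflect_reflect] at this

end IsCap

end OrientedKauffman

namespace OrientedKauffman

/-! ### Generation of diagrams by caps and reflected caps -/

namespace Diagram

/-- The diagram of straight strings with one basic arc inserted between the words `u` and `v`. -/
def cap (u : Word) (b : Bool) (v : Word) : Diagram (u ++ ([b, !b] ++ v)) (u ++ v) :=
  (id u).tensor ((arc b).tensor (id v))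

/-- The upper points of a cap that are not joined by its arc. -/
def capInj (u : Word) (b : Bool) (v : Word) (j : Fin (u ++ v).length) :
    Fin (u ++ ([b, !b] ++ v)).length :=
  ⟨if (j : ℕ) < u.length then j else j + 2, by
    have := lt_of_lt_of_eq j.2 List.length_append
    simp only [List.length_append, List.length_cons, List.length_nil]
    split_ifs <;> omega⟩

theorem capInj_left (u : Word) (b : Bool) (v : Word) (j : Fin u.length) :
    capInj u b v (leftFin u v j) = leftFin u ([b, !b] ++ v) j :=
  Fin.ext (if_pos j.2)

theorem capInj_right (u : Word) (b : Bool) (v : Word) (j : Fin v.length) :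
    capInj u b v (rightFin u v j) = rightFin u ([b, !b] ++ v) (rightFin [b, !b] v j) := by
  refine Fin.ext ((if_neg (by simp [rightFin])).trans ?_)
  simp only [rightFin, List.length_cons, List.length_nil]
  omega

/-- The left end of the arc of a cap. -/
def capLeft (u : Word) (b : Bool) (v : Word) : Fin (u ++ ([b, !b] ++ v)).length :=
  rightFin u ([b, !b] ++ v) (leftFin [b, !b] v (0 : Fin 2))

/-- The right end of the arc of a cap. -/
def capRight (u : Word) (b : Bool) (v : Word) : Fin (u ++ ([b, !b] ++ v)).length :=
  rightFin u ([b, !b] ++ v) (leftFin [b, !b] v (1 : Fin 2))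

theorem cap_isCap (u : Word) (b : Bool) (v : Word) :
    IsCap (cap u b v) (capInj u b v) (capLeft u b v) (capRight u b v) where
  strictMono := by
    intro i j h
    have h' : (i : ℕ) < j := h
    rw [Fin.lt_def]
    dsimp only [capInj]
    split_ifs <;> omega
  next := by simp [rightFin, leftFin, capLeft, capRight]
  ne_left := by
    intro j h
    have := congrArg Fin.val h
    simp only [capInj, capLeft, leftFin, rightFin, Fin.val_zero, add_zero] at this
    split_ifs at this <;> omega
  ne_right := by
    intro j h
    have := congrArg Fin.val h
    simp only [capInj, capRight, leftFin, rightFin, Fin.val_one] at this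
    split_ifs at this <;> omega
  cases := by
    intro i
    rcases fin_cases _ _ i with ⟨j, rfl⟩ | ⟨j, rfl⟩
    · exact Or.inr (Or.inr ⟨leftFin u v j, capInj_left u b v j⟩)
    · rcases fin_cases _ _ j with ⟨k, rfl⟩ | ⟨k, rfl⟩
      · have : k = (0 : Fin 2) ∨ k = (1 : Fin 2) := by
          have := k.2
          simp only [List.length_cons, List.length_nil] at this
          rcases (by omega : (k : ℕ) = 0 ∨ (k : ℕ) = 1) with h | h
          · exact Or.inl (Fin.ext h)
          · exact Or.inr (Fin.ext h)
        rcases this with rfl | rfl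
        · exact Or.inl rfl
        · exact Or.inr (Or.inl rfl)
      · exact Or.inr (Or.inr ⟨rightFin u v k, capInj_right u b v k⟩)
  arc := by
    have h : (arc b).rel (Sum.inl (0 : Fin 2)) (Sum.inl (1 : Fin 2)) := trivial
    exact tensorRel_right.2 (tensorRel_left.2 h)
  straight := by
    intro j
    rcases fin_cases u v j with ⟨j, rfl⟩ | ⟨j, rfl⟩
    · rw [capInj_left]
      have h : (id u).rel (Sum.inl j) (Sum.inr j) := rfl
      exact tensorRel_left.2 h
    · rw [capInj_right]
      have h : (id v).rel (Sum.inl j) (Sum.inr j) := rfl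
      have h2 : ((arc b).tensor (id v)).rel (rightPt (Sum.inl j)) (rightPt (Sum.inr j)) :=
        tensorRel_right.2 h
      have e' : (rightPt (Sum.inr j) : Points ([b, !b] ++ v) ([] ++ v)) = Sum.inr j :=
        congrArg Sum.inr (Fin.ext (by simp [rightFin]))
      rw [e'] at h2
      have h3 : tensorRel (id u).rel ((arc b).tensor (id v)).rel _ _ := tensorRel_right.2 h2
      exact h3

theorem isStart_inl {w w' : Word} (i : Fin w.length) :
    isStart (Sum.inl i : Points w w') = w.get i := rfl

theorem isStart_inr {w w' : Word} (i : Fin w'.length) :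
    isStart (Sum.inr i : Points w w') = !(w'.get i) := rfl

variable {w w' : Word}

/-- An innermost arc joins adjacent points. -/
theorem exists_adjacent (D : Diagram w w') {i j : Fin w.length} (hij : i < j)
    (h : D.rel (Sum.inl i) (Sum.inl j)) :
    ∃ P Q : Fin w.length, (Q : ℕ) = P + 1 ∧ D.rel (Sum.inl P) (Sum.inl Q) := by
  obtain ⟨n, hn⟩ : ∃ n, n = (j : ℕ) - i := ⟨_, rfl⟩
  induction n using Nat.strong_induction_on generalizing i j with
  | _ n ih =>
  have hij' : (i : ℕ) < j := hij
  by_cases hj : (j : ℕ) = i + 1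
  · exact ⟨i, j, hj, h⟩
  -- by planarity the arc that ends at the successor of `i` stays between `i` and `j`
  let k : Fin w.length := ⟨i + 1, by have := j.2; omega⟩
  have hk := D.rel_partner (Sum.inl k)
  have hpi : D.partner (Sum.inl i) = Sum.inl j :=
    D.partner_eq h (fun e => by have := Sum.inl_injective e; omega)
  have hpj : D.partner (Sum.inl j) = Sum.inl i := by rw [← hpi, D.partner_partner]
  have hkk := D.partner_partner (Sum.inl k)
  have hkne := D.partner_ne (Sum.inl k)
  generalize D.partner (Sum.inl k) = y at hk hkk hkne
  have hpl := D.isDiagram.planar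
  rcases y with l | l
  · have h1 : ¬ (l : ℕ) < i := fun hl =>
      hpl (Sum.inl j) (Sum.inl k) (Sum.inl i) (Sum.inl l)
        (by simp only [pos, Sum.elim_inl, k]; omega)
        (by simp only [pos, Sum.elim_inl, k]; omega) (by simp only [pos, Sum.elim_inl]; omega)
        (D.rel.symm' h) hk
    have h2 : ¬ (j : ℕ) < l := fun hl =>
      hpl (Sum.inl l) (Sum.inl j) (Sum.inl k) (Sum.inl i)
        (by simp only [pos, Sum.elim_inl]; omega)
        (by simp only [pos, Sum.elim_inl, k]; omega)
        (by simp only [pos, Sum.elim_inl, k]; omega)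
        (D.rel.symm' hk) (D.rel.symm' h)
    have h3 : (l : ℕ) ≠ i := by
      intro e
      rw [Fin.ext e, hpi] at hkk
      have := congrArg Fin.val (Sum.inl_injective hkk)
      simp only [k] at this
      omega
    have h4 : (l : ℕ) ≠ j := by
      intro e
      rw [Fin.ext e, hpj] at hkk
      have := congrArg Fin.val (Sum.inl_injective hkk)
      simp only [k] at this
      omega
    have h5 : (l : ℕ) ≠ k := fun e => hkne (congrArg Sum.inl (Fin.ext e))
    have h6 : (k : ℕ) = i + 1 := rfl
    exact ih (l - k) (by omega) (i := k) (j := l) (Fin.lt_def.2 (by omega)) hk rfl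
  · exact (hpl (Sum.inl j) (Sum.inl k) (Sum.inl i) (Sum.inr l)
      (by simp only [pos, Sum.elim_inl, k]; omega)
      (by simp only [pos, Sum.elim_inl, k]; omega)
      (by simp only [pos, Sum.elim_inl, Sum.elim_inr]; omega) (D.rel.symm' h) hk).elim

theorem le_of_strictMono {m n : ℕ} {f : Fin m → Fin n} (hf : StrictMono f) (i : Fin m) :
    (i : ℕ) ≤ f i := by
  obtain ⟨k, hk⟩ := i
  induction k with
  | zero => exact Nat.zero_le _
  | succ k ih =>
    have h1 := ih (by omega)
    have h2 : f ⟨k, by omega⟩ < f ⟨k + 1, hk⟩ := hf (Fin.lt_def.2 (Nat.lt_succ_self k))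
    have h3 := Fin.lt_def.1 h2
    simp only at h1 ⊢
    omega

/-- By planarity, straight strings preserve the order of their ends. -/
theorem through_strictMono (D : Diagram w w') {f : Fin w.length → Fin w'.length}
    (hf : ∀ i, D.rel (Sum.inl i) (Sum.inr (f i))) : StrictMono f := by
  intro i j hij
  by_contra hcon
  have hij' : (i : ℕ) < j := hij
  rcases lt_or_eq_of_le (not_lt.1 hcon) with h | h
  · have h' : (f j : ℕ) < f i := h
    exact D.isDiagram.planar (Sum.inl j) (Sum.inl i) (Sum.inr (f j)) (Sum.inr (f i))
      (by simp only [pos, Sum.elim_inl]; omega)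
      (by simp only [pos, Sum.elim_inl, Sum.elim_inr]; omega)
      (by simp only [pos, Sum.elim_inr]; omega) (hf j) (hf i)
  · have h1 := D.partner_eq (D.rel.symm' (hf i)) (by simp)
    have h2 := D.partner_eq (D.rel.symm' (hf j)) (by simp)
    rw [← h, h2] at h1
    have := Sum.inl_injective h1
    omega

/-- A diagram without arcs between points of the same side consists of straight strings. -/
theorem eq_id_of_through (D : Diagram w w')
    (h : ∀ i j : Fin w.length, i < j → ¬ D.rel (Sum.inl i) (Sum.inl j))
    (h' : ∀ i j : Fin w'.length, i < j → ¬ D.rel (Sum.inr i) (Sum.inr j)) :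
    ∃ e : w = w', e ▸ D = id w' := by
  have hf : ∀ i, ∃ j, D.rel (Sum.inl i) (Sum.inr j) := by
    intro i
    have h1 := D.rel_partner (Sum.inl i)
    have h2 := D.partner_ne (Sum.inl i)
    generalize D.partner (Sum.inl i) = y at h1 h2
    rcases y with y | y
    · rcases lt_trichotomy i y with hl | rfl | hl
      · exact absurd h1 (h _ _ hl)
      · exact absurd rfl h2
      · exact absurd (D.rel.symm' h1) (h _ _ hl)
    · exact ⟨y, h1⟩
  have hg : ∀ i, ∃ j, D.rel (Sum.inr i) (Sum.inl j) := by
    intro i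
    have h1 := D.rel_partner (Sum.inr i)
    have h2 := D.partner_ne (Sum.inr i)
    generalize D.partner (Sum.inr i) = y at h1 h2
    rcases y with y | y
    · exact ⟨y, h1⟩
    · rcases lt_trichotomy i y with hl | rfl | hl
      · exact absurd h1 (h' _ _ hl)
      · exact absurd rfl h2
      · exact absurd (D.rel.symm' h1) (h' _ _ hl)
  -- `f` and `g` are mutually inverse and increasing, hence preserve positions
  choose f hf using hf
  choose g hg using hg
  have hfm := D.through_strictMono hf
  have hgm : StrictMono g := D.reflect.through_strictMono hg
  have hgf : ∀ i, g (f i) = i := by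
    intro i
    have h1 := D.partner_eq (hg (f i)) (by simp)
    have h2 := D.partner_eq (D.rel.symm' (hf i)) (by simp)
    exact Sum.inl_injective (h1.symm.trans h2)
  have hval : ∀ i, (f i : ℕ) = i := by
    intro i
    have h1 := le_of_strictMono hfm i
    have h2 := le_of_strictMono hgm (f i)
    rw [hgf] at h2
    omega
  have hlen : w.length = w'.length := by
    have h1 := Fintype.card_le_of_injective f hfm.injective
    have h2 := Fintype.card_le_of_injective g hgm.injective
    simp only [Fintype.card_fin] at h1 h2
    omega
  have hw : w = w' := by
    refine List.ext_get hlen fun n h1 h2 => ?_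
    have ho := D.isDiagram.oriented _ _ (hf ⟨n, h1⟩) (by simp)
    rw [isStart_inl, isStart_inr, show f ⟨n, h1⟩ = ⟨n, h2⟩ from Fin.ext (hval _)] at ho
    revert ho
    cases w.get ⟨n, h1⟩ <;> cases w'.get ⟨n, h2⟩ <;> simp
  subst hw
  refine ⟨rfl, ?_⟩
  have hfi : ∀ i, f i = i := fun i => Fin.ext (hval i)
  symm
  apply eq_of_le
  rintro (x | x) (y | y) hxy <;> obtain rfl : x = y := hxy
  · exact D.rel.refl' _
  · have := hf x
    rwa [hfi] at this
  · have := D.rel.symm' (hf x)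
    rwa [hfi] at this
  · exact D.rel.refl' _

/-- Adjacent points joined by an arc are the ends of a cap. -/
theorem exists_cap_of_adjacent (D : Diagram w w') {P Q : Fin w.length} (hPQ : (Q : ℕ) = P + 1)
    (h : D.rel (Sum.inl P) (Sum.inl Q)) :
    ∃ (u : Word) (b : Bool) (v : Word) (e : w = u ++ ([b, !b] ++ v)),
      P = Fin.cast (by rw [e]) (capLeft u b v) ∧
      Q = Fin.cast (by rw [e]) (capRight u b v) := by
  have ho := D.isDiagram.oriented _ _ h (fun e => by have := Sum.inl_injective e; omega)
  rw [isStart_inl, isStart_inl] at ho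
  have hQ : w.get Q = !w.get P := by
    revert ho
    cases w.get P <;> cases w.get Q <;> simp
  have hP2 := P.2
  have hQ2 := Q.2
  have e : w = w.take P ++ ([w.get P, !w.get P] ++ w.drop (P + 2)) := by
    rw [← hQ]
    conv_lhs => rw [← List.take_append_drop P w]
    congr 1
    rw [List.drop_eq_getElem_cons hP2, List.drop_eq_getElem_cons (by omega)]
    simp [hPQ]
  refine ⟨w.take P, w.get P, w.drop (P + 2), e, ?_, ?_⟩
  · apply Fin.ext
    simp [rightFin, leftFin, capLeft]
  · apply Fin.ext
    simp [rightFin, leftFin, capRight]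
    omega

theorem exists_eq_cap_comp (D : Diagram w w') {i j : Fin w.length} (hij : i < j)
    (h : D.rel (Sum.inl i) (Sum.inl j)) :
    ∃ (u : Word) (b : Bool) (v : Word) (e : w = u ++ ([b, !b] ++ v)) (D' : Diagram (u ++ v) w'),
      e ▸ D = (cap u b v).comp D' := by
  obtain ⟨P, Q, hPQ, hD⟩ := D.exists_adjacent hij h
  obtain ⟨u, b, v, e, hP, hQ⟩ := D.exists_cap_of_adjacent hPQ hD
  subst e
  refine ⟨u, b, v, rfl, (cap u b v).reflect.comp D, ?_⟩
  symm
  refine (cap_isCap u b v).comp_reflect_comp D ?_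
  rw [hP, hQ] at hD
  exact hD

/-- Diagrams are generated by straight strings, by caps put on top and by reflected caps put at the
bottom. -/
theorem generation {C : ∀ w w' : Word, Diagram w w' → Prop} (hid : ∀ w, C w w (id w))
    (hcap : ∀ u b v w' (D : Diagram (u ++ v) w'), C _ _ D → C _ _ ((cap u b v).comp D))
    (hcup : ∀ u b v w (D : Diagram w (u ++ v)), C _ _ D → C _ _ (D.comp (cap u b v).reflect))
    (w w' : Word) (D : Diagram w w') : C w w' D := by
  obtain ⟨n, hn⟩ : ∃ n, n = w.length + w'.length := ⟨_, rfl⟩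
  induction n using Nat.strong_induction_on generalizing w w' with
  | _ n ih =>
  by_cases h : ∃ i j : Fin w.length, i < j ∧ D.rel (Sum.inl i) (Sum.inl j)
  · obtain ⟨i, j, hij, h⟩ := h
    obtain ⟨u, b, v, rfl, D', hD⟩ := D.exists_eq_cap_comp hij h
    change D = _ at hD
    rw [hD]
    refine hcap _ _ _ _ _ (ih _ ?_ _ _ D' rfl)
    simp only [List.length_append, List.length_cons, List.length_nil] at hn ⊢
    omega
  by_cases h' : ∃ i j : Fin w'.length, i < j ∧ D.rel (Sum.inr i) (Sum.inr j)
  · obtain ⟨i, j, hij, h'⟩ := h'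
    obtain ⟨u, b, v, rfl, D', hD⟩ := D.reflect.exists_eq_cap_comp hij h'
    change D.reflect = _ at hD
    have hD := congrArg reflect hD
    rw [reflect_reflect, reflect_comp] at hD
    rw [hD]
    refine hcup _ _ _ _ _ (ih _ ?_ _ _ D'.reflect rfl)
    simp only [List.length_append, List.length_cons, List.length_nil] at hn ⊢
    omega
  push Not at h h'
  obtain ⟨rfl, hD⟩ := D.eq_id_of_through h h'
  change D = _ at hD
  rw [hD]
  exact hid w

end Diagram

end OrientedKauffman

namespace OrientedKauffman

/-! ### Products over boundary points -/

section Products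

variable {w₀ w₁ w₂ u₀ u₁ : Word}

theorem IsCap.prod_fin {K : Diagram w₁ w₂} {ι : Fin w₂.length → Fin w₁.length}
    {P Q : Fin w₁.length} (hK : IsCap K ι P Q) (f : Fin w₁.length → ℂ) :
    ∏ i, f i = f P * (f Q * ∏ j, f (ι j)) := by
  classical
  have h : (Finset.univ : Finset (Fin w₁.length)) =
      insert P (insert Q (Finset.univ.image ι)) := by
    ext i
    simp only [Finset.mem_univ, Finset.mem_insert, Finset.mem_image, true_and, true_iff]
    exact hK.cases i
  rw [h, Finset.prod_insert, Finset.prod_insert, Finset.prod_image]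
  · exact fun _ _ _ _ h => hK.strictMono.injective h
  · simp [hK.ne_right]
  · simp [hK.ne_left, hK.ne]

theorem IsCap.prod_points {K : Diagram w₁ w₂} {ι : Fin w₂.length → Fin w₁.length}
    {P Q : Fin w₁.length} (hK : IsCap K ι P Q) (f : Points w₀ w₁ → ℂ) :
    ∏ x, f x = f (Sum.inr P) * (f (Sum.inr Q) * ∏ x : Points w₀ w₂, f (IsCap.lift ι x)) := by
  rw [Fintype.prod_sum_type, Fintype.prod_sum_type, hK.prod_fin]
  simp only [IsCap.lift, Sum.map_inl, Sum.map_inr, id]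
  ring

theorem prod_fin_append (w u : Word) (f : Fin (w ++ u).length → ℂ) :
    ∏ i, f i = (∏ i, f (leftFin w u i)) * ∏ i, f (rightFin w u i) := by
  refine Eq.trans (Eq.symm ?_) (Fintype.prod_sum_type
    (Sum.elim (fun i => f (leftFin w u i)) (fun i => f (rightFin w u i))))
  refine Fintype.prod_bijective (Sum.elim (leftFin w u) (rightFin w u)) ⟨?_, ?_⟩ _ _ ?_
  · rintro (i | i) (j | j) h <;> simp only [Sum.elim_inl, Sum.elim_inr] at h
    · rw [leftFin_injective _ _ h]
    · exact absurd h (leftFin_ne _ _ _ _)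
    · exact absurd h.symm (leftFin_ne _ _ _ _)
    · rw [rightFin_injective _ _ h]
  · intro i
    rcases fin_cases _ _ i with ⟨j, rfl⟩ | ⟨j, rfl⟩
    · exact ⟨Sum.inl j, rfl⟩
    · exact ⟨Sum.inr j, rfl⟩
  · rintro (i | i) <;> rfl

theorem prod_points_append (f : Points (w₀ ++ u₀) (w₁ ++ u₁) → ℂ) :
    ∏ x, f x = (∏ x : Points w₀ w₁, f (leftPt x)) * ∏ x : Points u₀ u₁, f (rightPt x) := by
  simp only [Fintype.prod_sum_type, prod_fin_append]
  simp only [leftPt, rightPt, Sum.map_inl, Sum.map_inr]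
  ring

end Products

/-! ### Matrix coefficients of diagrams -/

/-- Weights of the four kinds of turning arcs as functions of a label: arcs joining upper points
(`cap`) or lower points (`cup`), whose left point is the start or the end of the string. -/
structure Weights (κ : Type) where
  capStart : κ → ℂ
  capEnd : κ → ℂ
  cupStart : κ → ℂ
  cupEnd : κ → ℂ

namespace Weights

variable {κ : Type} {w₀ w₁ w₂ : Word}

/-- The weight of a string with the given start and end; strings between the upper and the lower
side have weight one. -/
def wt (W : Weights κ) : Points w₀ w₁ → Points w₀ w₁ → κ → ℂ
  | Sum.inl a, Sum.inl b => if a < b then W.capStart else W.capEnd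
  | Sum.inr a, Sum.inr b => if a < b then W.cupStart else W.cupEnd
  | _, _ => fun _ => 1

/-- The weights of the reflected arcs. -/
def reflect (W : Weights κ) : Weights κ where
  capStart := W.cupEnd
  capEnd := W.cupStart
  cupStart := W.capEnd
  cupEnd := W.capStart

theorem wt_swap (W : Weights κ) {x y : Points w₀ w₁} (h : x ≠ y) :
    W.wt y.swap x.swap = W.reflect.wt x y := by
  rcases x with x | x <;> rcases y with y | y
  · have : x ≠ y := fun e => h (congrArg _ e)
    rcases lt_or_gt_of_ne this with h | h <;> simp [wt, reflect, h, h.not_gt]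
  · rfl
  · rfl
  · have : x ≠ y := fun e => h (congrArg _ e)
    rcases lt_or_gt_of_ne this with h | h <;> simp [wt, reflect, h, h.not_gt]

theorem wt_lift (W : Weights κ) {ι : Fin w₂.length → Fin w₁.length} (hι : StrictMono ι)
    (x y : Points w₀ w₂) :
    W.wt (IsCap.lift ι x : Points w₀ w₁) (IsCap.lift ι y) = W.wt x y := by
  rcases x with x | x <;> rcases y with y | y <;> simp [wt, IsCap.lift, hι.lt_iff_lt]

theorem wt_leftPt (W : Weights κ) {u₀ u₁ : Word} (x y : Points w₀ w₁) :
    W.wt (leftPt x : Points (w₀ ++ u₀) (w₁ ++ u₁)) (leftPt y) = W.wt x y := by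
  rcases x with x | x <;> rcases y with y | y <;> simp [wt, leftPt, leftFin]

theorem wt_rightPt (W : Weights κ) {u₀ u₁ : Word} (x y : Points u₀ u₁) :
    W.wt (rightPt x : Points (w₀ ++ u₀) (w₁ ++ u₁)) (rightPt y) = W.wt x y := by
  rcases x with x | x <;> rcases y with y | y <;> simp [wt, rightPt, rightFin]

end Weights

namespace Diagram

variable {κ : Type} {w₀ w₁ w₂ u₀ u₁ : Word}

/-- The contribution of the string that starts at `x`. -/
noncomputable def factor (D : Diagram w₀ w₁) (W : Weights κ) (a : Points w₀ w₁ → κ)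
    (x : Points w₀ w₁) : ℂ :=
  if isStart x = true then W.wt x (D.partner x) (a x) else 1

open Classical in
/-- The coefficient of a diagram at a labelling of the boundary points: it vanishes unless both ends
of every string have the same label, and is then the product of the weights of the strings. -/
noncomputable def coeff (D : Diagram w₀ w₁) (W : Weights κ) (a : Points w₀ w₁ → κ) : ℂ :=
  if ∀ x, a (D.partner x) = a x then ∏ x, D.factor W a x else 0

theorem partner_reflect (D : Diagram w₀ w₁) (x : Points w₁ w₀) :
    D.reflect.partner x = (D.partner x.swap).swap := by
  refine D.reflect.partner_eq ?_ ?_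
  · change D.rel _ _
    rw [Sum.swap_swap]
    exact D.rel_partner _
  · intro h
    apply D.partner_ne x.swap
    have := congrArg Sum.swap h
    rwa [Sum.swap_swap] at this

theorem isStart_swap (x : Points w₀ w₁) :
    isStart (x.swap : Points w₁ w₀) = !isStart x := by
  rcases x with x | x <;> simp [isStart]

theorem coeff_reflect (D : Diagram w₀ w₁) (W : Weights κ) (a : Points w₁ w₀ → κ) :
    D.reflect.coeff W a = D.coeff W.reflect (fun x => a x.swap) := by
  unfold coeff
  have hiff : (∀ x, a (D.reflect.partner x) = a x) ↔
      ∀ x, a (D.partner x).swap = a x.swap := by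
    constructor
    · intro h x
      rw [← h x.swap, partner_reflect, Sum.swap_swap]
    · intro h x
      rw [partner_reflect, h, Sum.swap_swap]
  by_cases h : ∀ x, a (D.partner x).swap = a x.swap
  · rw [if_pos (hiff.2 h), if_pos h]
    symm
    refine Fintype.prod_bijective (fun x => (D.partner x).swap) ⟨?_, ?_⟩ _ _ ?_
    · intro x y hxy
      have := congrArg D.partner (Sum.swap_leftInverse.injective hxy)
      rwa [partner_partner, partner_partner] at this
    · intro x
      exact ⟨D.partner x.swap, by simp [partner_partner]⟩
    · intro x
      unfold factor
      rw [isStart_swap, isStart_partner, Bool.not_not, partner_reflect, Sum.swap_swap,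
        partner_partner, h, W.wt_swap (D.partner_ne x).symm]
  · rw [if_neg (fun h' => h (hiff.1 h')), if_neg h]

theorem partner_tensor_left (D : Diagram w₀ w₁) (E : Diagram u₀ u₁) (x : Points w₀ w₁) :
    (D.tensor E).partner (leftPt x) = leftPt (D.partner x) :=
  (D.tensor E).partner_eq (tensorRel_left.2 (D.rel_partner x))
    (fun h => D.partner_ne x (leftPt_injective h))

theorem partner_tensor_right (D : Diagram w₀ w₁) (E : Diagram u₀ u₁) (x : Points u₀ u₁) :
    (D.tensor E).partner (rightPt x) = rightPt (E.partner x) :=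
  (D.tensor E).partner_eq (tensorRel_right.2 (E.rel_partner x))
    (fun h => E.partner_ne x (rightPt_injective h))

theorem coeff_tensor (D : Diagram w₀ w₁) (E : Diagram u₀ u₁) (W : Weights κ)
    (a : Points (w₀ ++ u₀) (w₁ ++ u₁) → κ) :
    (D.tensor E).coeff W a =
      D.coeff W (fun x => a (leftPt x)) * E.coeff W (fun x => a (rightPt x)) := by
  unfold coeff
  have hiff : (∀ x, a ((D.tensor E).partner x) = a x) ↔
      (∀ x, a (leftPt (D.partner x)) = a (leftPt x)) ∧
        ∀ x, a (rightPt (E.partner x)) = a (rightPt x) := by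
    constructor
    · intro h
      refine ⟨fun x => ?_, fun x => ?_⟩
      · rw [← partner_tensor_left D E, h]
      · rw [← partner_tensor_right D E, h]
    · rintro ⟨h, h'⟩ x
      rcases pt_cases x with ⟨y, rfl⟩ | ⟨y, rfl⟩
      · rw [partner_tensor_left, h]
      · rw [partner_tensor_right, h']
  by_cases h : ∀ x, a (leftPt (D.partner x)) = a (leftPt x)
  · by_cases h' : ∀ x, a (rightPt (E.partner x)) = a (rightPt x)
    · rw [if_pos (hiff.2 ⟨h, h'⟩), if_pos h, if_pos h', prod_points_append]
      congr 1 <;> refine Finset.prod_congr rfl fun x _ => ?_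
      · unfold factor
        rw [isStart_leftPt, partner_tensor_left, W.wt_leftPt]
      · unfold factor
        rw [isStart_rightPt, partner_tensor_right, W.wt_rightPt]
    · rw [if_neg (fun e => h' (hiff.1 e).2), if_neg h', mul_zero]
  · rw [if_neg (fun e => h (hiff.1 e).1), if_neg h, zero_mul]

theorem partner_id_inl (w : Word) (i : Fin w.length) :
    (id w).partner (Sum.inl i) = Sum.inr i :=
  (id w).partner_eq (show idRel _ _ from rfl) (by simp)

theorem partner_id_inr (w : Word) (i : Fin w.length) :
    (id w).partner (Sum.inr i) = Sum.inl i :=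
  (id w).partner_eq (show idRel _ _ from rfl) (by simp)

open Classical in
theorem coeff_id (w : Word) (W : Weights κ) (a b : Fin w.length → κ) :
    (id w).coeff W (Sum.elim a b) = if a = b then 1 else 0 := by
  unfold coeff
  have hiff : (∀ x, (Sum.elim a b) ((id w).partner x) = Sum.elim a b x) ↔ a = b := by
    constructor
    · intro h
      funext i
      have := h (Sum.inr i)
      rwa [partner_id_inr] at this
    · rintro rfl (x | x)
      · rw [partner_id_inl]; rfl
      · rw [partner_id_inr]; rfl
  by_cases h : a = b
  · rw [if_pos (hiff.2 h), if_pos h]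
    refine Finset.prod_eq_one fun x _ => ?_
    unfold factor
    rcases x with x | x
    · rw [partner_id_inl]; simp [Weights.wt]
    · rw [partner_id_inr]; simp [Weights.wt]
  · rw [if_neg (fun e => h (hiff.1 e)), if_neg h]

end Diagram

namespace IsCap

variable {κ : Type} {w₀ w₁ w₂ : Word} {K : Diagram w₁ w₂} {ι : Fin w₂.length → Fin w₁.length}
  {P Q : Fin w₁.length}

theorem partner_cup_lift (hK : IsCap K ι P Q) (D : Diagram w₀ w₂) (x : Points w₀ w₂) :
    (D.comp K.reflect).partner (lift ι x) = lift ι (D.partner x) :=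
  Diagram.partner_eq _ (hK.comp_reflect_rel D (D.rel_partner x))
    (fun h => D.partner_ne x (hK.lift_injective h))

theorem partner_cup_left (hK : IsCap K ι P Q) (D : Diagram w₀ w₂) :
    (D.comp K.reflect).partner (Sum.inr P) = Sum.inr Q :=
  Diagram.partner_eq _ (hK.comp_reflect_arc D) (fun h => hK.ne (Sum.inr_injective h).symm)

theorem partner_cup_right (hK : IsCap K ι P Q) (D : Diagram w₀ w₂) :
    (D.comp K.reflect).partner (Sum.inr Q) = Sum.inr P := by
  rw [← hK.partner_cup_left D, Diagram.partner_partner]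

open Classical in
/-- Adding a reflected cap at the bottom multiplies a coefficient by the weight of the new arc. -/
theorem coeff_comp_reflect (hK : IsCap K ι P Q) (D : Diagram w₀ w₂) (W : Weights κ)
    (a : Points w₀ w₁ → κ) :
    (D.comp K.reflect).coeff W a =
      (if a (Sum.inr P) = a (Sum.inr Q) then
        (if w₁.get P = true then W.cupEnd else W.cupStart) (a (Sum.inr P)) else 0) *
      D.coeff W (fun x => a (lift ι x)) := by
  unfold Diagram.coeff
  have hiff : (∀ x, a ((D.comp K.reflect).partner x) = a x) ↔
      a (Sum.inr P) = a (Sum.inr Q) ∧ ∀ x, a (lift ι (D.partner x)) = a (lift ι x) := by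
    constructor
    · intro h
      refine ⟨?_, fun x => ?_⟩
      · rw [← h (Sum.inr Q), hK.partner_cup_right]
      · rw [← hK.partner_cup_lift, h]
    · rintro ⟨h, h'⟩ x
      rcases hK.point_cases x with rfl | rfl | ⟨y, rfl⟩
      · rw [hK.partner_cup_left, h]
      · rw [hK.partner_cup_right, h]
      · rw [hK.partner_cup_lift, h']
  by_cases h : a (Sum.inr P) = a (Sum.inr Q)
  · by_cases h' : ∀ x, a (lift ι (D.partner x)) = a (lift ι x)
    · rw [if_pos (hiff.2 ⟨h, h'⟩), if_pos h, if_pos h', hK.prod_points, ← mul_assoc]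
      congr 1
      · have hlt : P < Q := Fin.lt_def.2 (by rw [hK.next]; omega)
        have hQ := hK.get_right
        unfold Diagram.factor
        rw [hK.partner_cup_left, hK.partner_cup_right, Diagram.isStart_inr, Diagram.isStart_inr,
          hQ, h]
        cases w₁.get P <;> simp [Weights.wt, hlt, hlt.not_gt]
      · refine Finset.prod_congr rfl fun x _ => ?_
        unfold Diagram.factor
        rw [hK.isStart_lift, hK.partner_cup_lift, W.wt_lift hK.strictMono]
    · rw [if_neg (fun e => h' (hiff.1 e).2), if_neg h', mul_zero]
  · rw [if_neg (fun e => h (hiff.1 e).1), if_neg h, zero_mul]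

open Classical in
theorem coeff_reflect (hK : IsCap K ι P Q) (W : Weights κ) (e : Fin w₂.length → κ)
    (c : Fin w₁.length → κ) :
    K.reflect.coeff W (Sum.elim e c) =
      (if c P = c Q then (if w₁.get P = true then W.cupEnd else W.cupStart) (c P) else 0) *
      if e = c ∘ ι then 1 else 0 := by
  have h := hK.coeff_comp_reflect (Diagram.id w₂) W (Sum.elim e c)
  rw [Diagram.id_comp] at h
  rw [h]
  congr 1
  rw [← Diagram.coeff_id]
  congr 1
  funext x
  rcases x with x | x <;> rfl

open Classical in
theorem coeff_cap (hK : IsCap K ι P Q) (W : Weights κ) (e : Fin w₂.length → κ)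
    (c : Fin w₁.length → κ) :
    K.coeff W (Sum.elim c e) =
      (if c P = c Q then (if w₁.get P = true then W.capStart else W.capEnd) (c P) else 0) *
      if e = c ∘ ι then 1 else 0 := by
  have h := hK.coeff_reflect W.reflect e c
  rw [Diagram.coeff_reflect] at h
  have h1 : (fun x : Points w₁ w₂ => (Sum.elim e c : Points w₂ w₁ → κ) x.swap) = Sum.elim c e := by
    funext x
    rcases x with x | x <;> rfl
  rw [h1] at h
  exact h

end IsCap

end OrientedKauffman

namespace OrientedKauffman

/-! ### Functoriality of the coefficients -/

/-- The relations between the weights that correspond to the isotopies of strings and to the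
removal of the two kinds of loops. -/
structure Weights.IsDual {κ : Type} [Fintype κ] (W : Weights κ) (d : ℂ) : Prop where
  start_mul : ∀ i, W.capStart i * W.cupStart i = 1
  end_mul : ∀ i, W.capEnd i * W.cupEnd i = 1
  sum_start : ∑ i, W.capStart i * W.cupEnd i = d
  sum_end : ∑ i, W.capEnd i * W.cupStart i = d

/-- Straightening: the weights of two strings that are joined by a cap multiply to the weight of
the joined string. By planarity the relative position of the two other ends is determined by their
position relative to the cap. -/
theorem Diagram.wt_join {κ : Type} [Fintype κ] {w₀ w₁ : Word} {W : Weights κ} {d : ℂ}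
    (hW : W.IsDual d) (D : Diagram w₀ w₁) {P Q : Fin w₁.length} (hPQ : (Q : ℕ) = P + 1)
    {x y : Points w₀ w₁} (hx : D.rel x (Sum.inr P)) (hy : D.rel (Sum.inr Q) y)
    (hxP : x ≠ Sum.inr P) (hxQ : x ≠ Sum.inr Q) (hyP : y ≠ Sum.inr P) (hyQ : y ≠ Sum.inr Q)
    (hxy : x ≠ y) (i : κ) :
    W.capStart i * (W.wt (Sum.inr Q) y i * W.wt x (Sum.inr P) i) = W.wt x y i ∧
      W.capEnd i * (W.wt (Sum.inr P) x i * W.wt y (Sum.inr Q) i) = W.wt y x i := by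
  have pl := D.isDiagram.planar
  have hs := hW.start_mul i
  have he := hW.end_mul i
  have hx' := D.rel.symm' hx
  have hy' := D.rel.symm' hy
  rcases x with s | s <;> rcases y with t | t
  · have hne : (s : ℕ) ≠ t := fun e => hxy (congrArg _ (Fin.ext e))
    have hst : ¬ (t : ℕ) < s := fun h => pl (Sum.inl s) (Sum.inl t) (Sum.inr P) (Sum.inr Q)
      (by simp only [pos, Sum.elim_inl]; omega)
      (by simp only [pos, Sum.elim_inl, Sum.elim_inr]; omega)
      (by simp only [pos, Sum.elim_inr]; omega) hx hy'
    have h1 : s < t := Fin.lt_def.2 (by omega)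
    simp [Weights.wt, h1, h1.not_gt]
  · have hP : (t : ℕ) ≠ P := fun e => hyP (congrArg _ (Fin.ext e))
    have hQ : (t : ℕ) ≠ Q := fun e => hyQ (congrArg _ (Fin.ext e))
    have h1 : ¬ (t : ℕ) < P := fun h => pl (Sum.inl s) (Sum.inr t) (Sum.inr P) (Sum.inr Q)
      (by simp only [pos, Sum.elim_inl, Sum.elim_inr]; omega)
      (by simp only [pos, Sum.elim_inr]; omega)
      (by simp only [pos, Sum.elim_inr]; omega) hx hy'
    have h2 : Q < t := Fin.lt_def.2 (by omega)
    simp [Weights.wt, h2, h2.not_gt, hs, he]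
  · have hP : (s : ℕ) ≠ P := fun e => hxP (congrArg _ (Fin.ext e))
    have hQ : (s : ℕ) ≠ Q := fun e => hxQ (congrArg _ (Fin.ext e))
    have h1 : ¬ (Q : ℕ) < s := fun h => pl (Sum.inl t) (Sum.inr P) (Sum.inr Q) (Sum.inr s)
      (by simp only [pos, Sum.elim_inl, Sum.elim_inr]; omega)
      (by simp only [pos, Sum.elim_inr]; omega)
      (by simp only [pos, Sum.elim_inr]; omega) hy' hx'
    have h2 : s < P := Fin.lt_def.2 (by omega)
    simp [Weights.wt, h2, h2.not_gt, hs, he]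
  · have hne : (s : ℕ) ≠ t := fun e => hxy (congrArg _ (Fin.ext e))
    have hsP : (s : ℕ) ≠ P := fun e => hxP (congrArg _ (Fin.ext e))
    have hsQ : (s : ℕ) ≠ Q := fun e => hxQ (congrArg _ (Fin.ext e))
    have htP : (t : ℕ) ≠ P := fun e => hyP (congrArg _ (Fin.ext e))
    have htQ : (t : ℕ) ≠ Q := fun e => hyQ (congrArg _ (Fin.ext e))
    have c1 : ¬ ((s : ℕ) < t ∧ (t : ℕ) < P) := fun h =>
      pl (Sum.inr s) (Sum.inr t) (Sum.inr P) (Sum.inr Q)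
      (by simp only [pos, Sum.elim_inr]; omega) (by simp only [pos, Sum.elim_inr]; omega)
      (by simp only [pos, Sum.elim_inr]; omega) hx hy'
    have c2 : ¬ ((Q : ℕ) < s ∧ (t : ℕ) < P) := fun h =>
      pl (Sum.inr t) (Sum.inr P) (Sum.inr Q) (Sum.inr s)
      (by simp only [pos, Sum.elim_inr]; omega) (by simp only [pos, Sum.elim_inr]; omega)
      (by simp only [pos, Sum.elim_inr]; omega) hy' hx'
    have c3 : ¬ ((Q : ℕ) < s ∧ (s : ℕ) < t) := fun h =>
      pl (Sum.inr P) (Sum.inr Q) (Sum.inr s) (Sum.inr t)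
      (by simp only [pos, Sum.elim_inr]; omega) (by simp only [pos, Sum.elim_inr]; omega)
      (by simp only [pos, Sum.elim_inr]; omega) hx' hy
    rcases (by omega : (s : ℕ) < P ∧ (t : ℕ) < s ∨ (s : ℕ) < P ∧ (Q : ℕ) < t ∨
      (t : ℕ) < s ∧ (Q : ℕ) < t) with ⟨h1, h2⟩ | ⟨h1, h2⟩ | ⟨h1, h2⟩
    · have e1 : s < P := h1
      have e2 : t < s := h2
      have e3 : t < Q := Fin.lt_def.2 (by omega)
      simp only [Weights.wt, if_pos e1, if_pos e2, if_pos e3, if_neg e1.not_gt, if_neg e2.not_gt,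
        if_neg e3.not_gt]
      constructor
      · linear_combination W.cupEnd i * hs
      · linear_combination W.cupStart i * he
    · have e1 : s < P := h1
      have e2 : Q < t := h2
      have e3 : s < t := Fin.lt_def.2 (by omega)
      simp only [Weights.wt, if_pos e1, if_pos e2, if_pos e3, if_neg e1.not_gt, if_neg e2.not_gt,
        if_neg e3.not_gt]
      constructor
      · linear_combination W.cupStart i * hs
      · linear_combination W.cupEnd i * he
    · have e1 : t < s := h1
      have e2 : Q < t := h2
      have e3 : P < s := Fin.lt_def.2 (by omega)
      simp only [Weights.wt, if_pos e1, if_pos e2, if_pos e3, if_neg e1.not_gt, if_neg e2.not_gt,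
        if_neg e3.not_gt]
      constructor
      · linear_combination W.cupEnd i * hs
      · linear_combination W.cupStart i * he

namespace IsCap

variable {κ : Type} {w₀ w₁ w₂ : Word} {K : Diagram w₁ w₂} {ι : Fin w₂.length → Fin w₁.length}
  {P Q : Fin w₁.length}

theorem exists_extend (hK : IsCap K ι P Q) (f : Fin w₂.length → κ) (j : κ) :
    ∃ e : Fin w₁.length → κ, e P = j ∧ e Q = j ∧ e ∘ ι = f := by
  classical
  refine ⟨fun i => if h : ∃ k, ι k = i then f h.choose else j, ?_, ?_, ?_⟩
  · exact dif_neg fun ⟨k, hk⟩ => hK.ne_left k hk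
  · exact dif_neg fun ⟨k, hk⟩ => hK.ne_right k hk
  · funext k
    have h : ∃ k', ι k' = ι k := ⟨k, rfl⟩
    rw [Function.comp, dif_pos h]
    exact congrArg f (hK.strictMono.injective h.choose_spec)

theorem extend_unique (hK : IsCap K ι P Q) {e e' : Fin w₁.length → κ} (hP : e P = e' P)
    (hQ : e Q = e' Q) (h : e ∘ ι = e' ∘ ι) : e = e' := by
  funext i
  rcases hK.cases i with rfl | rfl | ⟨k, rfl⟩
  · exact hP
  · exact hQ
  · exact congrFun h k

variable [Fintype κ]

/-- Joining two strings by a cap. The label `j` is that of the two ends of the cap, and at most one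
label has a nonzero term on the left. -/
theorem sum_coeff_join (hK : IsCap K ι P Q) {W : Weights κ} {d : ℂ} (hW : W.IsDual d)
    (D : Diagram w₀ w₁) (hD : ¬ D.rel (Sum.inr P) (Sum.inr Q)) (c : Points w₀ w₂ → κ)
    (L : κ → Points w₀ w₁ → κ) (hP : ∀ j, L j (Sum.inr P) = j) (hQ : ∀ j, L j (Sum.inr Q) = j)
    (hL : ∀ j x, L j (lift ι x) = c x) :
    ∑ j, (if w₁.get P = true then W.capStart else W.capEnd) j * D.coeff W (L j) =
      (D.comp K).coeff W c := by
  classical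
  have hex : ∀ {A B : Fin w₁.length} (_ : A = P ∧ B = Q ∨ A = Q ∧ B = P),
      ∃ x : Points w₀ w₂, lift ι x = D.partner (Sum.inr A) := by
    rintro A B hAB
    have h1 := D.rel_partner (Sum.inr A)
    have h2 := D.partner_ne (Sum.inr A)
    rcases hK.point_cases (D.partner (Sum.inr A)) with e | e | e
    · rcases hAB with ⟨rfl, rfl⟩ | ⟨rfl, rfl⟩
      · exact absurd e h2
      · exact absurd (e ▸ D.rel.symm' h1) hD
    · rcases hAB with ⟨rfl, rfl⟩ | ⟨rfl, rfl⟩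
      · exact absurd (e ▸ h1) hD
      · exact absurd e h2
    · exact e
  -- `p` and `q` are the other ends of the two strings that end at `P` and `Q`
  obtain ⟨p, hp⟩ := hex (Or.inl ⟨rfl, rfl⟩)
  obtain ⟨q, hq⟩ := hex (Or.inr ⟨rfl, rfl⟩)
  have hp' : D.partner (lift ι p) = Sum.inr P := by rw [hp, D.partner_partner]
  have hq' : D.partner (lift ι q) = Sum.inr Q := by rw [hq, D.partner_partner]
  have hpq : p ≠ q := by
    rintro rfl
    exact hK.ne (Sum.inr_injective (hp'.symm.trans hq'))
  have hpr : D.rel (lift ι p) (Sum.inr P) := hp' ▸ D.rel_partner _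
  have hqr : D.rel (Sum.inr Q) (lift ι q) := hq ▸ D.rel_partner _
  have hcp : (D.comp K).partner p = q :=
    Diagram.partner_eq _ (hK.comp_rel_of_arc D hpr hqr) hpq.symm
  have hcq : (D.comp K).partner q = p := by rw [← hcp, Diagram.partner_partner]
  have hother : ∀ x, x ≠ p → x ≠ q → lift ι ((D.comp K).partner x) = D.partner (lift ι x) := by
    intro x hxp hxq
    rcases hK.point_cases (D.partner (lift ι x)) with e | e | ⟨y, e⟩
    · exact absurd (hK.lift_injective (by rw [hp, ← e, D.partner_partner])) hxp
    · exact absurd (hK.lift_injective (by rw [hq, ← e, D.partner_partner])) hxq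
    · rw [← e, Diagram.partner_eq (y := y) _ (hK.comp_rel D (e ▸ D.rel_partner _))]
      rintro rfl
      exact D.partner_ne _ e.symm
  have hcons : ∀ j, (∀ x, L j (D.partner x) = L j x) ↔
      c p = j ∧ c q = j ∧ ∀ x, x ≠ p → x ≠ q → c ((D.comp K).partner x) = c x := by
    intro j
    constructor
    · intro h
      refine ⟨?_, ?_, fun x h1 h2 => ?_⟩
      · have := h (lift ι p)
        rw [hp', hP, hL] at this
        exact this.symm
      · have := h (lift ι q)
        rw [hq', hQ, hL] at this
        exact this.symm
      · have := h (lift ι x)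
        rw [← hother x h1 h2, hL, hL] at this
        exact this
    · rintro ⟨h1, h2, h3⟩ x
      rcases hK.point_cases x with rfl | rfl | ⟨y, rfl⟩
      · rw [← hp, hL, hP, h1]
      · rw [← hq, hL, hQ, h2]
      · by_cases e1 : y = p
        · rw [e1, hp', hL, hP, h1]
        by_cases e2 : y = q
        · rw [e2, hq', hL, hQ, h2]
        rw [← hother y e1 e2, hL, hL, h3 y e1 e2]
  have hcons' : (∀ x, c ((D.comp K).partner x) = c x) ↔
      c p = c q ∧ ∀ x, x ≠ p → x ≠ q → c ((D.comp K).partner x) = c x := by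
    constructor
    · intro h
      exact ⟨by rw [← h p, hcp], fun x _ _ => h x⟩
    · rintro ⟨h1, h2⟩ x
      by_cases e1 : x = p
      · rw [e1, hcp, h1]
      by_cases e2 : x = q
      · rw [e2, hcq, h1]
      exact h2 x e1 e2
  -- if the labels of `c` are consistent, then only the label of `p` contributes
  by_cases hc : ∀ x, c ((D.comp K).partner x) = c x
  · have hc' := hcons'.1 hc
    rw [Finset.sum_eq_single (c p)]
    · have hl := (hcons (c p)).2 ⟨rfl, hc'.1.symm, hc'.2⟩
      unfold Diagram.coeff
      rw [if_pos hc, if_pos hl, hK.prod_points]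
      have hsplit : ∀ g : Points w₀ w₂ → ℂ,
          ∏ x, g x = g p * (g q * ∏ x ∈ (Finset.univ.erase p).erase q, g x) := by
        intro g
        rw [Finset.mul_prod_erase _ g (by simp [hpq.symm]), Finset.mul_prod_erase _ g (by simp)]
      rw [hsplit, hsplit ((D.comp K).factor W c)]
      have hrest : ∀ x ∈ (Finset.univ.erase p).erase q,
          D.factor W (L (c p)) (lift ι x) = (D.comp K).factor W c x := by
        intro x hx
        simp only [Finset.mem_erase, Finset.mem_univ, and_true] at hx
        unfold Diagram.factor
        rw [hK.isStart_lift, ← hother x hx.2 hx.1, W.wt_lift hK.strictMono, hL]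
      rw [Finset.prod_congr rfl hrest]
      have hmain : (if w₁.get P = true then W.capStart else W.capEnd) (c p) *
          (D.factor W (L (c p)) (Sum.inr P) * D.factor W (L (c p)) (Sum.inr Q) *
          (D.factor W (L (c p)) (lift ι p) * D.factor W (L (c p)) (lift ι q))) =
          (D.comp K).factor W c p * (D.comp K).factor W c q := by
        have hj := D.wt_join hW hK.next hpr hqr (hK.lift_ne_left p) (hK.lift_ne_right p)
          (hK.lift_ne_left q) (hK.lift_ne_right q) (fun e => hpq (hK.lift_injective e)) (c p)
        rw [W.wt_lift hK.strictMono, W.wt_lift hK.strictMono] at hj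
        have sp : isStart p = w₁.get P := by
          rw [← hK.isStart_lift (w₀ := w₀) p, hp, Diagram.isStart_partner, Diagram.isStart_inr,
            Bool.not_not]
        have sq : isStart q = !w₁.get P := by
          rw [← hK.isStart_lift (w₀ := w₀) q, hq, Diagram.isStart_partner, Diagram.isStart_inr,
            Bool.not_not, hK.get_right]
        unfold Diagram.factor
        rw [hK.isStart_lift, hK.isStart_lift, sp, sq, Diagram.isStart_inr, Diagram.isStart_inr,
          hK.get_right, hcp, hcq, hp', hq', ← hp, ← hq, hL, hL, hP, hQ, ← hc'.1]
        cases w₁.get P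
        · simpa using hj.2
        · simpa using hj.1
      rw [← mul_assoc ((D.comp K).factor W c p), ← hmain]
      ring
    · intro j _ hj
      have : ¬ ∀ x, L j (D.partner x) = L j x := fun h => hj ((hcons j).1 h).1.symm
      rw [Diagram.coeff, if_neg this, mul_zero]
    · exact fun h => absurd (Finset.mem_univ _) h
  · unfold Diagram.coeff
    rw [if_neg hc]
    refine Finset.sum_eq_zero fun j _ => ?_
    have hj : ¬ ∀ x, L j (D.partner x) = L j x := by
      intro h
      have h' := (hcons j).1 h
      exact hc (hcons'.2 ⟨h'.1.trans h'.2.1.symm, h'.2.2⟩)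
    rw [if_neg hj, mul_zero]

/-- Putting a cap below a diagram, in terms of coefficients: the labellings `L j` extend `c` by the
label `j` at both ends of the cap. -/
theorem sum_coeff_cap (hK : IsCap K ι P Q) {W : Weights κ} {d : ℂ} (hW : W.IsDual d)
    (D : Diagram w₀ w₁) (c : Points w₀ w₂ → κ)
    (L : κ → Points w₀ w₁ → κ) (hP : ∀ j, L j (Sum.inr P) = j) (hQ : ∀ j, L j (Sum.inr Q) = j)
    (hL : ∀ j x, L j (lift ι x) = c x) :
    ∑ j, (if w₁.get P = true then W.capStart else W.capEnd) j * D.coeff W (L j) =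
      d ^ D.loops K * (D.comp K).coeff W c := by
  by_cases hD : D.rel (Sum.inr P) (Sum.inr Q)
  · rw [hK.loops_of_rel D hD, pow_one]
    have h : ∀ j, D.coeff W (L j) =
        (if w₁.get P = true then W.cupEnd else W.cupStart) j * (D.comp K).coeff W c := by
      intro j
      conv_lhs => rw [← hK.comp_comp_reflect D hD]
      rw [hK.coeff_comp_reflect, hP, hQ, if_pos rfl]
      congr 2
      funext x
      exact hL j x
    simp only [h, ← mul_assoc, ← Finset.sum_mul]
    congr 1
    cases w₁.get P
    · exact hW.sum_end
    · exact hW.sum_start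
  · rw [hK.loops_of_not_rel D hD, pow_zero, one_mul]
    exact hK.sum_coeff_join hW D hD c L hP hQ hL

end IsCap

namespace Diagram

variable {κ : Type} {w₀ w₁ w₂ : Word}

/-- The matrix of a diagram in the bases of labellings of its lower and upper points. -/
noncomputable def mat (W : Weights κ) (D : Diagram w₀ w₁) :
    Matrix (Fin w₁.length → κ) (Fin w₀.length → κ) ℂ :=
  Matrix.of fun b a => D.coeff W (Sum.elim a b)

theorem mat_reflect (W : Weights κ) (D : Diagram w₀ w₁) :
    mat W D.reflect = (mat W.reflect D).transpose := by
  ext a b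
  simp only [mat, Matrix.of_apply, Matrix.transpose_apply, coeff_reflect]
  congr 1
  funext x
  rcases x with x | x <;> rfl

theorem mat_id [DecidableEq κ] (W : Weights κ) (w : Word) : mat W (id w) = 1 := by
  ext b a
  rw [mat, Matrix.of_apply, coeff_id, Matrix.one_apply]
  by_cases h : b = a
  · rw [if_pos h, if_pos h.symm]
  · rw [if_neg h, if_neg (Ne.symm h)]

variable [Fintype κ]

theorem mat_comp_cup {K : Diagram w₁ w₂} {ι : Fin w₂.length → Fin w₁.length}
    {P Q : Fin w₁.length} (hK : IsCap K ι P Q) (W : Weights κ) (D : Diagram w₀ w₂) :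
    mat W (D.comp K.reflect) = mat W K.reflect * mat W D := by
  classical
  ext b a
  simp only [mat, Matrix.of_apply, Matrix.mul_apply, hK.coeff_reflect, hK.coeff_comp_reflect,
    Sum.elim_inr, mul_assoc, ite_mul, one_mul, zero_mul, mul_ite, mul_zero]
  rw [Finset.sum_ite_eq' Finset.univ (b ∘ ι), if_pos (Finset.mem_univ _)]
  have : (fun x : Points w₀ w₂ => (Sum.elim a b : Points w₀ w₁ → κ) (IsCap.lift ι x)) =
      Sum.elim a (b ∘ ι) := by
    funext x
    rcases x with x | x <;> rfl
  rw [this]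
  by_cases h : b P = b Q
  · rw [if_pos h]
    exact congrArg (· * _) (if_pos h)
  · rw [if_neg h]
    exact (congrArg (· * _) (if_neg h)).trans (zero_mul _)

theorem mat_comp_cap {K : Diagram w₁ w₂} {ι : Fin w₂.length → Fin w₁.length}
    {P Q : Fin w₁.length} (hK : IsCap K ι P Q) {W : Weights κ} {d : ℂ} (hW : W.IsDual d)
    (D : Diagram w₀ w₁) :
    d ^ D.loops K • mat W (D.comp K) = mat W K * mat W D := by
  classical
  ext f a
  choose e he1 he2 he3 using hK.exists_extend f
  rw [Matrix.smul_apply, smul_eq_mul, Matrix.mul_apply]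
  simp only [mat, Matrix.of_apply]
  rw [← hK.sum_coeff_cap hW D (Sum.elim a f) (fun j => Sum.elim a (e j)) he1 he2 ?_]
  · refine Fintype.sum_of_injective e (fun j j' h => by rw [← he1 j, h, he1]) _ _ ?_ ?_
    · intro c hc
      rw [hK.coeff_cap]
      by_cases h1 : c P = c Q
      · by_cases h2 : f = c ∘ ι
        · refine absurd ⟨c P, hK.extend_unique (he1 _) ((he2 _).trans h1) ?_⟩ hc
          rw [he3, h2]
        · rw [if_neg h2, mul_zero, zero_mul]
      · rw [if_neg h1, zero_mul, zero_mul]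
    · intro j
      rw [hK.coeff_cap, he1, he2, if_pos rfl, if_pos (he3 j).symm, mul_one]
  · rintro j (x | x)
    · rfl
    · exact congrFun (he3 j) x

/-- The matrices of diagrams are compatible with composition, up to the factor of the loops. -/
theorem mat_comp {W : Weights κ} {d : ℂ} (hW : W.IsDual d) (D : Diagram w₀ w₁)
    (E : Diagram w₁ w₂) : d ^ D.loops E • mat W (D.comp E) = mat W E * mat W D := by
  classical
  refine generation (C := fun w₁ w₂ E => ∀ (w₀ : Word) (D : Diagram w₀ w₁),
    d ^ D.loops E • mat W (D.comp E) = mat W E * mat W D) ?_ ?_ ?_ w₁ w₂ E w₀ D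
  · intro w w₀ D
    have : D.loops (id w) = 0 := loopCount_idRel_right _
    rw [comp_id, mat_id, this, pow_zero, one_smul, Matrix.one_mul]
  · intro u b v w' E hE w₀ D
    have hK := cap_isCap u b v
    have hl := loops_assoc D (cap u b v) E
    rw [hK.loops_left, zero_add] at hl
    have h1 : mat W ((cap u b v).comp E) = mat W E * mat W (cap u b v) := by
      have h := mat_comp_cup hK W.reflect E.reflect
      rw [← reflect_comp, mat_reflect, mat_reflect, mat_reflect] at h
      have h := congrArg Matrix.transpose h
      rw [Matrix.transpose_mul] at h
      exact h
    rw [← hl, ← comp_assoc, pow_add, mul_smul, hE, h1, Matrix.mul_assoc, ← mat_comp_cap hK hW,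
      Matrix.mul_smul]
  · intro u b v w E hE w₀ D
    have hK := cap_isCap u b v
    have hl := loops_assoc D E (cap u b v).reflect
    rw [hK.loops_reflect, hK.loops_reflect, zero_add, add_zero] at hl
    rw [← hl, ← comp_assoc, mat_comp_cup hK, mat_comp_cup hK, Matrix.mul_assoc, ← hE,
      Matrix.mul_smul]

end Diagram

end OrientedKauffman

namespace OrientedKauffman

/-! ### Coefficients and the *-operation -/

namespace Diagram

variable {κ : Type} {w₀ w₁ : Word}

/-- Every arc joining two upper points has exactly one end of either polarity. -/
theorem upperArcs_eq_card (D : Diagram w₀ w₁) (b : Bool) :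
    D.upperArcs = Nat.card {i : Fin w₀.length //
      isStart (Sum.inl i : Points w₀ w₁) = b ∧ (D.partner (Sum.inl i)).isLeft = true} := by
  have hp : ∀ {i j : Fin w₀.length}, i < j → D.rel (Sum.inl i) (Sum.inl j) →
      D.partner (Sum.inl i) = Sum.inl j ∧ D.partner (Sum.inl j) = Sum.inl i := by
    intro i j hij h
    have h1 : D.partner (Sum.inl i) = Sum.inl j :=
      D.partner_eq h (fun e => hij.ne' (Sum.inl_injective e))
    exact ⟨h1, by rw [← h1, D.partner_partner]⟩
  -- an arc is sent to its end of polarity `b`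
  unfold upperArcs
  refine Nat.card_congr (Equiv.ofBijective (fun p =>
    if h : isStart (Sum.inl p.1.1 : Points w₀ w₁) = b then
      ⟨p.1.1, h, by rw [(hp p.2.1 p.2.2).1]; rfl⟩
    else ⟨p.1.2, by
      have := D.isStart_partner (Sum.inl p.1.1)
      rw [(hp p.2.1 p.2.2).1] at this
      rw [this]
      revert h
      cases isStart (Sum.inl p.1.1 : Points w₀ w₁) <;> cases b <;> simp,
      by rw [(hp p.2.1 p.2.2).2]; rfl⟩) ⟨?_, ?_⟩)
  · rintro ⟨⟨i, j⟩, hij, h⟩ ⟨⟨i', j'⟩, hij', h'⟩ he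
    have h1 := hp hij h
    have h2 := hp hij' h'
    dsimp only at he hij hij'
    have key : i = i' ∧ j = j' := by
      split_ifs at he with c1 c2 c2 <;> have he := congrArg Subtype.val he <;> dsimp only at he
      · subst he
        exact ⟨rfl, Sum.inl_injective (h1.1.symm.trans h2.1)⟩
      · subst he
        obtain rfl := Sum.inl_injective (h1.1.symm.trans h2.2)
        exact absurd hij hij'.not_gt
      · subst he
        obtain rfl := Sum.inl_injective (h1.2.symm.trans h2.1)
        exact absurd hij hij'.not_gt
      · subst he
        exact ⟨Sum.inl_injective (h1.2.symm.trans h2.2), rfl⟩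
    obtain ⟨rfl, rfl⟩ := key
    rfl
  · rintro ⟨i, hi, hl⟩
    have hr := D.rel_partner (Sum.inl i)
    have hne := D.partner_ne (Sum.inl i)
    have hs := D.isStart_partner (Sum.inl i)
    obtain ⟨y, hy⟩ : ∃ y, D.partner (Sum.inl i) = y := ⟨_, rfl⟩
    have hl' := hl
    rw [hy] at hl' hr hne hs
    rcases y with j | j
    · rcases lt_trichotomy i j with hij | rfl | hij
      · refine ⟨⟨(i, j), hij, hr⟩, ?_⟩
        dsimp only
        rw [dif_pos hi]
      · exact absurd rfl hne
      · refine ⟨⟨(j, i), hij, D.rel.symm' hr⟩, ?_⟩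
        dsimp only
        rw [dif_neg]
        rw [hs, hi]
        cases b <;> simp
    · simp at hl'

theorem prod_upper (D : Diagram w₀ w₁) (b : Bool) (s : ℂ) :
    ∏ i : Fin w₀.length, (if isStart (Sum.inl i : Points w₀ w₁) = b ∧
      (D.partner (Sum.inl i)).isLeft = true then s else 1) = s ^ D.upperArcs := by
  rw [Finset.prod_ite, Finset.prod_const, Finset.prod_const_one, mul_one, D.upperArcs_eq_card b,
    Nat.card_eq_fintype_card, Fintype.card_subtype]

theorem prod_lower (D : Diagram w₀ w₁) (b : Bool) (s : ℂ) :
    ∏ i : Fin w₁.length, (if isStart (Sum.inr i : Points w₀ w₁) = b ∧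
      (D.partner (Sum.inr i)).isRight = true then s else 1) = s ^ D.lowerArcs := by
  have h := D.reflect.prod_upper (!b) s
  change _ = s ^ D.lowerArcs at h
  rw [← h]
  refine Finset.prod_congr rfl fun i _ => ?_
  have h1 : isStart (Sum.inl i : Points w₁ w₀) = !isStart (Sum.inr i : Points w₀ w₁) := by
    rw [isStart_inl, isStart_inr, Bool.not_not]
  refine if_congr ?_ rfl rfl
  rw [partner_reflect, h1, Bool.not_inj_iff, Sum.isLeft_swap]
  rfl

/-- If reflecting the arcs conjugates their weights up to a sign `s`, then the coefficients of a
reflected diagram are conjugate up to the sign `s ^ ♯(D)`. -/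
theorem coeff_reflect_weights {W : Weights κ} {s : ℂ} (hs : s * s = 1)
    (h1 : ∀ i, W.cupEnd i = s * starRingEnd ℂ (W.capStart i))
    (h2 : ∀ i, W.cupStart i = s * starRingEnd ℂ (W.capEnd i))
    (h3 : ∀ i, W.capEnd i = s * starRingEnd ℂ (W.cupStart i))
    (h4 : ∀ i, W.capStart i = s * starRingEnd ℂ (W.cupEnd i))
    (D : Diagram w₀ w₁) (a : Points w₀ w₁ → κ) :
    D.coeff W.reflect a = s ^ D.sharp * starRingEnd ℂ (D.coeff W a) := by
  have hs0 : s ≠ 0 := by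
    rintro rfl
    simp at hs
  have hpow : s ^ D.sharp = s ^ D.upperArcs * s ^ D.lowerArcs := by
    have h : s ^ D.lowerArcs * s ^ D.lowerArcs = 1 := by rw [← mul_pow, hs, one_pow]
    -- as `s ^ 2 = 1`, the difference in `♯(D)` may be replaced by the sum
    unfold sharp
    rw [zpow_sub₀ hs0, zpow_natCast, zpow_natCast, div_eq_iff (pow_ne_zero _ hs0), mul_assoc, h,
      mul_one]
  unfold coeff
  split_ifs with h
  · have e := Fintype.prod_sum_type (fun x : Points w₀ w₁ => Sum.elim
      (fun i => if isStart (Sum.inl i : Points w₀ w₁) = true ∧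
        (D.partner (Sum.inl i)).isLeft = true then s else 1)
      (fun i => if isStart (Sum.inr i : Points w₀ w₁) = true ∧
        (D.partner (Sum.inr i)).isRight = true then s else 1) x)
    simp only [Sum.elim_inl, Sum.elim_inr] at e
    rw [hpow, ← D.prod_upper true s, ← D.prod_lower true s, map_prod, ← e,
      ← Finset.prod_mul_distrib]
    refine Finset.prod_congr rfl fun x _ => ?_
    unfold factor
    by_cases hx : isStart x = true
    · rw [if_pos hx, if_pos hx]
      have hne := D.partner_ne x
      rcases x with x | x <;> simp only [Sum.elim_inl, Sum.elim_inr, hx, true_and]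
      all_goals
        generalize D.partner _ = y at hne
        rcases y with y | y
      · have hxy : x ≠ y := fun e => hne (congrArg _ e.symm)
        simp only [Sum.isLeft_inl, if_true]
        rcases lt_or_gt_of_ne hxy with hlt | hlt
        · simp only [Weights.wt, if_pos hlt]
          exact h1 _
        · simp only [Weights.wt, if_neg hlt.not_gt]
          exact h2 _
      · simp [Weights.wt]
      · simp [Weights.wt]
      · have hxy : x ≠ y := fun e => hne (congrArg _ e.symm)
        simp only [Sum.isRight_inr, if_true]
        rcases lt_or_gt_of_ne hxy with hlt | hlt
        · simp only [Weights.wt, if_pos hlt]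
          exact h3 _
        · simp only [Weights.wt, if_neg hlt.not_gt]
          exact h4 _
    · rw [if_neg hx, if_neg hx]
      rcases x with x | x <;> simp [hx]
  · simp

end Diagram

end OrientedKauffman

namespace OrientedKauffman
open CategoryTheory MonoidalCategory TensorProduct

/-! ### The unitary fiber functor given by weights -/

/-- A labelling of a juxtaposition of words is a pair of labellings. -/
def labelEquiv (κ : Type) (w u : Word) :
    ((Fin w.length → κ) × (Fin u.length → κ)) ≃ (Fin (w ++ u).length → κ) :=
  (Equiv.sumArrowEquivProdArrow _ _ _).symm.trans
    (Equiv.arrowCongr (finSumFinEquiv.trans (finCongr List.length_append.symm)) (Equiv.refl κ))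

theorem labelEquiv_symm_apply (κ : Type) (w u : Word) (c : Fin (w ++ u).length → κ) :
    (labelEquiv κ w u).symm c = (fun i => c (leftFin w u i), fun i => c (rightFin w u i)) := rfl

theorem FdHilb.isUnitary_isoOf {V W : FdHilb} (e : V ≃ₗᵢ[ℂ] W) :
    FdHilb.IsUnitary (FdHilb.isoOf e.toLinearEquiv).hom := by
  have h : ∀ x : V,
      LinearMap.adjoint (𝕜 := ℂ) (E := V) (F := W) e.toLinearEquiv.toLinearMap (e x) = x := by
    intro x
    refine ext_inner_right ℂ fun y => ?_
    rw [LinearMap.adjoint_inner_left]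
    exact e.inner_map_map x y
  constructor
  · exact LinearMap.ext h
  · refine LinearMap.ext fun y => ?_
    obtain ⟨x, rfl⟩ := e.surjective y
    exact congrArg e (h x)

namespace Weights

variable {κ : Type} {d : ℂ}

/-- The matrix of a morphism of `O_d` in the bases of labellings. -/
noncomputable def homMat (W : Weights κ) {X Y : Kauffman d} (f : X ⟶ Y) :
    Matrix (Fin Y.word.length → κ) (Fin X.word.length → κ) ℂ :=
  Finsupp.linearCombination ℂ (Diagram.mat W) (f : Diagram X.word Y.word →₀ ℂ)

theorem homMat_single (W : Weights κ) {X Y : Kauffman d} (D : Diagram X.word Y.word) (a : ℂ) :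
    W.homMat (Finsupp.single D a : X ⟶ Y) = a • Diagram.mat W D :=
  Finsupp.linearCombination_single _ _ _

theorem homMat_id [DecidableEq κ] (W : Weights κ) (X : Kauffman d) : W.homMat (𝟙 X) = 1 := by
  refine (W.homMat_single _ _).trans ?_
  rw [one_smul, Diagram.mat_id]

theorem homMat_add (W : Weights κ) {X Y : Kauffman d} (f g : X ⟶ Y) :
    W.homMat (f + g) = W.homMat f + W.homMat g := map_add _ _ _

theorem homMat_smul (W : Weights κ) {X Y : Kauffman d} (a : ℂ) (f : X ⟶ Y) :
    W.homMat (a • f) = a • W.homMat f := map_smul _ _ _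

theorem homMat_comp [Fintype κ] {W : Weights κ} (hW : W.IsDual d) {X Y Z : Kauffman d} (f : X ⟶ Y)
    (g : Y ⟶ Z) : W.homMat (f ≫ g) = W.homMat g * W.homMat f := by
  change Finsupp.linearCombination ℂ (Diagram.mat W) (Kauffman.compL d f g) =
    Finsupp.linearCombination ℂ (Diagram.mat W) g * Finsupp.linearCombination ℂ (Diagram.mat W) f
  induction f using Finsupp.induction_linear with
  | zero => simp
  | add f f' hf hf' => simp only [map_add, LinearMap.add_apply, hf, hf', Matrix.mul_add]
  | single D a =>
    induction g using Finsupp.induction_linear with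
    | zero => simp
    | add f f' hf hf' => simp only [map_add, hf, hf', Matrix.add_mul]
    | single E b =>
      rw [Kauffman.compL_single, Finsupp.linearCombination_single, Finsupp.linearCombination_single,
        Finsupp.linearCombination_single, mul_smul, Diagram.mat_comp hW, Matrix.smul_mul,
        Matrix.mul_smul, smul_smul, mul_comm]

/-- The matrix of a juxtaposition is the Kronecker product of the matrices. -/
theorem homMat_tensor (W : Weights κ) {X Y X' Y' : Kauffman d} (f : X ⟶ Y) (g : X' ⟶ Y')
    (c : Fin (X.word ++ X'.word).length → κ) (c' : Fin (Y.word ++ Y'.word).length → κ) :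
    W.homMat (f ⊗ₘ g) c' c =
      W.homMat f (fun i => c' (leftFin _ _ i)) (fun i => c (leftFin _ _ i)) *
        W.homMat g (fun i => c' (rightFin _ _ i)) (fun i => c (rightFin _ _ i)) := by
  change Finsupp.linearCombination ℂ (Diagram.mat W) (Kauffman.tensorL f g) c' c =
    Finsupp.linearCombination ℂ (Diagram.mat W) f _ _ *
      Finsupp.linearCombination ℂ (Diagram.mat W) g _ _
  induction f using Finsupp.induction_linear with
  | zero => simp
  | add f f' hf hf' => simp only [map_add, LinearMap.add_apply, Matrix.add_apply, hf, hf', add_mul]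
  | single D a =>
    induction g using Finsupp.induction_linear with
    | zero => simp
    | add f f' hf hf' => simp only [map_add, Matrix.add_apply, hf, hf', mul_add]
    | single E b =>
      rw [Kauffman.tensorL_single, Finsupp.linearCombination_single,
        Finsupp.linearCombination_single, Finsupp.linearCombination_single]
      simp only [Matrix.smul_apply, smul_eq_mul, Diagram.mat, Matrix.of_apply, Diagram.coeff_tensor]
      have e1 : (fun x : Points X.word Y.word => (Sum.elim c c' : Points _ _ → κ) (leftPt x)) =
          Sum.elim (fun i => c (leftFin _ _ i)) (fun i => c' (leftFin _ _ i)) := by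
        funext x
        rcases x with x | x <;> rfl
      have e2 : (fun x : Points X'.word Y'.word => (Sum.elim c c' : Points _ _ → κ) (rightPt x)) =
          Sum.elim (fun i => c (rightFin _ _ i)) (fun i => c' (rightFin _ _ i)) := by
        funext x
        rcases x with x | x <;> rfl
      rw [e1, e2]
      ring

variable [Fintype κ]

variable (κ) in
/-- The Hilbert space with an orthonormal basis given by the labellings of a word. -/
noncomputable def space (w : Word) : FdHilb := ⟨EuclideanSpace ℂ (Fin w.length → κ)⟩

variable (κ) in
/-- The tensor product of two spaces of labellings. -/
noncomputable def tensorEquiv (w u : Word) :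
    (space κ w ⊗ space κ u : FdHilb) ≃ₗᵢ[ℂ] space κ (w ++ u) :=
  (((EuclideanSpace.basisFun (Fin w.length → κ) ℂ).tensorProduct
    (EuclideanSpace.basisFun (Fin u.length → κ) ℂ)).reindex (labelEquiv κ w u)).repr

variable (κ) in
/-- The space of labellings of the empty word. -/
noncomputable def unitEquiv : (𝟙_ FdHilb : FdHilb) ≃ₗᵢ[ℂ] space κ [] :=
  ((OrthonormalBasis.singleton Unit ℂ).reindex
    ((Equiv.equivPUnit (Fin 0 → κ)).symm : Unit ≃ (Fin ([] : Word).length → κ))).repr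

theorem tensorEquiv_tmul (w u : Word) (x : EuclideanSpace ℂ (Fin w.length → κ))
    (y : EuclideanSpace ℂ (Fin u.length → κ)) (c : Fin (w ++ u).length → κ) :
    (show EuclideanSpace ℂ (Fin (w ++ u).length → κ) from tensorEquiv κ w u (x ⊗ₜ[ℂ] y)) c =
      x (fun i => c (leftFin w u i)) * y (fun i => c (rightFin w u i)) := by
  change (((EuclideanSpace.basisFun (Fin w.length → κ) ℂ).tensorProduct
    (EuclideanSpace.basisFun (Fin u.length → κ) ℂ)).reindex (labelEquiv κ w u)).repr
      (x ⊗ₜ[ℂ] y) c = _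
  rw [OrthonormalBasis.repr_reindex, OrthonormalBasis.tensorProduct_repr_tmul_apply',
    labelEquiv_symm_apply]
  simp [mul_comm]

theorem unitEquiv_apply (z : ℂ) (c : Fin ([] : Word).length → κ) :
    (show EuclideanSpace ℂ (Fin ([] : Word).length → κ) from unitEquiv κ z) c = z :=
  (OrthonormalBasis.repr_reindex _ _ _ _).trans (OrthonormalBasis.singleton_repr z _)

variable [DecidableEq κ]

/-- The functor from `O_d` to Hilbert spaces given by weights. -/
noncomputable def functor (W : Weights κ) (hW : W.IsDual d) : Kauffman d ⥤ FdHilb where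
  obj X := space κ X.word
  map f := Matrix.toEuclideanLin (W.homMat f)
  map_id X := by
    rw [homMat_id]
    exact Matrix.toLpLin_one 2
  map_comp f g := by
    rw [homMat_comp hW]
    exact Matrix.toLpLin_mul_same 2 _ _

theorem functor_map_apply {W : Weights κ} (hW : W.IsDual d) {X Y : Kauffman d} (f : X ⟶ Y)
    (x : EuclideanSpace ℂ (Fin X.word.length → κ)) (c : Fin Y.word.length → κ) :
    (show EuclideanSpace ℂ (Fin Y.word.length → κ) from
      (show space κ X.word →ₗ[ℂ] space κ Y.word from (W.functor hW).map f) x) c =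
      ∑ a, W.homMat f c a * x a := rfl

instance {W : Weights κ} (hW : W.IsDual d) : (W.functor hW).Additive where
  map_add {X Y f g} := by
    change Matrix.toEuclideanLin (W.homMat (f + g)) =
      Matrix.toEuclideanLin (W.homMat f) + Matrix.toEuclideanLin (W.homMat g)
    rw [homMat_add, map_add]

instance {W : Weights κ} (hW : W.IsDual d) : (W.functor hW).Linear ℂ where
  map_smul f a := by
    change Matrix.toEuclideanLin (W.homMat (a • f)) = a • Matrix.toEuclideanLin (W.homMat f)
    rw [homMat_smul, map_smul]

theorem functor_map_eqToHom {W : Weights κ} (hW : W.IsDual d) {X Y : Kauffman d} (h : X = Y)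
    (x : EuclideanSpace ℂ (Fin X.word.length → κ)) (c : Fin Y.word.length → κ) :
    (show EuclideanSpace ℂ (Fin Y.word.length → κ) from
      (show space κ X.word →ₗ[ℂ] space κ Y.word from (W.functor hW).map (eqToHom h)) x) c =
      x (fun i => c (Fin.cast (by rw [h]) i)) := by
  subst h
  rw [eqToHom_refl, CategoryTheory.Functor.map_id]
  rfl

theorem functor_map_tensor {W : Weights κ} (hW : W.IsDual d) {X Y X' Y' : Kauffman d} (f : X ⟶ Y)
    (g : X' ⟶ Y') :
    ((W.functor hW).map f ⊗ₘ (W.functor hW).map g) ≫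
        (FdHilb.isoOf (tensorEquiv κ Y.word Y'.word).toLinearEquiv).hom =
      (FdHilb.isoOf (tensorEquiv κ X.word X'.word).toLinearEquiv).hom ≫
        (W.functor hW).map (f ⊗ₘ g) := by
  refine TensorProduct.ext' fun x y => ?_
  refine PiLp.ext fun c => ?_
  refine (tensorEquiv_tmul _ _ _ _ c).trans ?_
  refine Eq.trans ?_ (functor_map_apply hW (f ⊗ₘ g) _ c).symm
  refine Eq.trans (congrArg₂ (· * ·) (functor_map_apply hW f x _) (functor_map_apply hW g y _)) ?_
  rw [Finset.sum_mul_sum, ← Fintype.sum_prod_type']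
  refine Fintype.sum_equiv (labelEquiv κ X.word X'.word) _ _ fun p => ?_
  obtain ⟨c', rfl⟩ := (labelEquiv κ X.word X'.word).symm.surjective p
  rw [Equiv.apply_symm_apply]
  refine Eq.trans ?_ (congrArg₂ (· * ·) (homMat_tensor W f g c' c).symm
    (tensorEquiv_tmul _ _ x y c').symm)
  rw [labelEquiv_symm_apply]
  ring

/-- The tensor structure of the functor given by weights. -/
noncomputable def coreMonoidal {W : Weights κ} (hW : W.IsDual d) :
    (W.functor hW).CoreMonoidal where
  εIso := FdHilb.isoOf (unitEquiv κ).toLinearEquiv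
  μIso X Y := FdHilb.isoOf (tensorEquiv κ X.word Y.word).toLinearEquiv
  μIso_hom_natural_left f X' := by
    have h := functor_map_tensor hW f (𝟙 X')
    rwa [CategoryTheory.Functor.map_id, tensorHom_id, tensorHom_id] at h
  μIso_hom_natural_right X' f := by
    have h := functor_map_tensor hW (𝟙 X') f
    rwa [CategoryTheory.Functor.map_id, id_tensorHom, id_tensorHom] at h
  associativity X Y Z := by
    refine TensorProduct.ext_threefold fun x y z => ?_
    refine PiLp.ext fun c => ?_
    refine (functor_map_eqToHom hW (X := (X ⊗ Y) ⊗ Z) (Y := X ⊗ (Y ⊗ Z))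
      (congrArg Kauffman.mk (List.append_assoc X.word Y.word Z.word)) _ c).trans ?_
    refine (tensorEquiv_tmul _ _ _ _ _).trans ?_
    refine (congrArg (· * _) (tensorEquiv_tmul _ _ _ _ _)).trans ?_
    refine Eq.trans ?_ (tensorEquiv_tmul _ _ _ _ c).symm
    refine Eq.trans ?_ (congrArg (_ * ·) (tensorEquiv_tmul _ _ _ _ _).symm)
    rw [mul_assoc]
    refine congrArg (fun e => (show EuclideanSpace ℂ (Fin X.word.length → κ) from x) _ *
      ((show EuclideanSpace ℂ (Fin Y.word.length → κ) from y) _ *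
        (show EuclideanSpace ℂ (Fin Z.word.length → κ) from z) e)) ?_
    funext i
    refine congrArg c (Fin.ext ?_)
    have h : (X ⊗ Y).word.length = X.word.length + Y.word.length := List.length_append
    simp [rightFin, h, Nat.add_assoc]
  left_unitality X := by
    refine TensorProduct.ext' fun (z : ℂ) x => ?_
    refine PiLp.ext fun c => ?_
    refine Eq.trans ?_ (functor_map_eqToHom hW (X := 𝟙_ (Kauffman d) ⊗ X) (Y := X) rfl _ c).symm
    refine Eq.trans ?_ (tensorEquiv_tmul _ _ _ _ _).symm
    refine Eq.trans ?_ (congrArg (· * _) (unitEquiv_apply _ _).symm)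
    refine congrArg (fun e => z * (show EuclideanSpace ℂ (Fin X.word.length → κ) from x) e) ?_
    funext i
    refine congrArg c (Fin.ext ?_)
    exact (Nat.zero_add _).symm
  right_unitality X := by
    refine TensorProduct.ext' fun x (z : ℂ) => ?_
    refine PiLp.ext fun c => ?_
    refine Eq.trans ?_ (functor_map_eqToHom hW (X := X ⊗ 𝟙_ (Kauffman d)) (Y := X)
      (congrArg Kauffman.mk (List.append_nil X.word)) _ c).symm
    refine Eq.trans ?_ (tensorEquiv_tmul _ _ _ _ _).symm
    refine Eq.trans ?_ (congrArg (_ * ·) (unitEquiv_apply _ _).symm)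
    exact mul_comm z _

end Weights

end OrientedKauffman

namespace OrientedKauffman
open CategoryTheory MonoidalCategory TensorProduct

/-! ### The model fiber functors -/

namespace Diagram

theorem rel_of_two {a b : Bool} (D : Diagram [a, b] []) :
    D.rel (Sum.inl (0 : Fin 2)) (Sum.inl (1 : Fin 2)) := by
  have h := D.rel_partner (Sum.inl (0 : Fin 2))
  have h2 := D.partner_ne (Sum.inl (0 : Fin 2))
  rcases hx : D.partner (Sum.inl (0 : Fin 2)) with x | x
  · rw [hx] at h h2
    fin_cases x
    · exact absurd rfl h2
    · exact h
  · exact x.elim0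

/-- A diagram without lower points and with two upper points is a cap, in whichever way its points
are labelled. -/
theorem isCap_of_two {a b : Bool} (D : Diagram [a, b] []) :
    IsCap D Fin.elim0 (0 : Fin 2) (1 : Fin 2) where
  strictMono i := i.elim0
  next := rfl
  ne_left j := j.elim0
  ne_right j := j.elim0
  cases i := by
    fin_cases i
    · exact Or.inl rfl
    · exact Or.inr (Or.inl rfl)
  arc := D.rel_of_two
  straight j := j.elim0

end Diagram

theorem Diagram.coeff_arc {κ : Type} [DecidableEq κ] (W : Weights κ) (b : Bool)
    (c : Fin [b, !b].length → κ) (e : Fin ([] : Word).length → κ) :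
    (Diagram.arc b).coeff W (Sum.elim c e) =
      if c (0 : Fin 2) = c (1 : Fin 2) then
        (if b = true then W.capStart else W.capEnd) (c (0 : Fin 2)) else 0 := by
  rw [(Diagram.arc b).isCap_of_two.coeff_cap W e c, if_pos (funext fun i => i.elim0), mul_one]
  by_cases h : c (0 : Fin 2) = c (1 : Fin 2)
  · exact (if_pos h).trans (if_pos h).symm
  · exact (if_neg h).trans (if_neg h).symm

/-- The sign of a real number as a complex number, in the form in which it enters the
`*`-operation. -/
noncomputable def csign (d : ℝ) : ℂ := (d : ℂ) / (‖(d : ℂ)‖ : ℂ)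

theorem csign_eq (d : ℝ) : csign d = ((d / |d| : ℝ) : ℂ) := by
  rw [csign, Complex.norm_real, Real.norm_eq_abs, Complex.ofReal_div]

theorem star_csign (d : ℝ) : starRingEnd ℂ (csign d) = csign d := by
  rw [csign_eq, Complex.conj_ofReal]

theorem csign_mul_self {d : ℝ} (hd : d ≠ 0) : csign d * csign d = 1 := by
  rw [csign_eq, ← Complex.ofReal_mul, div_mul_div_comm, abs_mul_abs_self,
    div_self (mul_ne_zero hd hd), Complex.ofReal_one]

theorem csign_mul_abs {d : ℝ} (hd : d ≠ 0) : csign d * (|d| : ℝ) = d := by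
  rw [csign_eq, ← Complex.ofReal_mul, div_mul_cancel₀ _ (abs_ne_zero.2 hd)]

/-- The weights of the model fiber functor with given eigenvalues. The weight of the arc
`X* ⊗ X ⟶ I` is `μ`; the zigzag relations and the compatibility with the *-operation then
determine the other three. -/
noncomputable def eigenWeights (d : ℝ) {n : ℕ} (μ : Fin n → ℝ) : Weights (Fin n) where
  capStart i := csign d * ((μ i : ℂ))⁻¹
  capEnd i := μ i
  cupStart i := csign d * μ i
  cupEnd i := ((μ i : ℂ))⁻¹

theorem eigenWeights_isDual {d : ℝ} (hd : d ≠ 0) {n : ℕ} {μ : Fin n → ℝ} (hμ : ∀ i, 0 < μ i)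
    (h1 : ∑ i, μ i ^ 2 = |d|) (h2 : ∑ i, (μ i ^ 2)⁻¹ = |d|) :
    (eigenWeights d μ).IsDual d where
  start_mul i := by
    have : (μ i : ℂ) ≠ 0 := Complex.ofReal_ne_zero.2 (hμ i).ne'
    simp only [eigenWeights]
    rw [mul_mul_mul_comm, csign_mul_self hd, inv_mul_cancel₀ this, one_mul]
  end_mul i := mul_inv_cancel₀ (Complex.ofReal_ne_zero.2 (hμ i).ne')
  sum_start := by
    rw [← csign_mul_abs hd, ← h2, Complex.ofReal_sum, Finset.mul_sum]
    refine Finset.sum_congr rfl fun i _ => ?_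
    simp only [eigenWeights]
    push_cast
    rw [mul_assoc, pow_two, mul_inv]
  sum_end := by
    rw [← csign_mul_abs hd, ← h1, Complex.ofReal_sum, Finset.mul_sum]
    refine Finset.sum_congr rfl fun i _ => ?_
    simp only [eigenWeights]
    push_cast
    ring

theorem coeff_reflect_eigenWeights {d : ℝ} (hd : d ≠ 0) {n : ℕ} (μ : Fin n → ℝ) {w w' : Word}
    (D : Diagram w w') (a : Points w w' → Fin n) :
    D.coeff (eigenWeights d μ).reflect a =
      csign d ^ D.sharp * starRingEnd ℂ (D.coeff (eigenWeights d μ) a) := by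
  have hs := csign_mul_self hd
  refine Diagram.coeff_reflect_weights hs ?_ ?_ ?_ ?_ D a <;> intro i <;>
    simp only [eigenWeights, map_mul, map_inv₀, star_csign, Complex.conj_ofReal] <;>
    rw [← mul_assoc, hs, one_mul]

theorem homMat_dagger {d : ℝ} (hd : d ≠ 0) {n : ℕ} (μ : Fin n → ℝ) {Y Z : Kauffman (d : ℂ)}
    (f : Y ⟶ Z) :
    (eigenWeights d μ).homMat (Kauffman.dagger f) =
      ((eigenWeights d μ).homMat f).conjTranspose := by
  change Finsupp.linearCombination ℂ (Diagram.mat (eigenWeights d μ))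
    (Finsupp.sum (f : Diagram Y.word Z.word →₀ ℂ) fun D a =>
    (Finsupp.single D.reflect (starRingEnd ℂ a * csign d ^ D.sharp) :
      Diagram Z.word Y.word →₀ ℂ)) = (Finsupp.linearCombination ℂ (Diagram.mat (eigenWeights d μ))
    (f : Diagram Y.word Z.word →₀ ℂ)).conjTranspose
  induction f using Finsupp.induction_linear with
  | zero => simp
  | add f f' hf hf' =>
    rw [Finsupp.sum_add_index', map_add, map_add, Matrix.conjTranspose_add, hf, hf']
    · simp
    · intro D a b
      rw [map_add, add_mul, Finsupp.single_add]
  | single D a =>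
    rw [Finsupp.sum_single_index (by simp), Finsupp.linearCombination_single,
      Finsupp.linearCombination_single, Matrix.conjTranspose_smul, mul_smul, Diagram.mat_reflect]
    congr 1
    ext b c
    simp only [Matrix.smul_apply, Matrix.transpose_apply, Matrix.conjTranspose_apply, Diagram.mat,
      Matrix.of_apply, coeff_reflect_eigenWeights hd, smul_eq_mul]
    rw [← mul_assoc, ← mul_zpow, csign_mul_self hd, one_zpow, one_mul]
    rfl

/-- The model fiber functor with given eigenvalues. -/
noncomputable def modelFunctor {d : ℝ} (hd : d ≠ 0) {n : ℕ} {μ : Fin n → ℝ} (hμ : ∀ i, 0 < μ i)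
    (h1 : ∑ i, μ i ^ 2 = |d|) (h2 : ∑ i, (μ i ^ 2)⁻¹ = |d|) : UnitaryFiberFunctor d where
  toFunctor := (eigenWeights d μ).functor (eigenWeights_isDual hd hμ h1 h2)
  monoidal := (Weights.coreMonoidal (eigenWeights_isDual hd hμ h1 h2)).toMonoidal
  map_dagger f := by
    change Matrix.toEuclideanLin ((eigenWeights d μ).homMat (Kauffman.dagger f)) =
      LinearMap.adjoint (Matrix.toEuclideanLin ((eigenWeights d μ).homMat f))
    rw [homMat_dagger hd]
    exact Matrix.toEuclideanLin_conjTranspose_eq_adjoint _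
  isUnitary_unit := FdHilb.isUnitary_isoOf (Weights.unitEquiv (Fin n))
  isUnitary_tensor Y Z := FdHilb.isUnitary_isoOf (Weights.tensorEquiv (Fin n) Y.word Z.word)

/-- The orthonormal basis of the space of labellings of a word with one letter. -/
noncomputable def letterBasis (n : ℕ) (b : Bool) :
    OrthonormalBasis (Fin n) ℂ (Weights.space (Fin n) [b]) :=
  (EuclideanSpace.basisFun (Fin 1 → Fin n) ℂ).reindex (Equiv.funUnique (Fin 1) (Fin n))

theorem letterBasis_apply (n : ℕ) (b : Bool) (i : Fin n) (c : Fin [b].length → Fin n) :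
    (show EuclideanSpace ℂ (Fin [b].length → Fin n) from letterBasis n b i) c =
      if c (0 : Fin 1) = i then 1 else 0 := by
  change ((EuclideanSpace.basisFun (Fin 1 → Fin n) ℂ).reindex (Equiv.funUnique (Fin 1) (Fin n)) i :
    EuclideanSpace ℂ (Fin 1 → Fin n)) c = _
  rw [OrthonormalBasis.reindex_apply, EuclideanSpace.basisFun_apply, PiLp.single_apply]
  refine if_congr ?_ rfl rfl
  rw [Equiv.eq_symm_apply]
  rfl

theorem formMatrix_modelFunctor {d : ℝ} (hd : d ≠ 0) {n : ℕ} {μ : Fin n → ℝ} (hμ : ∀ i, 0 < μ i)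
    (h1 : ∑ i, μ i ^ 2 = |d|) (h2 : ∑ i, (μ i ^ 2)⁻¹ = |d|) :
    (modelFunctor hd hμ h1 h2).formMatrix (letterBasis n false) (letterBasis n true) =
      Matrix.diagonal fun i => (μ i : ℂ) := by
  ext j i
  have hW := eigenWeights_isDual hd hμ h1 h2
  have h : (modelFunctor hd hμ h1 h2).formMatrix (letterBasis n false) (letterBasis n true) j i =
      (Weights.unitEquiv (Fin n)).symm
        ((show Weights.space (Fin n) [false, true] →ₗ[ℂ] Weights.space (Fin n) [] from
          ((eigenWeights d μ).functor hW).map (Kauffman.epsilonXdual d))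
          (Weights.tensorEquiv (Fin n) [false] [true]
            (letterBasis n false j ⊗ₜ[ℂ] letterBasis n true i))) := rfl
  rw [h, LinearIsometryEquiv.symm_apply_eq]
  refine PiLp.ext fun c => ?_
  refine (Weights.functor_map_apply hW (Kauffman.epsilonXdual d) _ c).trans ?_
  refine Eq.trans ?_ (Weights.unitEquiv_apply _ _).symm
  have h' : (eigenWeights d μ).homMat (Kauffman.epsilonXdual (d : ℂ)) =
      Diagram.mat (eigenWeights d μ) (Diagram.arc false) :=
    (Weights.homMat_single _ _ _).trans (one_smul _ _)
  rw [h']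
  have hsum : ∀ a : Fin [false, true].length → Fin n,
      Diagram.mat (eigenWeights d μ) (Diagram.arc false) c a *
        (show EuclideanSpace ℂ (Fin [false, true].length → Fin n) from
          Weights.tensorEquiv (Fin n) [false] [true]
            (letterBasis n false j ⊗ₜ[ℂ] letterBasis n true i)) a =
        if a = ![j, i] then (if j = i then (μ i : ℂ) else 0) else 0 := by
    intro a
    rw [Diagram.mat, Matrix.of_apply, Diagram.coeff_arc]
    refine (congrArg (_ * ·) (Weights.tensorEquiv_tmul _ _ _ _ _)).trans ?_
    rw [letterBasis_apply, letterBasis_apply]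
    change (if a (0 : Fin 2) = a (1 : Fin 2) then (μ (a (0 : Fin 2)) : ℂ) else 0) *
      ((if a (0 : Fin 2) = j then 1 else 0) * (if a (1 : Fin 2) = i then 1 else 0)) = _
    by_cases ha : a = ![j, i]
    · subst ha
      by_cases hji : j = i
      · subst hji
        simp
      · simp [hji]
    · rw [if_neg ha]
      by_cases h0 : a (0 : Fin 2) = j
      · rw [if_neg (c := a (1 : Fin 2) = i), mul_zero, mul_zero]
        intro h1
        refine ha (funext fun k => ?_)
        fin_cases k
        · exact h0
        · exact h1
      · rw [if_neg h0, zero_mul, mul_zero]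
  -- only the labelling `(j, i)` contributes to the sum
  refine (Finset.sum_congr rfl fun a _ => hsum a).trans ?_
  refine (Fintype.sum_ite_eq' (ι := Fin 2 → Fin n) ![j, i] _).trans ?_
  rw [Matrix.diagonal_apply]
  by_cases hji : j = i
  · rw [if_pos hji, if_pos hji, hji]
  · rw [if_neg hji, if_neg hji]

end OrientedKauffman

namespace OrientedKauffman
open CategoryTheory MonoidalCategory TensorProduct Functor

/-! ### Fiber functors in terms of vectors -/

/-- A unitary morphism as an isometric linear equivalence. -/
noncomputable def FdHilb.IsUnitary.equiv {V W : FdHilb} {f : V ⟶ W} (hf : FdHilb.IsUnitary f) :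
    V ≃ₗᵢ[ℂ] W where
  toLinearEquiv := LinearEquiv.ofLinearMap f (FdHilb.adjoint f) hf.2 hf.1
  norm_map' x := by
    have h : inner ℂ ((show V →ₗ[ℂ] W from f) x) ((show V →ₗ[ℂ] W from f) x) = inner ℂ x x := by
      refine (LinearMap.adjoint_inner_left (𝕜 := ℂ) (E := V) (F := W) _ _ _).symm.trans ?_
      exact congrArg (fun y : V => inner ℂ y x) (LinearMap.congr_fun hf.1 x)
    rw [@norm_eq_sqrt_re_inner ℂ, @norm_eq_sqrt_re_inner ℂ V]
    exact congrArg (fun z : ℂ => √(RCLike.re z)) h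

namespace UnitaryFiberFunctor

variable {d : ℝ} (Φ : UnitaryFiberFunctor d)

/-- The Hilbert space that a fiber functor attaches to a word. -/
noncomputable def space (w : Word) : FdHilb := Φ.toFunctor.obj ⟨w⟩

/-- The tensor structure of a fiber functor. -/
noncomputable def mulEquiv (w u : Word) : (Φ.space w ⊗[ℂ] Φ.space u) ≃ₗᵢ[ℂ] Φ.space (w ++ u) :=
  (Φ.isUnitary_tensor ⟨w⟩ ⟨u⟩).equiv

/-- The product of vectors given by the tensor structure of a fiber functor. -/
noncomputable def mul {w u : Word} (x : Φ.space w) (y : Φ.space u) : Φ.space (w ++ u) :=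
  Φ.mulEquiv w u (x ⊗ₜ[ℂ] y)

/-- The unit of the tensor structure of a fiber functor. -/
noncomputable def unitEquiv : ℂ ≃ₗᵢ[ℂ] Φ.space [] :=
  Φ.isUnitary_unit.equiv

/-- The linear map that a fiber functor attaches to a diagram. -/
noncomputable def act {w u : Word} (D : Diagram w u) : Φ.space w →ₗ[ℂ] Φ.space u :=
  Φ.toFunctor.map (Kauffman.ofDiagram (X := ⟨w⟩) (Y := ⟨u⟩) D)

theorem act_id (w : Word) : Φ.act (Diagram.id w) = LinearMap.id :=
  Φ.toFunctor.map_id ⟨w⟩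

theorem ofDiagram_comp {d : ℂ} {w₀ w₁ w₂ : Word} (D : Diagram w₀ w₁) (E : Diagram w₁ w₂) :
    Kauffman.ofDiagram (d := d) (X := ⟨w₀⟩) (Y := ⟨w₁⟩) D ≫
        Kauffman.ofDiagram (X := ⟨w₁⟩) (Y := ⟨w₂⟩) E =
      d ^ D.loops E • Kauffman.ofDiagram (X := ⟨w₀⟩) (Y := ⟨w₂⟩) (D.comp E) := by
  refine (Kauffman.compL_single D E 1 1).trans ?_
  refine Eq.trans ?_ (Finsupp.smul_single' _ _ _).symm
  rw [one_mul, one_mul, mul_one]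

theorem act_comp {w₀ w₁ w₂ : Word} (D : Diagram w₀ w₁) (E : Diagram w₁ w₂) (x : Φ.space w₀) :
    Φ.act E (Φ.act D x) = (d : ℂ) ^ D.loops E • Φ.act (D.comp E) x := by
  have h := congrArg (fun f => Φ.toFunctor.map f) (ofDiagram_comp (d := (d : ℂ)) D E)
  simp only [Functor.map_comp, Functor.map_smul] at h
  exact LinearMap.congr_fun h x

theorem act_tensor {w₀ w₁ u₀ u₁ : Word} (D : Diagram w₀ w₁) (E : Diagram u₀ u₁) (x : Φ.space w₀)
    (y : Φ.space u₀) : Φ.act (D.tensor E) (Φ.mul x y) = Φ.mul (Φ.act D x) (Φ.act E y) := by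
  have h := LaxMonoidal.μ_natural Φ.toFunctor (Kauffman.ofDiagram (X := ⟨w₀⟩) (Y := ⟨w₁⟩) D)
    (Kauffman.ofDiagram (X := ⟨u₀⟩) (Y := ⟨u₁⟩) E)
  have h2 : Kauffman.ofDiagram (d := (d : ℂ)) (X := ⟨w₀⟩) (Y := ⟨w₁⟩) D ⊗ₘ
      Kauffman.ofDiagram (d := (d : ℂ)) (X := ⟨u₀⟩) (Y := ⟨u₁⟩) E =
      Kauffman.ofDiagram (X := ⟨w₀ ++ u₀⟩) (Y := ⟨w₁ ++ u₁⟩) (D.tensor E) := by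
    refine (Kauffman.tensorL_single D E 1 1).trans ?_
    rw [mul_one]
    rfl
  rw [h2] at h
  exact (LinearMap.congr_fun h (x ⊗ₜ[ℂ] y)).symm

theorem dagger_ofDiagram {w u : Word} (D : Diagram w u) :
    Kauffman.dagger (d := (d : ℂ)) (Kauffman.ofDiagram (X := ⟨w⟩) (Y := ⟨u⟩) D) =
      csign d ^ D.sharp • Kauffman.ofDiagram (X := ⟨u⟩) (Y := ⟨w⟩) D.reflect := by
  refine (Finsupp.sum_single_index (by simp)).trans ?_
  refine Eq.trans ?_ (Finsupp.smul_single' _ _ _).symm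
  rw [map_one, one_mul, mul_one]
  rfl

theorem adjoint_act {w u : Word} (D : Diagram w u) :
    LinearMap.adjoint (Φ.act D) = csign d ^ D.sharp • Φ.act D.reflect := by
  have h := Φ.map_dagger (Kauffman.ofDiagram (X := ⟨w⟩) (Y := ⟨u⟩) D)
  rw [dagger_ofDiagram, Functor.map_smul] at h
  exact h.symm

theorem unit_mul {w : Word} (z : ℂ) (x : Φ.space w) :
    (Φ.mul (Φ.unitEquiv z) x : Φ.space w) = z • x := by
  have h := LaxMonoidal.left_unitality Φ.toFunctor ⟨w⟩
  have h2 : Φ.toFunctor.map (λ_ (⟨w⟩ : Kauffman (d : ℂ))).hom = 𝟙 (Φ.toFunctor.obj ⟨w⟩) :=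
    Φ.toFunctor.map_id ⟨w⟩
  have h3 := LinearMap.congr_fun h (z ⊗ₜ[ℂ] x)
  refine Eq.trans ?_ h3.symm
  exact (LinearMap.congr_fun h2 (Φ.mul (Φ.unitEquiv z) x)).symm

/-- For a word with one letter the right unitor of the category is an identity by definition. -/
theorem mul_unit (a : Bool) (z : ℂ) (x : Φ.space [a]) :
    (Φ.mul x (Φ.unitEquiv z) : Φ.space [a]) = z • x := by
  have h := LaxMonoidal.right_unitality Φ.toFunctor ⟨[a]⟩
  have h2 : Φ.toFunctor.map (ρ_ (⟨[a]⟩ : Kauffman (d : ℂ))).hom = 𝟙 (Φ.toFunctor.obj ⟨[a]⟩) :=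
    Φ.toFunctor.map_id ⟨[a]⟩
  have h3 := LinearMap.congr_fun h (x ⊗ₜ[ℂ] z)
  refine Eq.trans ?_ h3.symm
  exact (LinearMap.congr_fun h2 (Φ.mul x (Φ.unitEquiv z))).symm

/-- For a word with one letter on the left the associator of the category is an identity by
definition. -/
theorem mul_assoc_letter (a : Bool) {w u : Word} (x : Φ.space [a]) (y : Φ.space w)
    (z : Φ.space u) :
    (Φ.mul (w := [a] ++ w) (Φ.mul x y) z : Φ.space (a :: (w ++ u))) = Φ.mul x (Φ.mul y z) := by
  have h := LaxMonoidal.associativity Φ.toFunctor ⟨[a]⟩ ⟨w⟩ ⟨u⟩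
  have h2 : Φ.toFunctor.map (α_ (⟨[a]⟩ : Kauffman (d : ℂ)) ⟨w⟩ ⟨u⟩).hom =
      𝟙 (Φ.toFunctor.obj ⟨a :: (w ++ u)⟩) :=
    Φ.toFunctor.map_id ⟨a :: (w ++ u)⟩
  have h3 := LinearMap.congr_fun h ((x ⊗ₜ[ℂ] y) ⊗ₜ[ℂ] z)
  refine Eq.trans ?_ h3
  exact (LinearMap.congr_fun h2 (Φ.mul (w := [a] ++ w) (Φ.mul x y) z)).symm

/-- The orthonormal basis of products of basis vectors. -/
noncomputable def mulBasis {w u : Word} {ι κ : Type} [Fintype ι] [Fintype κ]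
    (b : OrthonormalBasis ι ℂ (Φ.space w)) (c : OrthonormalBasis κ ℂ (Φ.space u)) :
    OrthonormalBasis (ι × κ) ℂ (Φ.space (w ++ u)) :=
  (b.tensorProduct c).map (Φ.mulEquiv w u)

theorem mulBasis_apply {w u : Word} {ι κ : Type} [Fintype ι] [Fintype κ]
    (b : OrthonormalBasis ι ℂ (Φ.space w)) (c : OrthonormalBasis κ ℂ (Φ.space u)) (p : ι × κ) :
    Φ.mulBasis b c p = Φ.mul (b p.1) (c p.2) := by
  rw [mulBasis, OrthonormalBasis.map_apply, OrthonormalBasis.tensorProduct_apply']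
  rfl

/-- The bilinear form given by a diagram without lower points. -/
noncomputable def form {a b : Bool} (D : Diagram [a, b] []) (x : Φ.space [a]) (y : Φ.space [b]) :
    ℂ :=
  Φ.unitEquiv.symm (Φ.act D (Φ.mul x y))

theorem act_mul_letters {a b : Bool} (D : Diagram [a, b] []) (x : Φ.space [a]) (y : Φ.space [b]) :
    Φ.act D (Φ.mul x y) = Φ.unitEquiv (Φ.form D x y) :=
  (LinearIsometryEquiv.apply_symm_apply _ _).symm

theorem formMatrix_eq {m n : ℕ}
    (w : OrthonormalBasis (Fin m) ℂ (Φ.space [false]))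
    (v : OrthonormalBasis (Fin n) ℂ (Φ.space [true])) :
    Φ.formMatrix w v = Matrix.of fun j i => Φ.form (Diagram.arc false) (w j) (v i) := by
  ext j i
  change _ = Φ.unitEquiv.symm (Φ.act (Diagram.arc false) (Φ.mul (w j) (v i)))
  rw [LinearIsometryEquiv.eq_symm_apply]
  exact LinearMap.congr_fun (Functor.Monoidal.η_ε (F := Φ.toFunctor))
    (Φ.act (Diagram.arc false) (Φ.mul (w j) (v i)))

end UnitaryFiberFunctor

end OrientedKauffman

namespace OrientedKauffman
open CategoryTheory MonoidalCategory TensorProduct Functor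

/-! ### The zigzag and loop relations -/

namespace Diagram

theorem rel_letter {a : Bool} (D : Diagram [a] [a]) (x y : Points [a] [a]) : D.rel x y := by
  have h : D.rel (Sum.inl (0 : Fin 1)) (Sum.inr (0 : Fin 1)) := by
    have h := D.rel_partner (Sum.inl (0 : Fin 1))
    have h2 := D.partner_ne (Sum.inl (0 : Fin 1))
    rcases hx : D.partner (Sum.inl (0 : Fin 1)) with x | x
    · rw [hx] at h2
      fin_cases x
      exact absurd rfl h2
    · rw [hx] at h
      fin_cases x
      exact h
  have h' : ∀ x : Points [a] [a], D.rel (Sum.inl (0 : Fin 1)) x := by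
    rintro (x | x) <;> fin_cases x
    · exact D.rel.refl' _
    · exact h
  exact D.rel.trans' (D.rel.symm' (h' x)) (h' y)

theorem eq_id_letter {a : Bool} (D : Diagram [a] [a]) : D = id [a] :=
  Diagram.ext (Setoid.ext fun x y => iff_of_true (D.rel_letter x y) ((id [a]).rel_letter x y))

theorem eq_id_nil (D : Diagram [] []) : D = id [] :=
  Diagram.ext (Setoid.ext fun x => by rcases x with x | x <;> exact x.elim0)

theorem isCap_id_tensor {a b : Bool} (D : Diagram [b, a] []) :
    IsCap ((id [a]).tensor D : Diagram [a, b, a] [a]) (fun _ => (0 : Fin 3)) (1 : Fin 3)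
      (2 : Fin 3) where
  strictMono i j h := absurd h (by rw [Subsingleton.elim (α := Fin 1) i j]; exact lt_irrefl _)
  next := rfl
  ne_left j := Fin.ne_of_val_ne (by simp)
  ne_right j := Fin.ne_of_val_ne (by simp)
  cases i := by
    fin_cases i
    · exact Or.inr (Or.inr ⟨(0 : Fin 1), rfl⟩)
    · exact Or.inl rfl
    · exact Or.inr (Or.inl rfl)
  arc := (tensorRel_right (M := (id [a]).rel) (N := D.rel) (a := Sum.inl (0 : Fin 2))
    (a' := Sum.inl (1 : Fin 2))).2 D.rel_of_two
  straight j := by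
    obtain rfl : j = (0 : Fin 1) := Subsingleton.elim (α := Fin 1) _ _
    exact (tensorRel_left (M := (id [a]).rel) (N := D.rel) (a := Sum.inl (0 : Fin 1))
      (a' := Sum.inr (0 : Fin 1))).2 ((id [a]).rel_letter _ _)

theorem isCap_tensor_id {a b : Bool} (D : Diagram [a, b] []) :
    IsCap (D.tensor (id [a]) : Diagram [a, b, a] [a]) (fun _ => (2 : Fin 3)) (0 : Fin 3)
      (1 : Fin 3) where
  strictMono i j h := absurd h (by rw [Subsingleton.elim (α := Fin 1) i j]; exact lt_irrefl _)
  next := rfl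
  ne_left j := Fin.ne_of_val_ne (by simp)
  ne_right j := Fin.ne_of_val_ne (by simp)
  cases i := by
    fin_cases i
    · exact Or.inl rfl
    · exact Or.inr (Or.inl rfl)
    · exact Or.inr (Or.inr ⟨(0 : Fin 1), rfl⟩)
  arc := (tensorRel_left (M := D.rel) (N := (id [a]).rel) (a := Sum.inl (0 : Fin 2))
    (a' := Sum.inl (1 : Fin 2))).2 D.rel_of_two
  straight j := by
    obtain rfl : j = (0 : Fin 1) := Subsingleton.elim (α := Fin 1) _ _
    exact (tensorRel_right (M := D.rel) (N := (id [a]).rel) (a := Sum.inl (0 : Fin 1))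
      (a' := Sum.inr (0 : Fin 1))).2 ((id [a]).rel_letter _ _)

/-- The zigzag of two arcs has no loops. -/
theorem loops_zigzag {a b : Bool} (D₁ : Diagram [a, b] []) (D₂ : Diagram [b, a] []) :
    ((id [a]).tensor D₂ : Diagram [a, b, a] [a]).reflect.loops
      (D₁.tensor (id [a]) : Diagram [a, b, a] [a]) = 0 := by
  have h1 := isCap_id_tensor D₂
  refine (isCap_tensor_id D₁).loops_of_not_rel _ fun h => ?_
  -- the point `0` of the middle line is joined to the outer point and not to the point `1`
  have h : ((id [a]).tensor D₂ : Diagram [a, b, a] [a]).rel (Sum.inl (0 : Fin 3))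
    (Sum.inl (1 : Fin 3)) := h
  have h2 := Diagram.partner_eq _ (h1.straight (0 : Fin 1)) (by simp)
  have h3 := Diagram.partner_eq _ h fun e =>
    absurd (congrArg Fin.val (Sum.inl_injective e)) (by simp)
  rw [h2] at h3
  exact absurd h3 (by simp)

theorem loops_reflect_of_two {a b : Bool} (D : Diagram [a, b] []) : D.reflect.loops D = 1 :=
  D.isCap_of_two.loops_of_rel _ D.rel_of_two

end Diagram

theorem norm_csign {d : ℝ} (hd : d ≠ 0) : ‖csign d‖ = 1 := by
  rw [csign_eq, Complex.norm_real, norm_div, norm_abs_eq_norm, div_self (norm_ne_zero_iff.2 hd)]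

namespace UnitaryFiberFunctor

variable {d : ℝ}

theorem act_zigzag (Φ : UnitaryFiberFunctor d) {a b : Bool} (D₁ : Diagram [a, b] [])
    (D₂ : Diagram [b, a] []) (x : Φ.space [a]) :
    Φ.act (D₁.tensor (Diagram.id [a]) : Diagram [a, b, a] [a])
      (LinearMap.adjoint (Φ.act ((Diagram.id [a]).tensor D₂ : Diagram [a, b, a] [a])) x) =
      csign d ^ ((Diagram.id [a]).tensor D₂).sharp • x := by
  rw [adjoint_act, LinearMap.smul_apply, LinearMap.map_smul, act_comp, Diagram.loops_zigzag,
    pow_zero, one_smul, Diagram.eq_id_letter (Diagram.comp _ _)]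
  exact congrArg (csign d ^ ((Diagram.id [a]).tensor D₂).sharp • ·)
    (LinearMap.congr_fun (Φ.act_id [a]) x)

theorem act_loop (Φ : UnitaryFiberFunctor d) {a b : Bool} (D : Diagram [a, b] [])
    (x : Φ.space []) :
    Φ.act D (LinearMap.adjoint (Φ.act D) x) = (csign d ^ D.sharp * d) • x := by
  rw [adjoint_act, LinearMap.smul_apply, LinearMap.map_smul, act_comp,
    Diagram.loops_reflect_of_two, pow_one, Diagram.eq_id_nil (Diagram.comp _ _), act_id, smul_smul]
  rfl

/-- The zigzag relation for the matrices of two opposite arcs: the matrix of one of them and the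
conjugate of the matrix of the other one are inverse to each other up to a sign. -/
theorem sum_form_mul_star_form (Φ : UnitaryFiberFunctor d) {a b : Bool} (D₁ : Diagram [a, b] [])
    (D₂ : Diagram [b, a] []) {ι κ : Type} [Fintype ι] [Fintype κ] [DecidableEq ι]
    (e : OrthonormalBasis ι ℂ (Φ.space [a])) (f : OrthonormalBasis κ ℂ (Φ.space [b])) (l k : ι) :
    ∑ j, Φ.form D₁ (e l) (f j) * starRingEnd ℂ (Φ.form D₂ (f j) (e k)) =
      if l = k then csign d ^ ((Diagram.id [a]).tensor D₂).sharp else 0 := by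
  let T : OrthonormalBasis (ι × (κ × ι)) ℂ (Φ.space [a, b, a]) := Φ.mulBasis e (Φ.mulBasis f e)
  have hT : ∀ p, T p = Φ.mul (e p.1) (Φ.mul (f p.2.1) (e p.2.2)) := fun p =>
    (Φ.mulBasis_apply e (Φ.mulBasis f e) p).trans
      (congrArg (Φ.mul (e p.1)) (Φ.mulBasis_apply f e p.2))
  have h1 : ∀ p, Φ.act ((Diagram.id [a]).tensor D₂ : Diagram [a, b, a] [a]) (T p) =
      Φ.form D₂ (f p.2.1) (e p.2.2) • e p.1 := by
    intro p
    rw [hT]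
    refine (Φ.act_tensor (Diagram.id [a]) D₂ (e p.1) (Φ.mul (f p.2.1) (e p.2.2))).trans ?_
    rw [act_mul_letters, act_id]
    exact Φ.mul_unit a _ _
  have h2 : ∀ p, Φ.act (D₁.tensor (Diagram.id [a]) : Diagram [a, b, a] [a]) (T p) =
      Φ.form D₁ (e p.1) (f p.2.1) • e p.2.2 := by
    intro p
    rw [hT]
    refine (congrArg _ (Φ.mul_assoc_letter a (e p.1) (f p.2.1) (e p.2.2)).symm).trans ?_
    refine (Φ.act_tensor D₁ (Diagram.id [a]) (Φ.mul (e p.1) (f p.2.1)) (e p.2.2)).trans ?_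
    rw [act_mul_letters, act_id]
    exact Φ.unit_mul _ _
  -- both sides of the zigzag relation are paired with `e k` and expanded in the basis `T`
  have h3 := congrArg (inner ℂ (e k)) (Φ.act_zigzag D₁ D₂ (e l))
  rw [← LinearMap.adjoint_inner_left, ← T.sum_inner_mul_inner, inner_smul_right,
    e.inner_eq_ite] at h3
  have h4 : ∀ p, inner ℂ (LinearMap.adjoint
      (Φ.act (D₁.tensor (Diagram.id [a]) : Diagram [a, b, a] [a])) (e k)) (T p) *
        inner ℂ (T p) (LinearMap.adjoint
          (Φ.act ((Diagram.id [a]).tensor D₂ : Diagram [a, b, a] [a])) (e l)) =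
      if p.1 = l then (if p.2.2 = k then
        Φ.form D₁ (e l) (f p.2.1) * starRingEnd ℂ (Φ.form D₂ (f p.2.1) (e k)) else 0) else 0 := by
    intro p
    rw [LinearMap.adjoint_inner_left, LinearMap.adjoint_inner_right, h1, h2, inner_smul_right,
      inner_smul_left, e.inner_eq_ite, e.inner_eq_ite]
    by_cases hl : p.1 = l
    · by_cases hk : p.2.2 = k
      · subst hl hk
        simp
      · simp [hk, Ne.symm hk]
    · simp [hl]
  rw [Finset.sum_congr rfl fun p _ => h4 p, Fintype.sum_prod_type] at h3
  simp only [Fintype.sum_prod_type] at h3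
  rw [show (if l = k then csign d ^ ((Diagram.id [a]).tensor D₂).sharp else 0) =
    csign d ^ ((Diagram.id [a]).tensor D₂).sharp * (if k = l then 1 else 0) by
      simp [eq_comm], ← h3]
  simp

/-- The loop relation for the matrix of an arc: its squared Hilbert-Schmidt norm is `|d|`. -/
theorem sum_norm_form (hd : d ≠ 0) (Φ : UnitaryFiberFunctor d) {a b : Bool}
    (D : Diagram [a, b] []) {ι κ : Type} [Fintype ι] [Fintype κ]
    (e : OrthonormalBasis ι ℂ (Φ.space [a])) (f : OrthonormalBasis κ ℂ (Φ.space [b])) :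
    ∑ i, ∑ j, ‖Φ.form D (e i) (f j)‖ ^ 2 = |d| := by
  let T : OrthonormalBasis (ι × κ) ℂ (Φ.space [a, b]) := Φ.mulBasis e f
  have hT : ∀ p, Φ.act D (T p) = Φ.unitEquiv (Φ.form D (e p.1) (f p.2)) := fun p =>
    (congrArg (Φ.act D) (Φ.mulBasis_apply e f p)).trans (Φ.act_mul_letters D _ _)
  have h := congrArg (inner ℂ (Φ.unitEquiv 1)) (Φ.act_loop D (Φ.unitEquiv 1))
  rw [← LinearMap.adjoint_inner_left, ← T.sum_inner_mul_inner, inner_smul_right,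
    LinearIsometryEquiv.inner_map_map] at h
  have h2 : ∀ p, inner ℂ (LinearMap.adjoint (Φ.act D) (Φ.unitEquiv 1)) (T p) *
      inner ℂ (T p) (LinearMap.adjoint (Φ.act D) (Φ.unitEquiv 1)) =
      ((‖Φ.form D (e p.1) (f p.2)‖ ^ 2 : ℝ) : ℂ) := by
    intro p
    rw [LinearMap.adjoint_inner_left, LinearMap.adjoint_inner_right, hT,
      LinearIsometryEquiv.inner_map_map, LinearIsometryEquiv.inner_map_map]
    simp [Complex.mul_conj']
  rw [Finset.sum_congr rfl fun p _ => h2 p, ← Complex.ofReal_sum, Fintype.sum_prod_type] at h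
  -- the sign on the right is irrelevant, because the left side is a nonnegative real number
  have h3 := congrArg norm h
  rw [Complex.norm_real, Real.norm_of_nonneg
    (Finset.sum_nonneg fun _ _ => Finset.sum_nonneg fun _ _ => sq_nonneg _)] at h3
  rw [h3, norm_mul, norm_mul, norm_zpow, norm_csign hd, one_zpow, one_mul, Complex.norm_real]
  simp

end UnitaryFiberFunctor

end OrientedKauffman

namespace OrientedKauffman
open scoped ComplexOrder

/-! ### Matrices of bilinear forms in orthonormal bases -/

section BilinearForms

variable {V W : Type} [NormedAddCommGroup V] [InnerProductSpace ℂ V] [NormedAddCommGroup W]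
  [InnerProductSpace ℂ W] {ι κ ι' κ' : Type} [Fintype ι] [Fintype κ] [Fintype ι'] [Fintype κ']

/-- The matrix of a bilinear form. -/
def bilinMatrix (β : W →ₗ[ℂ] V →ₗ[ℂ] ℂ) (w : κ → W) (v : ι → V) : Matrix κ ι ℂ :=
  Matrix.of fun j i => β (w j) (v i)

/-- The matrix with the coefficients of the vectors of an orthonormal basis in another one. -/
noncomputable def coeffMatrix (v : OrthonormalBasis ι ℂ V) (v' : OrthonormalBasis ι' ℂ V) :
    Matrix ι ι' ℂ :=
  Matrix.of fun i i' => inner ℂ (v i) (v' i')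

theorem coeffMatrix_conjTranspose (v : OrthonormalBasis ι ℂ V) (v' : OrthonormalBasis ι' ℂ V) :
    (coeffMatrix v v').conjTranspose = coeffMatrix v' v := by
  ext i j
  exact inner_conj_symm _ _

theorem coeffMatrix_mul [DecidableEq ι] (v : OrthonormalBasis ι ℂ V)
    (v' : OrthonormalBasis ι' ℂ V) : coeffMatrix v v' * coeffMatrix v' v = 1 := by
  ext i j
  rw [Matrix.mul_apply, Matrix.one_apply]
  exact (v'.sum_inner_mul_inner _ _).trans (v.inner_eq_ite i j)

theorem bilinMatrix_change (β : W →ₗ[ℂ] V →ₗ[ℂ] ℂ) (w : OrthonormalBasis κ ℂ W)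
    (w' : OrthonormalBasis κ' ℂ W) (v : OrthonormalBasis ι ℂ V) (v' : OrthonormalBasis ι' ℂ V) :
    bilinMatrix β w' v' =
      (coeffMatrix w w').transpose * bilinMatrix β w v * coeffMatrix v v' := by
  ext j i
  rw [Matrix.mul_apply]
  conv_lhs => rw [bilinMatrix, Matrix.of_apply, ← w.sum_repr' (w' j), ← v.sum_repr' (v' i)]
  simp only [map_sum, map_smul, LinearMap.sum_apply, LinearMap.smul_apply, smul_eq_mul,
    Matrix.mul_apply, Matrix.transpose_apply, coeffMatrix, bilinMatrix, Matrix.of_apply,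
    Finset.mul_sum, Finset.sum_mul]
  refine Finset.sum_congr rfl fun i _ => Finset.sum_congr rfl fun j _ => ?_
  ring

/-- A change of orthonormal bases does not change the characteristic polynomial of `B* B`. -/
theorem charpoly_bilinMatrix [DecidableEq ι] (β : W →ₗ[ℂ] V →ₗ[ℂ] ℂ)
    (w : OrthonormalBasis κ ℂ W) (w' : OrthonormalBasis κ' ℂ W) (v v' : OrthonormalBasis ι ℂ V) :
    ((bilinMatrix β w' v').conjTranspose * bilinMatrix β w' v').charpoly =
      ((bilinMatrix β w v).conjTranspose * bilinMatrix β w v).charpoly := by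
  classical
  have h1 : (coeffMatrix w w').transpose.conjTranspose * (coeffMatrix w w').transpose = 1 := by
    have h := congrArg Matrix.transpose (coeffMatrix_mul w w')
    rw [Matrix.transpose_mul, Matrix.transpose_one, ← coeffMatrix_conjTranspose w w'] at h
    exact h
  rw [bilinMatrix_change β w w' v v', Matrix.conjTranspose_mul, Matrix.conjTranspose_mul]
  generalize bilinMatrix β w v = B
  have h2 : (coeffMatrix v v').conjTranspose * (B.conjTranspose *
      (coeffMatrix w w').transpose.conjTranspose) *
        ((coeffMatrix w w').transpose * B * coeffMatrix v v') =
      (coeffMatrix v v').conjTranspose * (B.conjTranspose *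
        ((coeffMatrix w w').transpose.conjTranspose * (coeffMatrix w w').transpose) * B *
          coeffMatrix v v') := by
    simp only [Matrix.mul_assoc]
  rw [h2, h1, Matrix.mul_one, Matrix.charpoly_mul_comm, Matrix.mul_assoc,
    coeffMatrix_conjTranspose, coeffMatrix_mul, Matrix.mul_one]

/-- The singular value decomposition of a nondegenerate bilinear form. The second basis consists of
eigenvectors of `B* B`, and `μ` of the square roots of the eigenvalues. -/
theorem exists_bilinMatrix_diagonal [DecidableEq ι] [FiniteDimensional ℂ W]
    (β : W →ₗ[ℂ] V →ₗ[ℂ] ℂ)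
    (w : OrthonormalBasis κ ℂ W) (v : OrthonormalBasis ι ℂ V)
    (hcard : Fintype.card ι = Fintype.card κ)
    (hB : Function.Injective (bilinMatrix β w v).mulVec) :
    ∃ (μ : ι → ℝ) (w' : OrthonormalBasis ι ℂ W) (v' : OrthonormalBasis ι ℂ V),
      (∀ i, 0 < μ i) ∧ bilinMatrix β w' v' = Matrix.diagonal fun i => (μ i : ℂ) := by
  classical
  set B := bilinMatrix β w v with hBdef
  have hG := Matrix.isHermitian_conjTranspose_mul_self B
  have hpos : ∀ i, 0 < hG.eigenvalues i :=
    (Matrix.PosDef.conjTranspose_mul_self B hB).eigenvalues_pos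
  let μ : ι → ℝ := fun i => √(hG.eigenvalues i)
  have hμ : ∀ i, 0 < μ i := fun i => Real.sqrt_pos.2 (hpos i)
  have hμ0 : ∀ i, (μ i : ℂ) ≠ 0 := fun i => Complex.ofReal_ne_zero.2 (hμ i).ne'
  have hμsq : ∀ i, (μ i : ℂ) * μ i = hG.eigenvalues i := fun i => by
    rw [← Complex.ofReal_mul, Real.mul_self_sqrt (hpos i).le]
  let v' : OrthonormalBasis ι ℂ V := hG.eigenvectorBasis.map v.repr.symm
  -- the columns of the matrix in the new basis are orthogonal
  have horth : ∀ i k, ∑ j, starRingEnd ℂ (β (w j) (v' i)) * β (w j) (v' k) =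
      if i = k then (hG.eigenvalues k : ℂ) else 0 := by
    have hcol : ∀ j i, β (w j) (v' i) = (B.mulVec (hG.eigenvectorBasis i)) j := by
      intro j i
      have h : v' i = ∑ k, (hG.eigenvectorBasis i) k • v k := by
        rw [OrthonormalBasis.map_apply]
        exact (v.sum_repr_symm _).symm
      rw [h, map_sum]
      refine Finset.sum_congr rfl fun k _ => ?_
      rw [map_smul, smul_eq_mul, mul_comm]
      rfl
    intro i k
    simp only [hcol]
    have h1 : ∑ j, starRingEnd ℂ (B.mulVec (hG.eigenvectorBasis i) j) *
        B.mulVec (hG.eigenvectorBasis k) j =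
        star (hG.eigenvectorBasis i : ι → ℂ) ⬝ᵥ
          ((B.conjTranspose * B).mulVec (hG.eigenvectorBasis k)) := by
      rw [← Matrix.mulVec_mulVec, Matrix.dotProduct_mulVec, ← Matrix.star_mulVec]
      rfl
    rw [h1, hG.mulVec_eigenvectorBasis]
    have h2 := hG.eigenvectorBasis.inner_eq_ite i k
    rw [EuclideanSpace.inner_eq_star_dotProduct, dotProduct_comm] at h2
    have h3 : (hG.eigenvalues k • (hG.eigenvectorBasis k : ι → ℂ)) =
        (hG.eigenvalues k : ℂ) • (hG.eigenvectorBasis k : ι → ℂ) := by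
      ext j
      simp
    rw [h3, dotProduct_smul, h2, smul_eq_mul, mul_ite, mul_one, mul_zero]
  -- the normalized columns, conjugated as the form is bilinear, are the other basis
  let u : ι → W := fun i => ∑ j, (starRingEnd ℂ (β (w j) (v' i)) * (μ i : ℂ)⁻¹) • w j
  have hu : Orthonormal ℂ u := by
    rw [orthonormal_iff_ite]
    intro i k
    have h : inner ℂ (u i) (u k) =
        (μ i : ℂ)⁻¹ * (μ k : ℂ)⁻¹ * ∑ j, starRingEnd ℂ (β (w j) (v' k)) * β (w j) (v' i) := by
      rw [w.orthonormal.inner_sum, Finset.mul_sum]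
      refine Finset.sum_congr rfl fun j _ => ?_
      simp only [map_mul, map_inv₀, Complex.conj_ofReal, Complex.conj_conj]
      ring
    rw [h, horth]
    by_cases hik : i = k
    · subst hik
      rw [if_pos rfl, if_pos rfl, ← hμsq]
      field_simp [hμ0 i]
    · rw [if_neg hik, if_neg (Ne.symm hik), mul_zero]
  have hspan : ⊤ ≤ Submodule.span ℂ (Set.range u) := by
    rw [hu.linearIndependent.span_eq_top_of_card_eq_finrank']
    rw [hcard, Module.finrank_eq_card_basis w.toBasis]
  refine ⟨μ, OrthonormalBasis.mk hu hspan, v', hμ, ?_⟩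
  ext i k
  rw [bilinMatrix, Matrix.of_apply, OrthonormalBasis.coe_mk]
  simp only [u]
  rw [map_sum, LinearMap.sum_apply]
  simp only [map_smul, LinearMap.smul_apply, smul_eq_mul]
  have h : ∑ j, starRingEnd ℂ (β (w j) (v' i)) * (μ i : ℂ)⁻¹ * β (w j) (v' k) =
      (μ i : ℂ)⁻¹ * ∑ j, starRingEnd ℂ (β (w j) (v' i)) * β (w j) (v' k) := by
    rw [Finset.mul_sum]
    exact Finset.sum_congr rfl fun j _ => by ring
  rw [h, horth, Matrix.diagonal_apply]
  by_cases hik : i = k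
  · subst hik
    rw [if_pos rfl, if_pos rfl, ← hμsq]
    field_simp [hμ0 i]
  · rw [if_neg hik, if_neg hik, mul_zero]

end BilinearForms

theorem absEigenvalues_eq_roots {m n : ℕ} (B : Matrix (Fin m) (Fin n) ℂ) :
    absEigenvalues B = (B.conjTranspose * B).charpoly.roots.map fun z => √z.re := by
  rw [(Matrix.isHermitian_conjTranspose_mul_self B).roots_charpoly_eq_eigenvalues,
    Multiset.map_map]
  rfl

theorem absEigenvalues_diagonal {n : ℕ} {μ : Fin n → ℝ} (hμ : ∀ i, 0 < μ i) :
    absEigenvalues (Matrix.diagonal fun i => (μ i : ℂ)) = Finset.univ.val.map μ := by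
  rw [absEigenvalues_eq_roots, Matrix.diagonal_conjTranspose, Matrix.diagonal_mul_diagonal,
    Matrix.charpoly_diagonal, Polynomial.roots_prod _ _
      (Finset.prod_ne_zero_iff.2 fun i _ => Polynomial.X_sub_C_ne_zero _)]
  simp only [Polynomial.roots_X_sub_C, Multiset.bind_singleton, Multiset.map_map]
  refine Multiset.map_congr rfl fun i _ => ?_
  simp only [Function.comp, Pi.star_apply, RCLike.star_def, Complex.conj_ofReal]
  rw [← Complex.ofReal_mul, Complex.ofReal_re, Real.sqrt_mul_self (hμ i).le]

end OrientedKauffman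

namespace OrientedKauffman
open CategoryTheory MonoidalCategory TensorProduct

/-! ### The eigenvalues of a fiber functor -/

namespace UnitaryFiberFunctor

variable {d : ℝ}

/-- The bilinear form given by a diagram without lower points, as a bilinear map. -/
noncomputable def formMap (Φ : UnitaryFiberFunctor d) {a b : Bool} (D : Diagram [a, b] []) :
    Φ.space [a] →ₗ[ℂ] Φ.space [b] →ₗ[ℂ] ℂ :=
  (TensorProduct.mk ℂ (Φ.space [a]) (Φ.space [b])).compr₂
    (Φ.unitEquiv.symm.toLinearEquiv.toLinearMap ∘ₗ Φ.act D ∘ₗ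
      (Φ.mulEquiv [a] [b]).toLinearEquiv.toLinearMap)

theorem formMatrix_eq_bilinMatrix (Φ : UnitaryFiberFunctor d) {m n : ℕ}
    (w : OrthonormalBasis (Fin m) ℂ (Φ.space [false]))
    (v : OrthonormalBasis (Fin n) ℂ (Φ.space [true])) :
    Φ.formMatrix w v = bilinMatrix (Φ.formMap (Diagram.arc false)) w v :=
  Φ.formMatrix_eq w v

theorem absEigenvalues_formMatrix (Φ : UnitaryFiberFunctor d) {m n m' n' : ℕ}
    (w : OrthonormalBasis (Fin m) ℂ (Φ.space [false]))
    (v : OrthonormalBasis (Fin n) ℂ (Φ.space [true]))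
    (w' : OrthonormalBasis (Fin m') ℂ (Φ.space [false]))
    (v' : OrthonormalBasis (Fin n') ℂ (Φ.space [true])) :
    absEigenvalues (Φ.formMatrix w v) = absEigenvalues (Φ.formMatrix w' v') := by
  have hn : n = n' := by
    have h1 := Module.finrank_eq_card_basis v.toBasis
    have h2 := Module.finrank_eq_card_basis v'.toBasis
    rw [Fintype.card_fin] at h1 h2
    exact h1.symm.trans h2
  subst hn
  rw [absEigenvalues_eq_roots, absEigenvalues_eq_roots, formMatrix_eq_bilinMatrix,
    formMatrix_eq_bilinMatrix, charpoly_bilinMatrix _ w w' v v']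

theorem norm_csign_zpow (hd : d ≠ 0) (k : ℤ) : ‖csign d ^ k‖ = 1 := by
  rw [norm_zpow, norm_csign hd, one_zpow]

/-- A matrix of the form given by `X* ⊗ X ⟶ I` is invertible, because of the zigzag relations. -/
theorem formMatrix_invertible (hd : d ≠ 0) (Φ : UnitaryFiberFunctor d) {m n : ℕ}
    (w : OrthonormalBasis (Fin m) ℂ (Φ.space [false]))
    (v : OrthonormalBasis (Fin n) ℂ (Φ.space [true])) :
    m = n ∧ Function.Injective (bilinMatrix (Φ.formMap (Diagram.arc false)) w v).mulVec := by
  set B := bilinMatrix (Φ.formMap (Diagram.arc false)) w v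
  let A : Matrix (Fin n) (Fin m) ℂ :=
    Matrix.of fun i j => starRingEnd ℂ (Φ.form (Diagram.arc true) (v i) (w j))
  obtain ⟨c, hc0, hc⟩ : ∃ c : ℂ, c ≠ 0 ∧ B * A = c • (1 : Matrix _ _ ℂ) := by
    refine ⟨csign d ^ ((Diagram.id [false]).tensor (Diagram.arc true)).sharp, ?_, ?_⟩
    · exact norm_ne_zero_iff.1 (by rw [norm_csign_zpow hd]; exact one_ne_zero)
    · ext l k
      rw [Matrix.mul_apply, Matrix.smul_apply, Matrix.one_apply]
      refine (Φ.sum_form_mul_star_form (Diagram.arc false) (Diagram.arc true) w v l k).trans ?_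
      by_cases h : l = k
      · rw [if_pos h, if_pos h, smul_eq_mul, mul_one]
      · rw [if_neg h, if_neg h, smul_zero]
  obtain ⟨c', hc0', hc'⟩ : ∃ c : ℂ, c ≠ 0 ∧ A * B = c • (1 : Matrix _ _ ℂ) := by
    refine ⟨starRingEnd ℂ (csign d ^ ((Diagram.id [true]).tensor (Diagram.arc false)).sharp),
      ?_, ?_⟩
    · rw [Ne, map_eq_zero]
      exact norm_ne_zero_iff.1 (by rw [norm_csign_zpow hd]; exact one_ne_zero)
    · ext l k
      rw [Matrix.mul_apply, Matrix.smul_apply, Matrix.one_apply]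
      have h := congrArg (starRingEnd ℂ)
        (Φ.sum_form_mul_star_form (Diagram.arc true) (Diagram.arc false) v w l k)
      rw [map_sum] at h
      simp only [map_mul, Complex.conj_conj] at h
      refine h.trans ?_
      by_cases h : l = k
      · rw [if_pos h, if_pos h, smul_eq_mul, mul_one]
      · rw [if_neg h, if_neg h, smul_zero, map_zero]
  have hAB : (c'⁻¹ • A) * B = 1 := by
    rw [Matrix.smul_mul, hc', smul_smul, inv_mul_cancel₀ hc0', one_smul]
  have hBA : B * (c⁻¹ • A) = 1 := by
    rw [Matrix.mul_smul, hc, smul_smul, inv_mul_cancel₀ hc0, one_smul]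
  have hA : c⁻¹ • A = c'⁻¹ • A := by
    have h := congrArg ((c'⁻¹ • A) * ·) hBA
    simp only [← Matrix.mul_assoc] at h
    rwa [hAB, Matrix.one_mul, Matrix.mul_one] at h
  constructor
  · have h := Matrix.square_of_invertible B (c⁻¹ • A) hBA (by rw [hA, hAB])
    simpa using h
  · refine Function.LeftInverse.injective (g := (c'⁻¹ • A).mulVec) fun x => ?_
    rw [Matrix.mulVec_mulVec, hAB, Matrix.one_mulVec]

/-- Every fiber functor has orthonormal bases in which the matrix of the form is diagonal with
positive entries. -/
theorem exists_formMatrix_diagonal (hd : d ≠ 0) (Φ : UnitaryFiberFunctor d) :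
    ∃ (n : ℕ) (μ : Fin n → ℝ)
      (w : OrthonormalBasis (Fin n) ℂ (Φ.space [false]))
      (v : OrthonormalBasis (Fin n) ℂ (Φ.space [true])),
      (∀ i, 0 < μ i) ∧ Φ.formMatrix w v = (Matrix.diagonal fun i => (μ i : ℂ)) := by
  let w := stdOrthonormalBasis ℂ (Φ.space [false])
  let v := stdOrthonormalBasis ℂ (Φ.space [true])
  obtain ⟨hmn, hB⟩ := Φ.formMatrix_invertible hd w v
  obtain ⟨μ, w', v', hμ, h⟩ := exists_bilinMatrix_diagonal (Φ.formMap (Diagram.arc false)) w v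
    (by rw [Fintype.card_fin, Fintype.card_fin, hmn]) hB
  exact ⟨_, μ, w', v', hμ, (Φ.formMatrix_eq_bilinMatrix w' v').trans h⟩

/-- If the matrix of the arc `X* ⊗ X ⟶ I` is diagonal, then so is the matrix of the arc
`X ⊗ X* ⟶ I`, and it has the inverse entries up to a scalar that depends only on `d`. -/
theorem form_arc_true (Φ : UnitaryFiberFunctor d) {n : ℕ} {μ : Fin n → ℝ}
    (hμ : ∀ i, 0 < μ i)
    {w : OrthonormalBasis (Fin n) ℂ (Φ.space [false])}
    {v : OrthonormalBasis (Fin n) ℂ (Φ.space [true])}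
    (h : Φ.formMatrix w v = (Matrix.diagonal fun i => (μ i : ℂ))) (i j : Fin n) :
    Φ.form (Diagram.arc true) (v i) (w j) =
      if i = j then csign d ^ ((Diagram.id [true]).tensor (Diagram.arc false)).sharp *
        (μ i : ℂ)⁻¹ else 0 := by
  have hf : ∀ j k, Φ.form (Diagram.arc false) (w j) (v k) = if j = k then (μ j : ℂ) else 0 := by
    intro j k
    have h := congrFun (congrFun h j) k
    rw [formMatrix_eq, Matrix.of_apply, Matrix.diagonal_apply] at h
    exact h
  have hz := Φ.sum_form_mul_star_form (Diagram.arc true) (Diagram.arc false) v w i j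
  have hμ0 : (μ j : ℂ) ≠ 0 := Complex.ofReal_ne_zero.2 (hμ j).ne'
  have hs : ∀ k, Φ.form (Diagram.arc true) (v i) (w k) *
      starRingEnd ℂ (Φ.form (Diagram.arc false) (w k) (v j)) =
      if k = j then Φ.form (Diagram.arc true) (v i) (w j) * (μ j : ℂ) else 0 := by
    intro k
    rw [hf]
    by_cases hk : k = j
    · subst hk
      rw [if_pos rfl, if_pos rfl, Complex.conj_ofReal]
    · rw [if_neg hk, if_neg hk, map_zero, mul_zero]
  rw [Finset.sum_congr rfl fun k _ => hs k, Finset.sum_ite_eq', if_pos (Finset.mem_univ _)] at hz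
  rw [(eq_mul_inv_iff_mul_eq₀ hμ0).2 hz]
  by_cases hij : i = j
  · subst hij
    rw [if_pos rfl, if_pos rfl]
  · rw [if_neg hij, if_neg hij, zero_mul]

/-- The loop relations: `∑ μⱼ²` and `∑ μⱼ⁻²` are the squared norms of the two arcs. -/
theorem sum_eigenvalues (hd : d ≠ 0) (Φ : UnitaryFiberFunctor d) {n : ℕ} {μ : Fin n → ℝ}
    (hμ : ∀ i, 0 < μ i)
    {w : OrthonormalBasis (Fin n) ℂ (Φ.space [false])}
    {v : OrthonormalBasis (Fin n) ℂ (Φ.space [true])}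
    (h : Φ.formMatrix w v = (Matrix.diagonal fun i => (μ i : ℂ))) :
    ∑ i, μ i ^ 2 = |d| ∧ ∑ i, (μ i ^ 2)⁻¹ = |d| := by
  constructor
  · rw [← Φ.sum_norm_form hd (Diagram.arc false) w v]
    refine Finset.sum_congr rfl fun i _ => ?_
    have hf : ∀ k, ‖Φ.form (Diagram.arc false) (w i) (v k)‖ ^ 2 =
        if i = k then μ i ^ 2 else 0 := by
      intro k
      have h := congrFun (congrFun h i) k
      rw [formMatrix_eq, Matrix.of_apply, Matrix.diagonal_apply] at h
      rw [h]
      by_cases hik : i = k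
      · rw [if_pos hik, if_pos hik, Complex.norm_real, Real.norm_eq_abs, sq_abs]
      · rw [if_neg hik, if_neg hik]
        simp
    refine ((Finset.sum_congr rfl fun k _ => hf k).trans ?_).symm
    rw [Finset.sum_ite_eq, if_pos (Finset.mem_univ _)]
  · rw [← Φ.sum_norm_form hd (Diagram.arc true) v w]
    refine Finset.sum_congr rfl fun i _ => ?_
    have hf : ∀ k, ‖Φ.form (Diagram.arc true) (v i) (w k)‖ ^ 2 =
        if i = k then (μ i ^ 2)⁻¹ else 0 := by
      intro k
      rw [Φ.form_arc_true hμ h]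
      by_cases hik : i = k
      · rw [if_pos hik, if_pos hik, norm_mul, norm_csign_zpow hd, one_mul, norm_inv,
          Complex.norm_real, Real.norm_eq_abs, inv_pow, sq_abs]
      · rw [if_neg hik, if_neg hik]
        simp
    refine ((Finset.sum_congr rfl fun k _ => hf k).trans ?_).symm
    rw [Finset.sum_ite_eq, if_pos (Finset.mem_univ _)]

/-- Equivalent fiber functors have the same form matrices in corresponding bases. -/
theorem Equivalent.exists_formMatrix_eq {Φ Ψ : UnitaryFiberFunctor d} (h : Φ.Equivalent Ψ)
    {m n : ℕ} (w : OrthonormalBasis (Fin m) ℂ (Φ.space [false]))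
    (v : OrthonormalBasis (Fin n) ℂ (Φ.space [true])) :
    ∃ (w' : OrthonormalBasis (Fin m) ℂ (Ψ.space [false]))
      (v' : OrthonormalBasis (Fin n) ℂ (Ψ.space [true])),
      Ψ.formMatrix w' v' = Φ.formMatrix w v := by
  obtain ⟨η, hη, hu⟩ := h
  let E : ∀ u, Φ.space u ≃ₗᵢ[ℂ] Ψ.space u := fun u => (hu ⟨u⟩).equiv
  refine ⟨w.map (E [false]), v.map (E [true]), ?_⟩
  ext j i
  rw [formMatrix_eq, formMatrix_eq, Matrix.of_apply, Matrix.of_apply, OrthonormalBasis.map_apply,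
    OrthonormalBasis.map_apply, form, LinearIsometryEquiv.symm_apply_eq]
  have h1 : Ψ.mul (E [false] (w j)) (E [true] (v i)) = E [false, true] (Φ.mul (w j) (v i)) :=
    (LinearMap.congr_fun (hη.tensor (Kauffman.Xdual d) (Kauffman.X d)) (w j ⊗ₜ[ℂ] v i)).symm
  have h2 : Ψ.act (Diagram.arc false) (E [false, true] (Φ.mul (w j) (v i))) =
      E [] (Φ.act (Diagram.arc false) (Φ.mul (w j) (v i))) :=
    (LinearMap.congr_fun (η.hom.naturality (Kauffman.epsilonXdual (d : ℂ)))
      (Φ.mul (w j) (v i))).symm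
  have h3 : ∀ z, E [] (Φ.unitEquiv z) = Ψ.unitEquiv z := fun z => LinearMap.congr_fun hη.unit z
  rw [← h3]
  refine (congrArg _ h1).trans (h2.trans ?_)
  exact congrArg _ (Φ.act_mul_letters _ _ _)

end UnitaryFiberFunctor

end OrientedKauffman

namespace OrientedKauffman
open CategoryTheory MonoidalCategory TensorProduct

/-! ### Fiber functors are determined by their forms -/

namespace UnitaryFiberFunctor

variable {d : ℝ} {Φ Ψ : UnitaryFiberFunctor d}

/-- The space of a juxtaposition is spanned by products. -/
theorem mul_induction {w u : Word} {p : Φ.space (w ++ u) → Prop}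
    (hmul : ∀ x y, p (Φ.mul x y)) (hadd : ∀ x y, p x → p y → p (x + y)) (x : Φ.space (w ++ u)) :
    p x := by
  obtain ⟨t, rfl⟩ := (Φ.mulEquiv w u).surjective x
  induction t using TensorProduct.induction_on with
  | zero =>
    have h := hmul 0 0
    rwa [mul, TensorProduct.tmul_zero] at h
  | tmul x y => exact hmul x y
  | add x y hx hy =>
    rw [map_add]
    exact hadd _ _ hx hy

theorem add_mul {w u : Word} (x x' : Φ.space w) (y : Φ.space u) :
    Φ.mul (x + x') y = Φ.mul x y + Φ.mul x' y := by
  rw [mul, TensorProduct.add_tmul, map_add]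
  rfl

/-- The extension of isometries between the spaces attached to the letters to all words, by
recursion on the first letter. -/
noncomputable def extend (u : ∀ a, Φ.space [a] ≃ₗᵢ[ℂ] Ψ.space [a]) :
    ∀ w, Φ.space w ≃ₗᵢ[ℂ] Ψ.space w
  | [] => Φ.unitEquiv.symm.trans Ψ.unitEquiv
  | a :: w => (Φ.mulEquiv [a] w).symm.trans
      ((TensorProduct.congrIsometry (u a) (extend u w)).trans (Ψ.mulEquiv [a] w))

variable (u : ∀ a, Φ.space [a] ≃ₗᵢ[ℂ] Ψ.space [a])

theorem extend_nil (z : ℂ) : extend u [] (Φ.unitEquiv z) = Ψ.unitEquiv z := by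
  rw [extend, LinearIsometryEquiv.trans_apply, LinearIsometryEquiv.symm_apply_apply]

theorem extend_cons (a : Bool) {w : Word} (x : Φ.space [a]) (y : Φ.space w) :
    extend u (a :: w) (Φ.mul x y) = Ψ.mul (u a x) (extend u w y) := by
  have h : (Φ.mulEquiv [a] w).symm (Φ.mul x y) = x ⊗ₜ[ℂ] y :=
    LinearIsometryEquiv.symm_apply_apply _ _
  exact congrArg (fun t => Ψ.mulEquiv [a] w (TensorProduct.congrIsometry (u a) (extend u w) t)) h

theorem extend_letter (a : Bool) (x : Φ.space [a]) : extend u [a] x = u a x := by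
  have h := extend_cons u a x (Φ.unitEquiv 1)
  rw [extend_nil] at h
  have h1 := Φ.mul_unit a 1 x
  have h2 := Ψ.mul_unit a 1 (u a x)
  rw [one_smul] at h1 h2
  exact (congrArg (extend u [a]) h1.symm).trans (h.trans h2)

theorem extend_mul : ∀ (w : Word) {w' : Word} (x : Φ.space w) (y : Φ.space w'),
    extend u (w ++ w') (Φ.mul x y) = Ψ.mul (extend u w x) (extend u w' y)
  | [], w', x, y => by
    obtain ⟨z, rfl⟩ := Φ.unitEquiv.surjective x
    rw [extend_nil]
    refine (congrArg (extend u w') (Φ.unit_mul z y)).trans ?_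
    rw [map_smul]
    exact (Ψ.unit_mul z _).symm
  | a :: w, w', x, y => by
    refine mul_induction (Φ := Φ) (w := [a]) (u := w)
      (p := fun x => extend u (a :: (w ++ w')) (Φ.mul (w := a :: w) x y) =
        Ψ.mul (extend u (a :: w) x) (extend u w' y)) ?_ ?_ x
    · intro p q
      refine (congrArg (extend u (a :: (w ++ w'))) (Φ.mul_assoc_letter a p q y)).trans ?_
      rw [extend_cons, extend_mul w q y]
      refine (Ψ.mul_assoc_letter a (u a p) (extend u w q) (extend u w' y)).symm.trans ?_
      exact congrArg (fun t => Ψ.mul (w := a :: w) t (extend u w' y)) (extend_cons u a p q).symm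
    · intro p q hp hq
      refine (congrArg (extend u (a :: (w ++ w'))) (Φ.add_mul (w := a :: w) p q y)).trans ?_
      rw [map_add, hp, hq]
      refine (Ψ.add_mul _ _ _).symm.trans ?_
      exact congrArg (fun t => Ψ.mul (w := a :: w) t (extend u w' y))
        (map_add (extend u (a :: w)) p q).symm

variable {u}

/-- Naturality of the extension with respect to a diagram. -/
def Intertwines (u : ∀ a, Φ.space [a] ≃ₗᵢ[ℂ] Ψ.space [a]) {w w' : Word} (D : Diagram w w') :
    Prop :=
  ∀ x, extend u w' (Φ.act D x) = Ψ.act D (extend u w x)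

theorem intertwines_id (w : Word) : Intertwines u (Diagram.id w) := fun x => by
  rw [act_id, act_id]
  rfl

theorem Intertwines.tensor {w₀ w₁ v₀ v₁ : Word} {D : Diagram w₀ w₁} {E : Diagram v₀ v₁}
    (hD : Intertwines u D) (hE : Intertwines u E) : Intertwines u (D.tensor E) := by
  refine mul_induction (fun x y => ?_) fun x y hx hy => ?_
  · rw [act_tensor, extend_mul, extend_mul, hD, hE, act_tensor]
  · rw [map_add, map_add, hx, hy, map_add, map_add]

theorem Intertwines.comp {w₀ w₁ w₂ : Word} {D : Diagram w₀ w₁} {E : Diagram w₁ w₂}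
    (hD : Intertwines u D) (hE : Intertwines u E) (h : D.loops E = 0) :
    Intertwines u (D.comp E) := by
  intro x
  have h1 := Φ.act_comp D E x
  have h2 := Ψ.act_comp D E (extend u w₀ x)
  rw [h, pow_zero, one_smul] at h1 h2
  rw [← h1, ← h2, hE, hD]

/-- An isometry that is natural for a diagram is natural for its adjoint, which is a multiple of the
reflected diagram. -/
theorem Intertwines.reflect (hd : d ≠ 0) {w w' : Word} {D : Diagram w w'}
    (hD : Intertwines u D) : Intertwines u D.reflect := by
  have hs : csign d ^ D.sharp ≠ 0 :=
    zpow_ne_zero _ (norm_ne_zero_iff.1 (by rw [norm_csign hd]; exact one_ne_zero))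
  have hadj : ∀ x, extend u w (LinearMap.adjoint (Φ.act D) x) =
      LinearMap.adjoint (Ψ.act D) (extend u w' x) := by
    intro x
    refine ext_inner_right ℂ fun y => ?_
    obtain ⟨y, rfl⟩ := (extend u w).surjective y
    rw [LinearIsometryEquiv.inner_map_map, LinearMap.adjoint_inner_left,
      LinearMap.adjoint_inner_left, ← hD, LinearIsometryEquiv.inner_map_map]
  intro x
  have h := hadj x
  rw [adjoint_act, adjoint_act, LinearMap.smul_apply, LinearMap.smul_apply, map_smul] at h
  exact smul_right_injective _ hs h

/-- An isometry that is compatible with the forms given by the two arcs is natural. -/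
theorem intertwines (hd : d ≠ 0)
    (hu : ∀ a x y, Ψ.form (Diagram.arc a) (u a x) (u (!a) y) = Φ.form (Diagram.arc a) x y)
    {w w' : Word} (D : Diagram w w') : Intertwines u D := by
  have harc : ∀ a, Intertwines u (Diagram.arc a) := by
    intro a
    refine mul_induction (Φ := Φ) (w := [a]) (u := [!a]) (fun x y => ?_) fun x y hx hy => ?_
    · rw [act_mul_letters, extend_nil, ← hu, ← act_mul_letters]
      refine congrArg (Ψ.act (Diagram.arc a)) ?_
      refine Eq.trans ?_ (extend_cons u a x y).symm
      rw [extend_letter]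
    · rw [map_add, map_add, hx, hy]
      exact ((congrArg (Ψ.act (Diagram.arc a)) (map_add (extend u [a, !a]) x y)).trans
        (map_add _ _ _)).symm
  have hcap : ∀ v b v', Intertwines u (Diagram.cap v b v') := fun v b v' =>
    (intertwines_id v).tensor ((harc b).tensor (intertwines_id v'))
  refine Diagram.generation (C := fun _ _ D => Intertwines u D) intertwines_id ?_ ?_ w w' D
  · intro v b v' w' D hD
    exact (hcap v b v').comp hD ((Diagram.cap_isCap v b v').loops_left D)
  · intro v b v' w D hD
    exact hD.comp ((hcap v b v').reflect hd) ((Diagram.cap_isCap v b v').loops_reflect D)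

/-- Isometries between the spaces attached to the letters that are compatible with the forms
given by the two arcs extend to an equivalence of fiber functors. -/
theorem equivalent_of_form (hd : d ≠ 0)
    (hu : ∀ a x y, Ψ.form (Diagram.arc a) (u a x) (u (!a) y) = Φ.form (Diagram.arc a) x y) :
    Φ.Equivalent Ψ := by
  have hnat : ∀ {X Y : Kauffman (d : ℂ)} (f : X ⟶ Y),
      Φ.toFunctor.map f ≫ (FdHilb.isoOf (V := Φ.space Y.word) (W := Ψ.space Y.word)
        (extend u Y.word).toLinearEquiv).hom =
      (FdHilb.isoOf (V := Φ.space X.word) (W := Ψ.space X.word)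
        (extend u X.word).toLinearEquiv).hom ≫ Ψ.toFunctor.map f := by
    intro X Y f
    refine Finsupp.induction_linear (motive := fun f : Diagram X.word Y.word →₀ ℂ =>
      Φ.toFunctor.map (show X ⟶ Y from f) ≫ (FdHilb.isoOf (V := Φ.space Y.word)
        (W := Ψ.space Y.word) (extend u Y.word).toLinearEquiv).hom =
      (FdHilb.isoOf (V := Φ.space X.word) (W := Ψ.space X.word)
        (extend u X.word).toLinearEquiv).hom ≫ Ψ.toFunctor.map (show X ⟶ Y from f)) f ?_ ?_ ?_
    · have h1 : Φ.toFunctor.map (0 : X ⟶ Y) = 0 := Functor.map_zero _ _ _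
      have h2 : Ψ.toFunctor.map (0 : X ⟶ Y) = 0 := Functor.map_zero _ _ _
      refine (congrArg (· ≫ _) h1).trans (Eq.trans ?_ (congrArg (_ ≫ ·) h2).symm)
      exact Limits.zero_comp.trans Limits.comp_zero.symm
    · intro f g hf hg
      have h1 : Φ.toFunctor.map (show X ⟶ Y from f + g) = Φ.toFunctor.map (show X ⟶ Y from f) +
          Φ.toFunctor.map (show X ⟶ Y from g) := Functor.map_add _
      have h2 : Ψ.toFunctor.map (show X ⟶ Y from f + g) = Ψ.toFunctor.map (show X ⟶ Y from f) +
          Ψ.toFunctor.map (show X ⟶ Y from g) := Functor.map_add _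
      rw [h1, h2]
      refine (Preadditive.add_comp _ _ _ _ _ _).trans ?_
      rw [hf, hg]
      exact (Preadditive.comp_add _ _ _ _ _ _).symm
    · intro D a
      have h0 : (Finsupp.single D a : Diagram X.word Y.word →₀ ℂ) =
          a • Finsupp.single D 1 := by rw [Finsupp.smul_single', mul_one]
      have h1 : Φ.toFunctor.map (show X ⟶ Y from Finsupp.single D a) =
          a • Φ.toFunctor.map (Kauffman.ofDiagram D) :=
        (congrArg (fun f : X ⟶ Y => Φ.toFunctor.map f) h0).trans (Functor.map_smul _ _ _)
      have h2 : Ψ.toFunctor.map (show X ⟶ Y from Finsupp.single D a) =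
          a • Ψ.toFunctor.map (Kauffman.ofDiagram D) :=
        (congrArg (fun f : X ⟶ Y => Ψ.toFunctor.map f) h0).trans (Functor.map_smul _ _ _)
      rw [h1, h2]
      refine (Linear.smul_comp _ _ _ _ _ _).trans ?_
      refine Eq.trans ?_ (Linear.comp_smul _ _ _ _ _ _).symm
      refine congrArg (a • ·) (LinearMap.ext fun x => ?_)
      exact intertwines hd hu D x
  refine ⟨NatIso.ofComponents (fun X => FdHilb.isoOf (V := Φ.space X.word)
    (W := Ψ.space X.word) (extend u X.word).toLinearEquiv) hnat, ⟨?_, fun X Y => ?_⟩, fun X => ?_⟩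
  · exact LinearMap.ext fun z => extend_nil u z
  · exact TensorProduct.ext' fun x y => extend_mul u X.word x y
  · exact FdHilb.isUnitary_isoOf (V := Φ.space X.word) (W := Ψ.space X.word) (extend u X.word)

/-- Fiber functors whose forms have the same diagonal matrix in suitable bases are equivalent. -/
theorem equivalent_of_formMatrix_eq (hd : d ≠ 0) {n : ℕ} {μ : Fin n → ℝ} (hμ : ∀ i, 0 < μ i)
    {w : OrthonormalBasis (Fin n) ℂ (Φ.space [false])}
    {v : OrthonormalBasis (Fin n) ℂ (Φ.space [true])}
    {w' : OrthonormalBasis (Fin n) ℂ (Ψ.space [false])}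
    {v' : OrthonormalBasis (Fin n) ℂ (Ψ.space [true])}
    (h : Φ.formMatrix w v = (Matrix.diagonal fun i => (μ i : ℂ)))
    (h' : Ψ.formMatrix w' v' = (Matrix.diagonal fun i => (μ i : ℂ))) : Φ.Equivalent Ψ := by
  let u : ∀ a, Φ.space [a] ≃ₗᵢ[ℂ] Ψ.space [a] := fun a =>
    match a with
    | false => w.equiv w' (Equiv.refl _)
    | true => v.equiv v' (Equiv.refl _)
  have hw : ∀ i, u false (w i) = w' i := fun i => w.equiv_apply_basis w' (Equiv.refl _) i
  have hv : ∀ i, u true (v i) = v' i := fun i => v.equiv_apply_basis v' (Equiv.refl _) i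
  have h1 : (Ψ.formMap (Diagram.arc false)).compl₁₂ (u false).toLinearEquiv.toLinearMap
      (u true).toLinearEquiv.toLinearMap = Φ.formMap (Diagram.arc false) := by
    refine w.toBasis.ext fun i => v.toBasis.ext fun j => ?_
    rw [OrthonormalBasis.coe_toBasis, OrthonormalBasis.coe_toBasis]
    refine (congrArg₂ (Ψ.form (Diagram.arc false)) (hw i) (hv j)).trans ?_
    have e := congrFun (congrFun (h'.trans h.symm) i) j
    rw [formMatrix_eq, formMatrix_eq] at e
    exact e
  have h2 : (Ψ.formMap (Diagram.arc true)).compl₁₂ (u true).toLinearEquiv.toLinearMap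
      (u false).toLinearEquiv.toLinearMap = Φ.formMap (Diagram.arc true) := by
    refine v.toBasis.ext fun i => w.toBasis.ext fun j => ?_
    rw [OrthonormalBasis.coe_toBasis, OrthonormalBasis.coe_toBasis]
    refine (congrArg₂ (Ψ.form (Diagram.arc true)) (hv i) (hw j)).trans ?_
    exact (Ψ.form_arc_true hμ h' i j).trans (Φ.form_arc_true hμ h i j).symm
  refine equivalent_of_form (u := u) hd fun a => ?_
  cases a
  · exact fun x y => LinearMap.congr_fun₂ h1 x y
  · exact fun x y => LinearMap.congr_fun₂ h2 x y

end UnitaryFiberFunctor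

end OrientedKauffman

namespace OrientedKauffman

/-! ### The classification -/

/-- Two families with the same values, counted with multiplicities, differ by a permutation. -/
theorem exists_perm_of_map_eq {n : ℕ} {μ μ' : Fin n → ℝ}
    (h : Finset.univ.val.map μ = Finset.univ.val.map μ') : ∃ σ : Equiv.Perm (Fin n), μ = μ' ∘ σ := by
  rw [Fin.univ_val_map, Fin.univ_val_map, Multiset.coe_eq_coe] at h
  have h1 := ((Tuple.sort μ).ofFn_comp_perm μ).trans
    (h.trans ((Tuple.sort μ').ofFn_comp_perm μ').symm)
  have h2 : μ ∘ Tuple.sort μ = μ' ∘ Tuple.sort μ' := List.ofFn_injective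
    (h1.eq_of_sortedLE (Tuple.monotone_sort μ).sortedLE_ofFn (Tuple.monotone_sort μ').sortedLE_ofFn)
  refine ⟨(Tuple.sort μ).symm.trans (Tuple.sort μ'), funext fun i => ?_⟩
  have h3 := congrFun h2 ((Tuple.sort μ).symm i)
  simpa using h3

namespace UnitaryFiberFunctor

variable {d : ℝ}

/-- The eigenvalues of `|B|` for the form matrix `B` of a fiber functor in the standard choice of
orthonormal bases. -/
noncomputable def eigenvalues (Φ : UnitaryFiberFunctor d) : Multiset ℝ :=
  absEigenvalues (Φ.formMatrix (stdOrthonormalBasis ℂ (Φ.space [false]))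
    (stdOrthonormalBasis ℂ (Φ.space [true])))

theorem eigenvalues_eq (Φ : UnitaryFiberFunctor d) {m n : ℕ}
    (w : OrthonormalBasis (Fin m) ℂ (Φ.space [false]))
    (v : OrthonormalBasis (Fin n) ℂ (Φ.space [true])) :
    Φ.eigenvalues = absEigenvalues (Φ.formMatrix w v) :=
  Φ.absEigenvalues_formMatrix _ _ w v

theorem eigenvalues_eq_of_diagonal (Φ : UnitaryFiberFunctor d) {n : ℕ} {μ : Fin n → ℝ}
    (hμ : ∀ i, 0 < μ i) {w : OrthonormalBasis (Fin n) ℂ (Φ.space [false])}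
    {v : OrthonormalBasis (Fin n) ℂ (Φ.space [true])}
    (h : Φ.formMatrix w v = (Matrix.diagonal fun i => (μ i : ℂ))) :
    Φ.eigenvalues = Finset.univ.val.map μ := by
  rw [Φ.eigenvalues_eq w v, h, absEigenvalues_diagonal hμ]

theorem Equivalent.eigenvalues_eq {Φ Ψ : UnitaryFiberFunctor d} (h : Φ.Equivalent Ψ) :
    Φ.eigenvalues = Ψ.eigenvalues := by
  obtain ⟨w, v, hwv⟩ := h.exists_formMatrix_eq (stdOrthonormalBasis ℂ (Φ.space [false]))
    (stdOrthonormalBasis ℂ (Φ.space [true]))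
  rw [Ψ.eigenvalues_eq w v, hwv, eigenvalues]

/-- The eigenvalues of a fiber functor as an eigenvalue list. -/
noncomputable def eigenvalueList (hd : d ≠ 0) (Φ : UnitaryFiberFunctor d) : EigenvalueList d :=
  ⟨Φ.eigenvalues, by
    obtain ⟨n, μ, w, v, hμ, h⟩ := Φ.exists_formMatrix_diagonal hd
    rw [Φ.eigenvalues_eq_of_diagonal hμ h]
    obtain ⟨h1, h2⟩ := Φ.sum_eigenvalues hd hμ h
    refine ⟨fun t ht => ?_, ?_, ?_⟩
    · obtain ⟨i, -, rfl⟩ := Multiset.mem_map.1 ht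
      exact hμ i
    · rw [Multiset.map_map]
      exact h1
    · rw [Multiset.map_map]
      exact h2⟩

/-- Fiber functors with the same eigenvalues are equivalent. -/
theorem equivalent_of_eigenvalues_eq (hd : d ≠ 0) {Φ Ψ : UnitaryFiberFunctor d}
    (h : Φ.eigenvalues = Ψ.eigenvalues) : Φ.Equivalent Ψ := by
  obtain ⟨n, μ, w, v, hμ, hΦ⟩ := Φ.exists_formMatrix_diagonal hd
  obtain ⟨n', μ', w', v', hμ', hΨ⟩ := Ψ.exists_formMatrix_diagonal hd
  rw [Φ.eigenvalues_eq_of_diagonal hμ hΦ, Ψ.eigenvalues_eq_of_diagonal hμ' hΨ] at h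
  obtain rfl : n = n' := by simpa using congrArg Multiset.card h
  obtain ⟨σ, hσ⟩ := exists_perm_of_map_eq h
  -- reordering the bases of the second functor gives the same diagonal matrix
  refine equivalent_of_formMatrix_eq (Φ := Φ) (Ψ := Ψ) hd hμ (w := w) (v := v)
    (w' := w'.reindex σ.symm) (v' := v'.reindex σ.symm) hΦ ?_
  ext j i
  have e := congrFun (congrFun hΨ (σ j)) (σ i)
  rw [formMatrix_eq, Matrix.of_apply, Matrix.diagonal_apply] at e
  rw [formMatrix_eq, Matrix.of_apply, OrthonormalBasis.reindex_apply,
    OrthonormalBasis.reindex_apply, Matrix.diagonal_apply, hσ]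
  refine e.trans ?_
  simp only [σ.apply_eq_iff_eq, Function.comp]

/-- Every eigenvalue list comes from a model functor. -/
theorem exists_eigenvalues_eq (hd : d ≠ 0) (l : EigenvalueList d) :
    ∃ Φ : UnitaryFiberFunctor d, Φ.eigenvalues = l.1 := by
  obtain ⟨s, hpos, h1, h2⟩ := l
  obtain ⟨n, μ, rfl⟩ : ∃ (n : ℕ) (μ : Fin n → ℝ), s = Finset.univ.val.map μ := by
    refine ⟨s.toList.length, s.toList.get, ?_⟩
    rw [Fin.univ_val_map, List.ofFn_get, Multiset.coe_toList]
  have hμ : ∀ i, 0 < μ i := fun i => hpos _ (Multiset.mem_map_of_mem μ (Finset.mem_univ i))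
  rw [Multiset.map_map] at h1 h2
  exact ⟨modelFunctor hd hμ h1 h2, eigenvalues_eq_of_diagonal (w := letterBasis n false)
    (v := letterBasis n true) _ hμ (formMatrix_modelFunctor hd hμ h1 h2)⟩

end UnitaryFiberFunctor

end OrientedKauffman

theorem theorem5p2 (d : ℝ) (hd : 4 ≤ d ^ 2) :
    ∃ e : Quotient (OrientedKauffman.UnitaryFiberFunctor.setoid d) ≃
        OrientedKauffman.EigenvalueList d,
      ∀ (Φ : OrientedKauffman.UnitaryFiberFunctor d) {m n : ℕ}
        (w : OrthonormalBasis (Fin m) ℂ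
          (Φ.toFunctor.obj (OrientedKauffman.Kauffman.Xdual (d : ℂ))))
        (v : OrthonormalBasis (Fin n) ℂ
          (Φ.toFunctor.obj (OrientedKauffman.Kauffman.X (d : ℂ)))),
        (e (Quotient.mk _ Φ)).1 = OrientedKauffman.absEigenvalues (Φ.formMatrix w v) := by
  have hd0 : d ≠ 0 := by
    rintro rfl
    norm_num at hd
  refine ⟨Equiv.ofBijective (Quotient.lift
    (OrientedKauffman.UnitaryFiberFunctor.eigenvalueList hd0)
    fun Φ Ψ h => Subtype.ext (OrientedKauffman.UnitaryFiberFunctor.Equivalent.eigenvalues_eq h))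
    ⟨?_, ?_⟩, fun Φ m n w v => Φ.eigenvalues_eq w v⟩
  · intro p q
    induction p using Quotient.inductionOn with
    | h Φ =>
      induction q using Quotient.inductionOn with
      | h Ψ =>
        intro h
        exact Quotient.sound (OrientedKauffman.UnitaryFiberFunctor.equivalent_of_eigenvalues_eq
          hd0 (congrArg Subtype.val h))
  · intro l
    obtain ⟨Φ, hΦ⟩ := OrientedKauffman.UnitaryFiberFunctor.exists_eigenvalues_eq hd0 l
    exact ⟨Quotient.mk _ Φ, Subtype.ext hΦ⟩
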